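/- Notation. For $\sigma\in\mathbb R$, $1<p<\infty$ let $\mathbb W^\sigma_p(\mathbb R)=\mathbb B^\sigma_{p,p}(\mathbb R)$ be the Sobolev–Slobodeckii (Besov) space of tempered distributions $f$ with $\|f\|=\big(\sum_{j\ge0}(2^{j\sigma}\|\mathcal F^{-1}\varphi_j\mathcal Ff\|_{L_p})^p\big)^{1/p}<\infty$, where $(\varphi_j)$ is a smooth dyadic resolution of unity. For an open half-line $I$ let $\widetilde{\mathbb W}^\sigma_p(I)$ be the subspace of those $f\in\mathbb W^\sigma_p(\mathbb R)$ supported in $\overline I$, and let $\mathbb W^\sigma_p(I)$ be the space of restrictions to $I$ of elements of $\mathbb W^\sigma_p(\mathbb R)$, with the quotient norm. Put $\mathbb R^+=(0,\infty)$, $\mathbb R^-=(-\infty,0)$; $r_\pm$ is the restriction to $\mathbb R^\pm$. The mixed system of the half-plane is $$\tfrac12\varphi^0-r_+\mathbf W_0\varphi^0+r_+\mathbf V_{-1}\psi^0=G_1\ \text{ on }\mathbb R^+,\qquad \tfrac12\psi^0+r_-\mathbf W_0^*\psi^0-r_-\mathbf V_{+1}\varphi^0=H_1\ \text{ on }\mathbb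 R^-,\tag{A}$$ with $\varphi^0\in\widetilde{\mathbb W}^{s-1/p}_p(\mathbb R^+)$, $\psi^0\in\widetilde{\mathbb W}^{s-1-1/p}_p(\mathbb R^-)$, $G_1\in\mathbb W^{s-1/p}_p(\mathbb R^+)$, $H_1\in\mathbb W^{s-1-1/p}_p(\mathbb R^-)$. Here, with $\mathcal K(x)=\frac1{2\pi}\ln|x|$ on $\mathbb R^2$, $\mathbf V_{-1}v(t)=\frac1{2\pi}\int_{\mathbb R}\ln|t-\tau|\,v(\tau)\,d\tau$; $\mathbf W_0$ and $\mathbf W_0^*$ are the direct values on $\mathbb R=\partial\mathbb R^2_+$ of the integral operators whose kernels are the derivatives of $\mathcal K(t-\tau)$ along the outer normal $(0,-1)$ in the variable $\tau$, respectively $t$ (these kernels vanish, so that $\mathbf W_0=\mathbf W_0^*=0$); and $\mathbf V_{+1}v(t)=-v(t)+\frac1{2\pi}\,\mathrm{p.v.}\!\int_{\mathbb R}\frac{v'(\tau)}{t-\tau}\,d\tau$. The Mellin convolution system is $$\varphi+\mathbf K^1_{-1}\psi=G,\qquad \psi+\mathbf K^1_{-1}\varphi=H\quad\text{on }\mathbb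 R^+,\qquad \mathbf K^1_{-1}v(t)=\frac1\pi\int_0^\infty\frac{v(\tau)\,d\tau}{t+\tau},\tag{B}$$ with $\varphi,\psi\in\widetilde{\mathbb W}^{r-1}_p(\mathbb R^+)$, $G,H\in\mathbb W^{r-1}_p(\mathbb R^+)$. The operators are given by these formulas on $C_c^\infty$ functions in the respective open half-lines and are extended by continuity. A cut-off is a function in $C_c^\infty(\mathbb R)$ equal to $1$ near $0$. The operator $A$ of such a system, from the space $X$ of unknowns to the space $Y$ of right-hand sides, is called locally invertible at $0$ (locally Fredholm at $0$) if there are cut-offs $g,h$ such that $hAg:X\to Y$ is bounded and a bounded $L:Y\to X$ with $L\,(hAg)-gI$ compact in $X$, and there are cut-offs $g',h'$ such that $g'Ah':X\to Y$ is bounded and a bounded $R:Y\to X$ with $(g'Ah')\,R-g'I$ compact in $Y$. Lemma. Let $1<p<\infty$, $s>\frac1p$ and $r=s-\frac1p>0$. The system (A) is locally invertible at $0$ if and only if the system (B) is locally invertible at $0$. -/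

import Mathlib

open scoped ENNReal SchwartzMap ContDiff Topology

noncomputable section

/-! ### Besov (Sobolev–Slobodeckii) spaces `W^σ_p = B^σ_{p,p}` on the line -/

/-- A smooth even function equal to `1` on `[-1, 1]` and to `0` outside `[-√2, √2]`. -/
def lowPass (ξ : ℝ) : ℂ := (Real.smoothTransition (2 - ξ ^ 2) : ℂ)

/-- The smooth dyadic resolution of unity `(φ_j)` on the frequency line:
`φ_0 = lowPass` and `φ_j(ξ) = lowPass (2^{-j} ξ) - lowPass (2^{-j+1} ξ)` for `j ≥ 1`. -/
def dyadicCutoff : ℕ → ℝ → ℂ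
  | 0, ξ => lowPass ξ
  | j + 1, ξ => lowPass (ξ / 2 ^ (j + 1)) - lowPass (ξ / 2 ^ j)

/-- The Littlewood–Paley block `F⁻¹ φ_j F f` of a tempered distribution. -/
def dyadicBlock (j : ℕ) : 𝓢'(ℝ, ℂ) →L[ℂ] 𝓢'(ℝ, ℂ) :=
  TemperedDistribution.fourierMultiplierCLM ℂ (dyadicCutoff j)

/-- Sequences of `L_p` functions with `∑ ‖F_j‖_p ^ p < ∞`. -/
abbrev DyadicSeq (p : ℝ≥0∞) [Fact (1 ≤ p)] : Type :=
  lp (fun _ : ℕ => MeasureTheory.Lp ℂ p (MeasureTheory.volume : MeasureTheory.Measure ℝ)) p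

/-- The tempered distributions `f` whose weighted blocks `2^{jσ} F⁻¹ φ_j F f` are `L_p` functions
forming a `p`-summable sequence, that is, `∑_j (2^{jσ} ‖F⁻¹ φ_j F f‖_p) ^ p < ∞`. -/
def besovSubmodule (σ : ℝ) (p : ℝ≥0∞) [Fact (1 ≤ p)] : Submodule ℂ 𝓢'(ℝ, ℂ) where
  carrier := {f | ∃ F : DyadicSeq p, ∀ j : ℕ,
    (F j : 𝓢'(ℝ, ℂ)) = (((2 : ℝ) ^ ((j : ℝ) * σ) : ℝ) : ℂ) • dyadicBlock j f}
  zero_mem' := ⟨0, fun j => by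
    rw [map_zero]
    exact (map_zero (MeasureTheory.Lp.toTemperedDistributionCLM ℂ
      (MeasureTheory.volume : MeasureTheory.Measure ℝ) p)).trans (smul_zero _).symm⟩
  add_mem' := by
    rintro f g ⟨F, hF⟩ ⟨G, hG⟩
    refine ⟨F + G, fun j => ?_⟩
    have := map_add (MeasureTheory.Lp.toTemperedDistributionCLM ℂ
      (MeasureTheory.volume : MeasureTheory.Measure ℝ) p) (F j) (G j)
    simp only [MeasureTheory.Lp.toTemperedDistributionCLM_apply] at this
    rw [map_add, smul_add, ← hF, ← hG, ← this]
    rfl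
  smul_mem' := by
    rintro c f ⟨F, hF⟩
    refine ⟨c • F, fun j => ?_⟩
    have := map_smul (MeasureTheory.Lp.toTemperedDistributionCLM ℂ
      (MeasureTheory.volume : MeasureTheory.Measure ℝ) p) c (F j)
    simp only [MeasureTheory.Lp.toTemperedDistributionCLM_apply] at this
    rw [map_smul, smul_comm, ← hF, ← this]
    rfl

/-- The space `W^σ_p(ℝ) = B^σ_{p,p}(ℝ)`. -/
def Besov (σ : ℝ) (p : ℝ≥0∞) [Fact (1 ≤ p)] : Type := besovSubmodule σ p

namespace Besov

variable {σ : ℝ} {p : ℝ≥0∞} [Fact (1 ≤ p)]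

instance : AddCommGroup (Besov σ p) := inferInstanceAs (AddCommGroup (besovSubmodule σ p))

instance : Module ℂ (Besov σ p) := inferInstanceAs (Module ℂ (besovSubmodule σ p))

/-- The underlying tempered distribution. -/
def dist : Besov σ p →ₗ[ℂ] 𝓢'(ℝ, ℂ) := (besovSubmodule σ p).subtype

theorem toTempered_injective : Function.Injective
    (MeasureTheory.Lp.toTemperedDistributionCLM ℂ
      (MeasureTheory.volume : MeasureTheory.Measure ℝ) p) :=
  LinearMap.ker_eq_bot.mp MeasureTheory.Lp.ker_toTemperedDistributionCLM_eq_bot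

theorem blocks_exists (f : Besov σ p) : ∃ F : DyadicSeq p, ∀ j : ℕ,
    (F j : 𝓢'(ℝ, ℂ)) = (((2 : ℝ) ^ ((j : ℝ) * σ) : ℝ) : ℂ) • dyadicBlock j (dist f) := f.2

/-- The sequence of weighted Littlewood–Paley blocks `2^{jσ} F⁻¹ φ_j F f`, as `L_p` functions. -/
def blocksFun (f : Besov σ p) : DyadicSeq p := (blocks_exists f).choose

theorem blocksFun_spec (f : Besov σ p) (j : ℕ) :
    MeasureTheory.Lp.toTemperedDistributionCLM ℂ
      (MeasureTheory.volume : MeasureTheory.Measure ℝ) p (blocksFun f j)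
      = (((2 : ℝ) ^ ((j : ℝ) * σ) : ℝ) : ℂ) • dyadicBlock j (dist f) :=
  (blocks_exists f).choose_spec j

/-- `blocksFun` as a linear map. -/
def blocks : Besov σ p →ₗ[ℂ] DyadicSeq p where
  toFun := blocksFun
  map_add' f g := by
    apply lp.ext
    funext j
    apply toTempered_injective
    rw [lp.coeFn_add, Pi.add_apply, map_add, blocksFun_spec, blocksFun_spec, blocksFun_spec,
      map_add, map_add, smul_add]
  map_smul' c f := by
    apply lp.ext
    funext j
    apply toTempered_injective
    rw [lp.coeFn_smul, Pi.smul_apply, map_smul, blocksFun_spec, blocksFun_spec,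
      map_smul, map_smul, smul_comm, RingHom.id_apply]

/-- The norm `‖f‖ = (∑_j (2^{jσ} ‖F⁻¹ φ_j F f‖_p) ^ p) ^ (1/p)`. -/
instance : SeminormedAddCommGroup (Besov σ p) :=
  SeminormedAddCommGroup.induced (Besov σ p) (DyadicSeq p) (blocks (σ := σ) (p := p))

instance : NormedSpace ℂ (Besov σ p) :=
  NormedSpace.induced ℂ (Besov σ p) (DyadicSeq p) (blocks (σ := σ) (p := p))

/-- The elements that vanish, as distributions, on the open set `U`. -/
def vanishingOn (σ : ℝ) (p : ℝ≥0∞) [Fact (1 ≤ p)] (U : Set ℝ) : Submodule ℂ (Besov σ p) where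
  carrier := {f | Distribution.IsVanishingOn (dist f) U}
  zero_mem' := fun θ _ => by simp
  add_mem' := fun {f g} hf hg θ hθ => by
    have h1 := hf θ hθ
    have h2 := hg θ hθ
    rw [map_add]
    change dist f θ + dist g θ = 0
    rw [h1, h2, add_zero]
  smul_mem' := fun c f hf θ hθ => by
    have h1 := hf θ hθ
    rw [map_smul]
    change c • dist f θ = 0
    rw [h1, smul_zero]

end Besov

/-- The space `W̃^σ_p(I)` of the `f ∈ W^σ_p(ℝ)` supported in the closure of the open set `I`. -/
abbrev BesovTilde (σ : ℝ) (p : ℝ≥0∞) [Fact (1 ≤ p)] (I : Set ℝ) : Type :=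
  Besov.vanishingOn σ p (closure I)ᶜ

/-- The space `W^σ_p(I)` of restrictions to the open set `I` of elements of `W^σ_p(ℝ)`:
the quotient of `W^σ_p(ℝ)` by the elements vanishing on `I`, with the quotient norm. -/
abbrev BesovOn (σ : ℝ) (p : ℝ≥0∞) [Fact (1 ≤ p)] (I : Set ℝ) : Type :=
  Besov σ p ⧸ Besov.vanishingOn σ p I

/-- The restriction operator `W^σ_p(ℝ) → W^σ_p(I)`. -/
def Besov.restrict {σ : ℝ} {p : ℝ≥0∞} [Fact (1 ≤ p)] (I : Set ℝ) (f : Besov σ p) :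
    BesovOn σ p I :=
  Submodule.Quotient.mk f

/-! ### Test functions, distributions given by functions, cut-offs -/

/-- `φ ∈ C_c^∞(I)`. -/
structure IsTestFunctionOn (I : Set ℝ) (φ : ℝ → ℂ) : Prop where
  smooth : ContDiff ℝ ∞ φ
  compact : HasCompactSupport φ
  supp : tsupport φ ⊆ I

/-- On the open set `U` the distribution `f` is the function `F`. -/
def AgreesOn (U : Set ℝ) (f : 𝓢'(ℝ, ℂ)) (F : ℝ → ℂ) : Prop :=
  ∀ θ : 𝓢(ℝ, ℂ), HasCompactSupport θ → tsupport θ ⊆ U → f θ = ∫ t, θ t * F t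

/-- Smooth compactly supported functions that equal `1` in a neighbourhood of `0`. -/
structure IsCutoffAtZero (g : ℝ → ℂ) : Prop where
  smooth : ContDiff ℝ ∞ g
  compact : HasCompactSupport g
  eq_one : ∀ᶠ t in 𝓝 (0 : ℝ), g t = 1

/-! ### Two-by-two systems on half-lines and local invertibility -/

/-- A system `A(φ, ψ) = (G, H)` with `φ ∈ W̃^{σ₁}_p(I₁)`, `ψ ∈ W̃^{σ₂}_p(I₂)`,
`G ∈ W^{σ₁}_p(I₁)`, `H ∈ W^{σ₂}_p(I₂)`. The operator is given by its formula on the dense set of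
pairs `φ ∈ C_c^∞(I₁)`, `ψ ∈ C_c^∞(I₂)`; only the values on `I₁` and on `I₂` of the two components
of the result matter. -/
structure HalfLineSystem where
  /-- smoothness of the first unknown and of the first right-hand side -/
  σ₁ : ℝ
  /-- smoothness of the second unknown and of the second right-hand side -/
  σ₂ : ℝ
  /-- where the first equation is posed -/
  I₁ : Set ℝ
  /-- where the second equation is posed -/
  I₂ : Set ℝ
  /-- the operator -/
  op : (ℝ → ℂ) × (ℝ → ℂ) → (ℝ → ℂ) × (ℝ → ℂ)

namespace HalfLineSystem

variable (S : HalfLineSystem) (p : ℝ≥0∞) [Fact (1 ≤ p)]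

/-- The space `W̃^{σ₁}_p(I₁) × W̃^{σ₂}_p(I₂)` of unknowns. -/
abbrev Unknowns : Type := BesovTilde S.σ₁ p S.I₁ × BesovTilde S.σ₂ p S.I₂

/-- The space `W^{σ₁}_p(I₁) × W^{σ₂}_p(I₂)` of right-hand sides. -/
abbrev Data : Type := BesovOn S.σ₁ p S.I₁ × BesovOn S.σ₂ p S.I₂

variable {p}

/-- The bounded operator `T` is (the continuous extension of) `h A g`, the operator of the system
between multiplications by `g` and by `h`. -/
def IsLocalization (h g : ℝ → ℂ) (T : S.Unknowns p →L[ℂ] S.Data p) : Prop :=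
  ∀ φ ψ : ℝ → ℂ, IsTestFunctionOn S.I₁ φ → IsTestFunctionOn S.I₂ ψ →
  ∀ u : S.Unknowns p,
    AgreesOn Set.univ (Besov.dist (u.1 : Besov S.σ₁ p)) φ →
    AgreesOn Set.univ (Besov.dist (u.2 : Besov S.σ₂ p)) ψ →
    ∃ (y₁ : Besov S.σ₁ p) (y₂ : Besov S.σ₂ p),
      T u = (y₁.restrict S.I₁, y₂.restrict S.I₂) ∧
      AgreesOn S.I₁ (Besov.dist y₁)
        (fun t => h t * (S.op (fun τ => g τ * φ τ, fun τ => g τ * ψ τ)).1 t) ∧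
      AgreesOn S.I₂ (Besov.dist y₂)
        (fun t => h t * (S.op (fun τ => g τ * φ τ, fun τ => g τ * ψ τ)).2 t)

/-- `M` is the operator of multiplication by `g` on the space of unknowns. -/
def IsMulUnknowns (g : ℝ → ℂ) (M : S.Unknowns p →L[ℂ] S.Unknowns p) : Prop :=
  ∀ u : S.Unknowns p,
    Besov.dist ((M u).1 : Besov S.σ₁ p) =
      TemperedDistribution.smulLeftCLM ℂ g (Besov.dist (u.1 : Besov S.σ₁ p)) ∧
    Besov.dist ((M u).2 : Besov S.σ₂ p) =
      TemperedDistribution.smulLeftCLM ℂ g (Besov.dist (u.2 : Besov S.σ₂ p))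

/-- `M` is the operator of multiplication by `g` on the space of right-hand sides. -/
def IsMulData (g : ℝ → ℂ) (M : S.Data p →L[ℂ] S.Data p) : Prop :=
  ∀ (f₁ : Besov S.σ₁ p) (f₂ : Besov S.σ₂ p), ∃ (k₁ : Besov S.σ₁ p) (k₂ : Besov S.σ₂ p),
    Besov.dist k₁ = TemperedDistribution.smulLeftCLM ℂ g (Besov.dist f₁) ∧
    Besov.dist k₂ = TemperedDistribution.smulLeftCLM ℂ g (Besov.dist f₂) ∧
    M (f₁.restrict S.I₁, f₂.restrict S.I₂) = (k₁.restrict S.I₁, k₂.restrict S.I₂)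

variable (p)

/-- There are cut-offs `g`, `h` at `0`, with `h A g` bounded, and a bounded `L` such that
`L (h A g) - g` is compact. -/
def HasLeftLocalInverse : Prop :=
  ∃ g h : ℝ → ℂ, IsCutoffAtZero g ∧ IsCutoffAtZero h ∧
  ∃ T : S.Unknowns p →L[ℂ] S.Data p, S.IsLocalization h g T ∧
  ∃ M : S.Unknowns p →L[ℂ] S.Unknowns p, S.IsMulUnknowns g M ∧
  ∃ L : S.Data p →L[ℂ] S.Unknowns p, IsCompactOperator (L ∘L T - M)

/-- There are cut-offs `g`, `h` at `0`, with `g A h` bounded, and a bounded `R` such that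
`(g A h) R - g` is compact. -/
def HasRightLocalInverse : Prop :=
  ∃ g h : ℝ → ℂ, IsCutoffAtZero g ∧ IsCutoffAtZero h ∧
  ∃ T : S.Unknowns p →L[ℂ] S.Data p, S.IsLocalization g h T ∧
  ∃ M : S.Data p →L[ℂ] S.Data p, S.IsMulData g M ∧
  ∃ R : S.Data p →L[ℂ] S.Unknowns p, IsCompactOperator (T ∘L R - M)

/-- Local invertibility at `0` (local Fredholmness): local inverses, modulo compact operators,
exist from both sides. -/
def LocallyInvertibleAtZero : Prop :=
  S.HasLeftLocalInverse p ∧ S.HasRightLocalInverse p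

end HalfLineSystem

/-! ### The boundary operators of the half-plane -/

/-- The fundamental solution `(1/2π) ln |x|` of the Laplacian in the plane. -/
def laplaceKernel (x₁ x₂ : ℝ) : ℝ := 1 / (2 * Real.pi) * Real.log (Real.sqrt (x₁ ^ 2 + x₂ ^ 2))

/-- The single layer operator `V_{-1} v(t) = (1/2π) ∫ ln|t - τ| v(τ) dτ` on the boundary line. -/
def singleLayer (v : ℝ → ℂ) (t : ℝ) : ℂ := ∫ τ, (laplaceKernel (t - τ) 0 : ℂ) * v τ

/-- The direct value `W_0` of the double layer potential on the boundary line, with the normal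
derivative `-∂/∂y₂` in the variable of integration. -/
def doubleLayer (v : ℝ → ℂ) (t : ℝ) : ℂ :=
  ∫ τ, ((-deriv (fun y₂ : ℝ => laplaceKernel (t - τ) (0 - y₂)) 0 : ℝ) : ℂ) * v τ

/-- The adjoint operator `W_0^*`, with the normal derivative `-∂/∂x₂` in the outer variable. -/
def adjointDoubleLayer (v : ℝ → ℂ) (t : ℝ) : ℂ :=
  ∫ τ, ((-deriv (fun x₂ : ℝ => laplaceKernel (t - τ) (x₂ - 0)) 0 : ℝ) : ℂ) * v τ

/-- The hypersingular operator
`V_{+1} v(t) = -v(t) + (1/2π) p.v. ∫ v'(τ) / (t - τ) dτ` on the boundary line. -/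
def hypersingular (v : ℝ → ℂ) (t : ℝ) : ℂ :=
  -v t + 1 / (2 * Real.pi) *
    Filter.limUnder (𝓝[>] (0 : ℝ))
      (fun ε : ℝ => ∫ τ in {τ : ℝ | ε < |t - τ|}, deriv v τ / ((t - τ : ℝ) : ℂ))

/-- The system
`½ φ - r₊ W_0 φ + r₊ V_{-1} ψ = G` on `(0, ∞)`, `½ ψ + r₋ W_0^* ψ - r₋ V_{+1} φ = H` on `(-∞, 0)`
of the mixed Dirichlet–Neumann problem in the half-plane, for `φ ∈ W̃^r_p(0, ∞)`,
`ψ ∈ W̃^{r-1}_p(-∞, 0)`, `G ∈ W^r_p(0, ∞)`, `H ∈ W^{r-1}_p(-∞, 0)`. -/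
def mixedSystem (r : ℝ) : HalfLineSystem where
  σ₁ := r
  σ₂ := r - 1
  I₁ := Set.Ioi 0
  I₂ := Set.Iio 0
  op u :=
    (fun t => 1 / 2 * u.1 t - doubleLayer u.1 t + singleLayer u.2 t,
     fun t => 1 / 2 * u.2 t + adjointDoubleLayer u.2 t - hypersingular u.1 t)

/-- The Mellin convolution operator `K^1_{-1} v(t) = (1/π) ∫_0^∞ v(τ) / (t + τ) dτ`. -/
def mellinOp (v : ℝ → ℂ) (t : ℝ) : ℂ :=
  1 / Real.pi * ∫ τ in Set.Ioi (0 : ℝ), v τ / ((t + τ : ℝ) : ℂ)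

/-- The system `φ + K^1_{-1} ψ = G`, `ψ + K^1_{-1} φ = H` on `(0, ∞)` for
`φ, ψ ∈ W̃^{r-1}_p(0, ∞)`, `G, H ∈ W^{r-1}_p(0, ∞)`. -/
def mellinSystem (r : ℝ) : HalfLineSystem where
  σ₁ := r - 1
  σ₂ := r - 1
  I₁ := Set.Ioi 0
  I₂ := Set.Ioi 0
  op u := (fun t => u.1 t + mellinOp u.2 t, fun t => u.2 t + mellinOp u.1 t)

end

/-!
Write `V` for the convolution with `(1/2π) ln|t|`, `∂` for the derivative and `J` for the reflection
`v ↦ v(-·)`. The double layer operators vanish on the boundary line, because their kernels are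
normal derivatives of even functions. Off the support of `φ` the hypersingular operator is `∂∂V`, so
that the rows of the mixed system are `½φ + Vψ` on `(0, ∞)` and `½ψ - ∂∂Vφ` on `(-∞, 0)`. On
`(0, ∞)` the Mellin convolution is `2∂VJ`.

The maps `P(φ, ψ) = (∂φ + φ, Jψ)` and `Q(G, H) = (∂G - G, JH)` are isomorphisms from the spaces of
the mixed system onto those of the Mellin system. The inverse of `∂ + 1` is the convolution with
`e^{-t} 1_{t > 0}`, which preserves supports in `[0, ∞)`; the inverse of `∂ - 1` is anticausal and
therefore acts on restrictions to `(0, ∞)`. If `A`, `B` denote the operators of the two systems,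
then `Q A` and `½ B P` have the same leading terms. Between even cut-offs `h` and `g` the
difference `Q (h A g) - ½ (h B g) P` consists of terms in which a derivative falls on a cut-off or
is missing (`mixedRow₁_sub_mellinRow`, `mixedRow₂_sub_mellinRow`), and the commutators of `P`, `Q`
with the cut-offs are multiplications by derivatives of the cut-offs. All these terms contain a
multiplication by a test function `B^{σ+1} → B^σ`, which is compact (`isCompactOperator_of_smulD`).
So the two localized systems are intertwined modulo compact operators (`exists_intertwined`), and
one-sided inverses modulo compact operators carry over (`Intertwined.exists_left`,
`Intertwined.exists_right`).

Local invertibility provides some cut-offs, not necessarily even ones, and some bounded extension of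
the localized operator. As test functions are dense in the spaces of unknowns
(`mem_closure_testSet_Ioi`), the localizations of a system to different cut-offs can be compared
(`localization_comp`), and it suffices to consider even cut-offs.

The analysis on Besov spaces rests on Littlewood-Paley blocks. An operator that acts on each block
separately is bounded as soon as it is bounded on blocks with the right power of `2`
(`besovBound_of_blocks`). Convolution with a kernel whose second differences are `O(|s|)` in `L_1`
gains one derivative (`besovBound_zygmund`); this covers the resolvent kernel and the truncated
logarithm (`isZygmundKernel_logKernel`). Multiplication by Schwartz functions is bounded
(`besovBound_smulD`), by a splitting into high and low frequencies for positive order and by the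
isomorphism `∂ + 1` for the other orders.
-/

open MeasureTheory FourierTransform Filter Set

noncomputable section

namespace BesovLine

/-! ### Dilated cut-offs in the Schwartz space -/

theorem temperate_dilate (χ : 𝓢(ℝ, ℂ)) (ε : ℝ) :
    (fun x : ℝ => χ (ε * x)).HasTemperateGrowth := by
  have h : (fun x : ℝ => ε * x).HasTemperateGrowth := by fun_prop
  exact χ.hasTemperateGrowth.comp h

/-- All derivatives of `χ(ε ·) - χ(0)` are `O(ε)` up to linear growth: the mean value theorem for
order zero, and a factor `ε ^ i` from the chain rule for order `i ≥ 1`. -/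
theorem norm_iteratedDeriv_dilate_sub_le (χ : 𝓢(ℝ, ℂ)) (i : ℕ) :
    ∃ C : ℝ, 0 ≤ C ∧ ∀ ε x : ℝ, |ε| ≤ 1 →
      ‖iteratedDeriv i (fun y : ℝ => χ (ε * y) - χ 0) x‖ ≤ |ε| * C * (1 + |x|) := by
  rcases Nat.eq_zero_or_pos i with rfl | hi
  · obtain ⟨C, hC⟩ := χ.decay 0 1
    have hC1 : ∀ x, ‖deriv χ x‖ ≤ C := by
      intro x
      have := hC.2 x
      rwa [pow_zero, one_mul, norm_iteratedFDeriv_one, ← norm_deriv_eq_norm_fderiv] at this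
    refine ⟨C, hC.1.le, fun ε x _ => ?_⟩
    have h := Convex.norm_image_sub_le_of_norm_deriv_le (s := Set.univ) (f := χ) (C := C)
      (fun y _ => χ.differentiable.differentiableAt) (fun y _ => hC1 y) convex_univ
      (Set.mem_univ 0) (Set.mem_univ (ε * x))
    rw [iteratedDeriv_zero]
    refine h.trans ?_
    rw [sub_zero, Real.norm_eq_abs, abs_mul]
    have : 0 ≤ |ε| * C := mul_nonneg (abs_nonneg _) hC.1.le
    nlinarith
  · obtain ⟨C, hC⟩ := χ.decay 0 i
    have hC1 : ∀ x, ‖iteratedDeriv i χ x‖ ≤ C := by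
      intro x
      have := hC.2 x
      rwa [pow_zero, one_mul, norm_iteratedFDeriv_eq_norm_iteratedDeriv] at this
    refine ⟨C, hC.1.le, fun ε x hε => ?_⟩
    have h1 : iteratedDeriv i (fun y : ℝ => χ (ε * y) - χ 0) x =
        ε ^ i • iteratedDeriv i χ (ε * x) := by
      rw [show (fun y : ℝ => χ (ε * y) - χ 0) = (fun y : ℝ => χ (ε * y)) - fun _ => χ 0 from rfl,
        iteratedDeriv_sub]
      · have := iteratedDeriv_comp_const_smul (f := χ) (n := i) (χ.smooth i) ε
        rw [this, iteratedDeriv_const, if_neg hi.ne', sub_zero]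
      · exact ((χ.smooth i).comp (by fun_prop)).contDiffAt
      · exact contDiffAt_const
    rw [h1, norm_smul, norm_pow, Real.norm_eq_abs]
    have h2 : |ε| ^ i ≤ |ε| := pow_le_of_le_one (abs_nonneg _) hε hi.ne'
    calc |ε| ^ i * ‖iteratedDeriv i χ (ε * x)‖ ≤ |ε| * C :=
          mul_le_mul h2 (hC1 _) (norm_nonneg _) (abs_nonneg _)
      _ ≤ |ε| * C * (1 + |x|) :=
          le_mul_of_one_le_right (mul_nonneg (abs_nonneg _) hC.1.le) (by linarith [abs_nonneg x])

/-- Multiplication by a flat dilate of a Schwartz function `χ` tends to multiplication by the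
constant `χ 0`, in the topology of the Schwartz space. -/
theorem tendsto_dilate_smul (χ η : 𝓢(ℝ, ℂ)) :
    Tendsto (fun ε : ℝ => SchwartzMap.smulLeftCLM ℂ (fun x : ℝ => χ (ε * x)) η) (𝓝 0)
      (𝓝 (χ 0 • η)) := by
  rw [(schwartz_withSeminorms ℝ ℝ ℂ).tendsto_nhds]
  rintro ⟨k, l⟩ δ hδ
  choose C hC0 hC using norm_iteratedDeriv_dilate_sub_le χ
  set B : ℝ := ∑ i ∈ Finset.range (l + 1), (l.choose i : ℝ) * (C i *
    (SchwartzMap.seminorm ℝ k (l - i) η + SchwartzMap.seminorm ℝ (k + 1) (l - i) η)) with hB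
  have hB0 : 0 ≤ B := Finset.sum_nonneg fun i _ => mul_nonneg (Nat.cast_nonneg _)
    (mul_nonneg (hC0 i) (add_nonneg (apply_nonneg _ _) (apply_nonneg _ _)))
  have key : ∀ ε : ℝ, |ε| ≤ 1 → SchwartzMap.seminorm ℝ k l
      (SchwartzMap.smulLeftCLM ℂ (fun x : ℝ => χ (ε * x)) η - χ 0 • η) ≤ |ε| * B := by
    intro ε hε
    refine SchwartzMap.seminorm_le_bound ℝ k l _ (mul_nonneg (abs_nonneg _) hB0) fun x => ?_
    have hfun : (⇑(SchwartzMap.smulLeftCLM ℂ (fun x : ℝ => χ (ε * x)) η - χ 0 • η) : ℝ → ℂ) =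
        fun y => (χ (ε * y) - χ 0) * η y := by
      funext y
      simp [SchwartzMap.smulLeftCLM_apply_apply (temperate_dilate χ ε), sub_mul]
    rw [hfun]
    have h1 := norm_iteratedFDeriv_mul_le (𝕜 := ℝ) (f := fun y : ℝ => χ (ε * y) - χ 0) (g := η)
      (N := ∞) (((χ.smooth ⊤).comp (by fun_prop)).sub contDiff_const) (η.smooth ⊤) x
      (n := l) (mod_cast le_top)
    calc ‖x‖ ^ k * _ ≤ ‖x‖ ^ k * _ := mul_le_mul_of_nonneg_left h1 (by positivity)
      _ ≤ _ := by
        rw [hB, Finset.mul_sum, Finset.mul_sum]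
        refine Finset.sum_le_sum fun i _ => ?_
        have h2 := hC i ε x hε
        rw [← norm_iteratedFDeriv_eq_norm_iteratedDeriv] at h2
        have h3 := SchwartzMap.le_seminorm ℝ k (l - i) η x
        have h4 := SchwartzMap.le_seminorm ℝ (k + 1) (l - i) η x
        set a := ‖iteratedFDeriv ℝ i (fun y : ℝ => χ (ε * y) - χ 0) x‖
        set b := ‖iteratedFDeriv ℝ (l - i) (⇑η) x‖ with hb
        have hb0 : 0 ≤ b := norm_nonneg _
        calc ‖x‖ ^ k * (↑(l.choose i) * a * b)
            ≤ ‖x‖ ^ k * (↑(l.choose i) * (|ε| * C i * (1 + |x|)) * b) := by gcongr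
          _ = |ε| * (↑(l.choose i) * (C i * (‖x‖ ^ k * b + ‖x‖ ^ (k + 1) * b))) := by
            rw [Real.norm_eq_abs]; ring
          _ ≤ _ := by
            have := hC0 i
            gcongr
  have hpos : 0 < min 1 (δ / (B + 1)) := lt_min one_pos (div_pos hδ (by linarith))
  filter_upwards [Metric.ball_mem_nhds (0 : ℝ) hpos] with ε hε
  rw [Metric.mem_ball, dist_zero_right, Real.norm_eq_abs, lt_min_iff] at hε
  refine (key ε hε.1.le).trans_lt ?_
  have := (lt_div_iff₀ (by linarith : 0 < B + 1)).mp hε.2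
  nlinarith [abs_nonneg ε]

/-- A smooth bump as a Schwartz function: compactly supported, equal to `1` on `[-1, 1]`. -/
theorem exists_unit_cutoff : ∃ χ : 𝓢(ℝ, ℂ), HasCompactSupport χ ∧ (∀ x, |x| ≤ 1 → χ x = 1) ∧
    tsupport χ ⊆ Icc (-2) 2 := by
  let b : ContDiffBump (0 : ℝ) := ⟨1, 2, one_pos, one_lt_two⟩
  have h1 : HasCompactSupport (fun x : ℝ => (b x : ℂ)) := by
    have := b.hasCompactSupport
    exact this.comp_left (g := fun t : ℝ => (t : ℂ)) (by simp)
  have h2 : ContDiff ℝ ∞ (fun x : ℝ => (b x : ℂ)) :=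
    Complex.ofRealCLM.contDiff.comp b.contDiff
  refine ⟨h1.toSchwartzMap h2, h1, fun x hx => ?_, ?_⟩
  · change ((b x : ℝ) : ℂ) = 1
    rw [b.one_of_mem_closedBall (by simpa using hx)]
    simp
  · refine closure_minimal ?_ isClosed_Icc
    intro x hx
    have hx' : b x ≠ 0 := by
      intro h
      apply hx
      change ((b x : ℝ) : ℂ) = 0
      rw [h]; simp
    have : x ∈ Function.support b := hx'
    rw [b.support_eq, Metric.mem_ball, dist_zero_right, Real.norm_eq_abs, abs_lt] at this
    exact ⟨this.1.le, this.2.le⟩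

/-- A distribution that annihilates the compactly supported Schwartz functions with support in a
set annihilates all Schwartz functions with support in that set. -/
theorem isVanishingOn_of_compactSupport {f : 𝓢'(ℝ, ℂ)} {U : Set ℝ}
    (h : ∀ θ : 𝓢(ℝ, ℂ), HasCompactSupport θ → tsupport θ ⊆ U → f θ = 0) :
    Distribution.IsVanishingOn f U := by
  intro θ hθ
  obtain ⟨χ, hχ, h1, -⟩ := exists_unit_cutoff
  have ht := (tendsto_dilate_smul χ θ).mono_left
    (nhdsWithin_le_nhds (s := ({0}ᶜ : Set ℝ)))
  rw [h1 0 (by simp), one_smul] at ht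
  -- The dilate `χ(ε ·)` has compact support only for `ε ≠ 0`, hence the punctured neighbourhood.
  have ht2 : Tendsto (fun ε : ℝ => f (SchwartzMap.smulLeftCLM ℂ (fun x : ℝ => χ (ε * x)) θ))
      (𝓝[≠] 0) (𝓝 (f θ)) := (map_continuous f).continuousAt.tendsto.comp ht
  have hev : ∀ᶠ ε : ℝ in 𝓝[≠] 0,
      f (SchwartzMap.smulLeftCLM ℂ (fun x : ℝ => χ (ε * x)) θ) = 0 := by
    filter_upwards [self_mem_nhdsWithin] with ε hε
    have hs := SchwartzMap.tsupport_smulLeftCLM_subset (F := ℂ) (fun x : ℝ => χ (ε * x)) θ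
    refine h _ ?_ (hs.trans (inter_subset_left.trans hθ))
    have hc : HasCompactSupport (fun x : ℝ => χ (ε * x)) :=
      hχ.comp_homeomorph (Homeomorph.mulLeft₀ ε hε)
    exact IsCompact.of_isClosed_subset hc (isClosed_tsupport _) (hs.trans inter_subset_right)
  exact tendsto_nhds_unique (ht2.congr' hev) tendsto_const_nhds

/-! ### Fourier multipliers whose symbol is the Fourier transform of an integrable kernel -/

/-- Integrable kernels all of whose moments are finite. -/
structure IsMomentKernel (k : ℝ → ℂ) : Prop where
  meas : AEStronglyMeasurable k
  moment : ∀ n : ℕ, Integrable (fun x => |x| ^ n * ‖k x‖)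

theorem IsMomentKernel.integrable {k : ℝ → ℂ} (hk : IsMomentKernel k) : Integrable k := by
  have := hk.moment 0
  simp only [pow_zero, one_mul] at this
  exact (integrable_norm_iff hk.meas).mp this

theorem IsMomentKernel.temperate {k : ℝ → ℂ} (hk : IsMomentKernel k) :
    (𝓕 k).HasTemperateGrowth := by
  have hint : ∀ n : ℕ, (n : ℕ∞) ≤ ⊤ → Integrable (fun x : ℝ => x ^ n • k x) := by
    intro n _
    refine (hk.moment n).mono' ?_ ?_
    · exact ((continuous_pow n).aestronglyMeasurable).smul hk.meas
    · filter_upwards with x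
      rw [norm_smul, norm_pow, Real.norm_eq_abs]
  refine ⟨Real.contDiff_fourier (N := ⊤) (fun n _ => by simpa using hk.moment n), fun n => ?_⟩
  refine ⟨0, ∫ x : ℝ, ‖((-2 * Real.pi * Complex.I * x) ^ n • k x)‖, fun x => ?_⟩
  rw [pow_zero, mul_one, norm_iteratedFDeriv_eq_norm_iteratedDeriv,
    Real.iteratedDeriv_fourier hint le_top]
  exact VectorFourier.norm_fourierIntegral_le_integral_norm _ _ _ _ _

theorem isMomentKernel_schwartz (k : 𝓢(ℝ, ℂ)) : IsMomentKernel k where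
  meas := k.continuous.aestronglyMeasurable
  moment n := by simpa using k.integrable_pow_mul volume n

/-- The transpose, on test functions, of a multiplier with symbol `𝓕 k` is the correlation
with the kernel `k`. -/
theorem fourier_smulLeft_fourierInv_apply {k : ℝ → ℂ} (hk : Integrable k)
    (hm : (𝓕 k).HasTemperateGrowth) (θ : 𝓢(ℝ, ℂ)) (x : ℝ) :
    (𝓕 (SchwartzMap.smulLeftCLM ℂ (𝓕 k) (𝓕⁻ θ))) x = ∫ s, k s * θ (x + s) := by
  rw [SchwartzMap.fourier_coe, Real.fourier_eq]
  have hg : Integrable (fun ξ : ℝ => Real.fourierChar (-(inner ℝ ξ x)) • (𝓕⁻ θ) ξ) := by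
    exact (Real.fourierIntegral_convergent_iff x).mpr (𝓕⁻ θ).integrable
  -- The multiplication formula moves the Fourier transform from `k` to the other factor, where
  -- Fourier inversion applies.
  have h := VectorFourier.integral_fourierIntegral_smul_eq_flip (L := innerₗ ℝ) (μ := volume)
    (ν := volume) Real.continuous_fourierChar continuous_inner hk hg
  have e1 : ∀ ξ : ℝ, Real.fourierChar (-(inner ℝ ξ x)) •
      (SchwartzMap.smulLeftCLM ℂ (𝓕 k) (𝓕⁻ θ)) ξ =
      VectorFourier.fourierIntegral Real.fourierChar volume (innerₗ ℝ) k ξ •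
        Real.fourierChar (-(inner ℝ ξ x)) • (𝓕⁻ θ) ξ := by
    intro ξ
    rw [SchwartzMap.smulLeftCLM_apply_apply hm, smul_comm]
    rfl
  simp_rw [e1]
  rw [h]
  refine integral_congr_ae (Eventually.of_forall fun s => ?_)
  simp only [smul_eq_mul]
  congr 1
  have h2 : θ (x + s) = (𝓕 (𝓕⁻ θ)) (x + s) := by rw [FourierTransform.fourier_fourierInv_eq]
  rw [h2, SchwartzMap.fourier_coe, Real.fourier_eq]
  refine integral_congr_ae (Eventually.of_forall fun ξ => ?_)
  simp only [LinearMap.flip_apply, innerₗ_apply_apply, smul_smul]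
  congr 1
  rw [← AddChar.map_add_eq_mul]
  congr 1
  simp only [RCLike.inner_apply, conj_trivial]
  ring


/-- A frequency cut-off `φ` kills a product of two functions if it vanishes on the sum of their
spectra. -/
theorem smulLeft_fourierInv_mul_eq_zero {φ : ℝ → ℂ} (hφ : φ.HasTemperateGrowth) {a b : 𝓢(ℝ, ℂ)}
    (h : ∀ ξ η : ℝ, φ ξ ≠ 0 → (𝓕⁻ a) (ξ - η) ≠ 0 → (𝓕⁻ b) η ≠ 0 → False) :
    SchwartzMap.smulLeftCLM ℂ φ (𝓕⁻ (SchwartzMap.smulLeftCLM ℂ a b)) = 0 := by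
  ext ξ
  rw [SchwartzMap.smulLeftCLM_apply_apply hφ]
  change φ ξ • _ = 0
  by_cases hξ : φ ξ = 0
  · rw [hξ, zero_smul]
  -- The inverse Fourier transform of a product is the convolution of the transforms.
  have e : 𝓕⁻ (SchwartzMap.smulLeftCLM ℂ a b) =
      SchwartzMap.convolution (ContinuousLinearMap.mul ℂ ℂ).flip (𝓕⁻ b) (𝓕⁻ a) := by
    have : SchwartzMap.smulLeftCLM ℂ a b =
        SchwartzMap.pairing (ContinuousLinearMap.mul ℂ ℂ).flip b a := by
      ext x
      rw [SchwartzMap.smulLeftCLM_apply_apply a.hasTemperateGrowth,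
        SchwartzMap.pairing_apply_apply]
      rfl
    rw [this]
    simp [SchwartzMap.convolution]
  rw [e, SchwartzMap.convolution_apply, MeasureTheory.convolution,
    integral_eq_zero_of_ae, smul_zero]
  filter_upwards with η
  by_contra hne
  refine h ξ η hξ (fun h0 => hne ?_) (fun h0 => hne ?_) <;> simp [h0]

/-! ### Translation, convolution and multiplication on `L_q` of the line -/

/-- The complex space `L_q` of the real line. -/
abbrev LpC (q : ℝ≥0∞) : Type := Lp ℂ q (volume : Measure ℝ)

variable {q : ℝ≥0∞} [Fact (1 ≤ q)]

/-- The embedding of `L_q` into the tempered distributions. -/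
abbrev toDist : LpC q →L[ℂ] 𝓢'(ℝ, ℂ) := Lp.toTemperedDistributionCLM ℂ volume q

theorem toDist_apply (F : LpC q) (θ : 𝓢(ℝ, ℂ)) : toDist F θ = ∫ x, θ x * F x :=
  Lp.toTemperedDistribution_apply F θ

theorem toDist_injective : Function.Injective (toDist (q := q)) :=
  LinearMap.ker_eq_bot.mp Lp.ker_toTemperedDistributionCLM_eq_bot

theorem continuous_toDist_apply (θ : 𝓢(ℝ, ℂ)) : Continuous fun F : LpC q => toDist F θ :=
  (PointwiseConvergenceCLM.evalCLM (RingHom.id ℂ) ℂ θ).continuous.comp (toDist (q := q)).continuous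

/-- Pairing of an `L_q` function with a fixed test function. -/
def pairCLM (θ : 𝓢(ℝ, ℂ)) : LpC q →L[ℂ] ℂ where
  toFun F := toDist F θ
  map_add' F G := by rw [map_add]; rfl
  map_smul' c F := by rw [map_smul]; rfl
  cont := continuous_toDist_apply θ

theorem toDist_toLp (θ : 𝓢(ℝ, ℂ)) :
    toDist (θ.toLp q) = SchwartzMap.toTemperedDistributionCLM ℝ ℂ volume θ :=
  Lp.toTemperedDistribution_toLp_eq θ

/-- Translation `F ↦ F (· - s)`. -/
def translate (s : ℝ) : LpC q →ₗᵢ[ℂ] LpC q :=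
  Lp.compMeasurePreservingₗᵢ ℂ (fun x => x - s) (measurePreserving_sub_right volume s)

theorem coeFn_translate (s : ℝ) (F : LpC q) : translate s F =ᵐ[volume] fun x => F (x - s) :=
  Lp.coeFn_compMeasurePreserving F (measurePreserving_sub_right volume s)

theorem continuous_translate (hq : q ≠ ⊤) (F : LpC q) : Continuous fun s => translate s F := by
  have hc : Continuous fun s : ℝ => (⟨fun x : ℝ => x - s, by fun_prop⟩ : C(ℝ, ℝ)) := by
    refine ContinuousMap.continuous_of_continuous_uncurry _ ?_
    change Continuous fun z : ℝ × ℝ => z.2 - z.1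
    fun_prop
  exact Continuous.compMeasurePreservingLp (f := fun _ : ℝ => F) continuous_const hc
    (fun s => measurePreserving_sub_right volume s) hq

theorem toDist_translate (s : ℝ) (F : LpC q) (θ : 𝓢(ℝ, ℂ)) :
    toDist (translate s F) θ = ∫ x, θ (x + s) * F x := by
  rw [toDist_apply]
  have h1 : (fun x => θ x * translate s F x) =ᵐ[volume]
      fun x => (fun y => θ (y + s) * F y) (x - s) := by
    filter_upwards [coeFn_translate s F] with x hx
    simp [hx]
  rw [integral_congr_ae h1]
  exact integral_sub_right_eq_self (fun y => θ (y + s) * F y) s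

/-- Convolution of an integrable kernel with an `L_q` function, as a vector valued integral of
translates. -/
def conv (k : ℝ → ℂ) (F : LpC q) : LpC q := ∫ s, k s • translate s F

theorem integrable_conv (hq : q ≠ ⊤) {k : ℝ → ℂ} (hk : Integrable k) (F : LpC q) :
    Integrable fun s => k s • translate s F := by
  refine (hk.norm.mul_const ‖F‖).mono' (hk.1.smul (continuous_translate hq F).aestronglyMeasurable)
    ?_
  filter_upwards with s
  rw [norm_smul, LinearIsometry.norm_map]

theorem norm_conv_le (k : ℝ → ℂ) (F : LpC q) : ‖conv k F‖ ≤ (∫ s, ‖k s‖) * ‖F‖ := by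
  refine (norm_integral_le_integral_norm _).trans ?_
  simp_rw [norm_smul, LinearIsometry.norm_map]
  rw [integral_mul_const]

/-- Convolution with an integrable kernel as a bounded operator. -/
def convCLM (hq : q ≠ ⊤) {k : ℝ → ℂ} (hk : Integrable k) : LpC q →L[ℂ] LpC q :=
  LinearMap.mkContinuous
    { toFun := conv k
      map_add' := fun F G => by
        simp only [conv, map_add, smul_add]
        exact integral_add (integrable_conv hq hk F) (integrable_conv hq hk G)
      map_smul' := fun c F => by
        simp only [conv, map_smul, RingHom.id_apply]
        rw [← integral_smul]
        simp_rw [smul_comm c] }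
    (∫ s, ‖k s‖) (norm_conv_le k)

theorem toDist_conv_apply (hq : q ≠ ⊤) {k : ℝ → ℂ} (hk : Integrable k) (F : LpC q)
    (θ : 𝓢(ℝ, ℂ)) : toDist (conv k F) θ = ∫ s, k s * ∫ x, θ (x + s) * F x := by
  have h := (pairCLM (q := q) θ).integral_comp_comm (integrable_conv hq hk F)
  have e : toDist (conv k F) θ = pairCLM θ (∫ s, k s • translate s F) := rfl
  rw [e, ← h]
  refine integral_congr_ae (Eventually.of_forall fun s => ?_)
  simp only [map_smul, smul_eq_mul]
  congr 1
  exact toDist_translate s F θ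

/-- Convolution with `k` is the Fourier multiplier with symbol `𝓕 k`. -/
theorem toDist_conv (hq : q ≠ ⊤) {k : ℝ → ℂ} (hk : Integrable k)
    (hm : (𝓕 k).HasTemperateGrowth) (F : LpC q) :
    toDist (conv k F) = TemperedDistribution.fourierMultiplierCLM ℂ (𝓕 k) (toDist F) := by
  ext θ
  rw [TemperedDistribution.fourierMultiplierCLM_apply_apply]
  set w := 𝓕 (SchwartzMap.smulLeftCLM ℂ (𝓕 k) (𝓕⁻ θ)) with hw
  have hdense := SchwartzMap.denseRange_toLpCLM (E := ℝ) (F := ℂ) (μ := volume) hq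
  -- Both sides are continuous in `F`, so that a Schwartz function `φ` may take the place of `F`.
  refine congrFun (f := fun F : LpC q => toDist (conv k F) θ) (g := fun F : LpC q => toDist F w)
    (hdense.equalizer ?_ (continuous_toDist_apply w) ?_) F
  · exact (continuous_toDist_apply θ).comp (convCLM hq hk).continuous
  funext φ
  simp only [Function.comp_apply, SchwartzMap.toLpCLM_apply]
  rw [toDist_conv_apply hq hk, toDist_toLp]
  refine Eq.trans ?_ (SchwartzMap.coe_apply φ w).symm
  have hφ : ∀ s, ∫ x, θ (x + s) * (φ.toLp q volume) x = ∫ x, θ (x + s) * φ x := by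
    intro s
    refine integral_congr_ae ?_
    filter_upwards [φ.coeFn_toLp q volume] with x hx
    rw [hx]
  simp_rw [hφ, ← integral_const_mul]
  have hint : Integrable (Function.uncurry fun s x : ℝ => k s * (θ (x + s) * φ x))
      (volume.prod volume) := by
    have h0 : Integrable (fun z : ℝ × ℝ => k z.1 * φ z.2) (volume.prod volume) :=
      hk.mul_prod φ.integrable
    obtain ⟨C, hC⟩ := θ.decay 0 0
    have h1 := h0.bdd_mul (f := fun z : ℝ × ℝ => θ (z.2 + z.1)) (c := C)
      (by
        have : Continuous fun z : ℝ × ℝ => θ (z.2 + z.1) := θ.continuous.comp (by fun_prop)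
        exact this.aestronglyMeasurable)
      (Eventually.of_forall fun z => by simpa using hC.2 (z.2 + z.1))
    refine h1.congr (Eventually.of_forall fun z => ?_)
    simp only [Function.uncurry]
    ring
  rw [integral_integral_swap hint]
  refine integral_congr_ae (Eventually.of_forall fun x => ?_)
  simp only [smul_eq_mul]
  rw [hw, fourier_smulLeft_fourierInv_apply hk hm, ← integral_mul_const]
  refine integral_congr_ae (Eventually.of_forall fun s => ?_)
  simp only
  ring

/-- Multiplication of an `L_q` function by a Schwartz function. -/
def mulLp (g : 𝓢(ℝ, ℂ)) : LpC q →L[ℂ] LpC q :=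
  LinearMap.mkContinuous
    { toFun := fun F => (g.toLp ∞ volume : LpC ∞) • F
      map_add' := fun _ _ => Lp.add_smul _ _ _
      map_smul' := fun c F => (Lp.smul_comm c _ F).symm }
    ‖(g.toLp ∞ volume : LpC ∞)‖ (fun _ => Lp.norm_smul_le _ _)

theorem mulLp_apply (g : 𝓢(ℝ, ℂ)) (F : LpC q) :
    mulLp g F = ((g.toLp ∞ volume : LpC ∞) • F : LpC q) := rfl

theorem coeFn_mulLp (g : 𝓢(ℝ, ℂ)) (F : LpC q) : mulLp g F =ᵐ[volume] fun x => g x * F x := by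
  rw [mulLp_apply]
  filter_upwards [Lp.coeFn_lpSMul (r := q) (g.toLp ∞ volume : LpC ∞) F,
    g.coeFn_toLp ∞ volume] with x h1 h2
  rw [h1, Pi.smul_apply', h2, smul_eq_mul]

theorem toDist_mulLp (g : 𝓢(ℝ, ℂ)) (F : LpC q) :
    toDist (mulLp g F) = TemperedDistribution.smulLeftCLM ℂ g (toDist F) := by
  ext θ
  rw [TemperedDistribution.smulLeftCLM_apply_apply, toDist_apply, toDist_apply]
  refine integral_congr_ae ?_
  filter_upwards [coeFn_mulLp g F] with x hx
  rw [hx, SchwartzMap.smulLeftCLM_apply_apply g.hasTemperateGrowth, smul_eq_mul]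
  ring

theorem norm_mulLp_le (g : 𝓢(ℝ, ℂ)) {C : ℝ} (hC : ∀ x, ‖g x‖ ≤ C) (F : LpC q) :
    ‖mulLp g F‖ ≤ C * ‖F‖ := by
  refine Lp.norm_le_mul_norm_of_ae_le_mul ?_
  filter_upwards [coeFn_mulLp g F] with x hx
  rw [hx, norm_mul]
  exact mul_le_mul_of_nonneg_right (hC x) (norm_nonneg _)

/-! ### Low-frequency cut-offs and dyadic blocks -/

theorem lowPass_eq_one {ξ : ℝ} (h : |ξ| ≤ 1) : lowPass ξ = 1 := by
  have : (1 : ℝ) ≤ 2 - ξ ^ 2 := by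
    have := (sq_le_one_iff_abs_le_one ξ).mpr h
    linarith
  simp [lowPass, Real.smoothTransition.one_of_one_le this]

theorem lowPass_eq_zero {ξ : ℝ} (h : 2 ≤ ξ ^ 2) : lowPass ξ = 0 := by
  simp [lowPass, Real.smoothTransition.zero_of_nonpos (by linarith : 2 - ξ ^ 2 ≤ 0)]

theorem norm_lowPass_sub_one_le (ξ : ℝ) : ‖1 - lowPass ξ‖ ≤ 1 := by
  have h : 1 - lowPass ξ = ((1 - Real.smoothTransition (2 - ξ ^ 2) : ℝ) : ℂ) := by
    simp [lowPass]
  rw [h, Complex.norm_real, Real.norm_eq_abs, abs_le]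
  constructor <;>
    linarith [Real.smoothTransition.nonneg (2 - ξ ^ 2), Real.smoothTransition.le_one (2 - ξ ^ 2)]

theorem lowPass_neg (ξ : ℝ) : lowPass (-ξ) = lowPass ξ := by simp [lowPass]

theorem contDiff_lowPass : ContDiff ℝ ∞ lowPass := by
  refine Complex.ofRealCLM.contDiff.comp (Real.smoothTransition.contDiff.comp ?_)
  fun_prop

/-- The low-pass symbol at frequency `2 ^ n`. -/
def low (n : ℕ) (ξ : ℝ) : ℂ := lowPass (ξ / 2 ^ n)

theorem low_eq_one {n : ℕ} {ξ : ℝ} (h : |ξ| ≤ 2 ^ n) : low n ξ = 1 := by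
  apply lowPass_eq_one
  rw [abs_div, abs_of_pos (by positivity : (0 : ℝ) < 2 ^ n)]
  exact (div_le_one (by positivity)).mpr h

theorem low_eq_zero {n : ℕ} {ξ : ℝ} (h : 2 * (2 ^ n) ^ 2 ≤ ξ ^ 2) : low n ξ = 0 := by
  apply lowPass_eq_zero
  rw [div_pow, le_div_iff₀ (by positivity)]
  exact h

theorem low_neg (n : ℕ) (ξ : ℝ) : low n (-ξ) = low n ξ := by
  rw [low, neg_div, lowPass_neg, low]

theorem sq_lt_of_low_ne_zero {n : ℕ} {ξ : ℝ} (h : low n ξ ≠ 0) : ξ ^ 2 < 2 * (2 ^ n) ^ 2 := by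
  by_contra hc
  exact h (low_eq_zero (not_lt.mp hc))

theorem hasCompactSupport_low (n : ℕ) : HasCompactSupport (low n) := by
  refine HasCompactSupport.of_support_subset_isCompact (K := Icc (-(2 * 2 ^ n)) (2 * 2 ^ n))
    isCompact_Icc fun ξ hξ => ?_
  have h := sq_lt_of_low_ne_zero hξ
  have hp : (0 : ℝ) < 2 ^ n := by positivity
  exact abs_le.mp (abs_le_of_sq_le_sq (by nlinarith) (by positivity))

theorem contDiff_low (n : ℕ) : ContDiff ℝ ∞ (low n) :=
  contDiff_lowPass.comp (contDiff_id.div_const _)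

/-- `low n` as a Schwartz function. -/
def lowS (n : ℕ) : 𝓢(ℝ, ℂ) := (hasCompactSupport_low n).toSchwartzMap (contDiff_low n)

@[simp]
theorem lowS_coe (n : ℕ) : (lowS n : ℝ → ℂ) = low n := rfl

theorem temperate_low (n : ℕ) : (low n).HasTemperateGrowth := (lowS n).hasTemperateGrowth

theorem dyadicCutoff_zero : dyadicCutoff 0 = low 0 := by
  funext ξ
  simp [dyadicCutoff, low]

theorem dyadicCutoff_succ (j : ℕ) : dyadicCutoff (j + 1) = low (j + 1) - low j := rfl

theorem temperate_dyadicCutoff (j : ℕ) : (dyadicCutoff j).HasTemperateGrowth := by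
  cases j with
  | zero => rw [dyadicCutoff_zero]; exact temperate_low 0
  | succ j => rw [dyadicCutoff_succ]; exact (temperate_low _).sub (temperate_low _)

theorem low_mul_low {m n : ℕ} (h : m < n) : low m * low n = low m := by
  funext ξ
  rw [Pi.mul_apply]
  by_cases h0 : low m ξ = 0
  · rw [h0, zero_mul]
  · have h1 := sq_lt_of_low_ne_zero h0
    have h2 : (2 : ℝ) ^ (m + 1) ≤ 2 ^ n := pow_le_pow_right₀ one_le_two h
    have hp : (0 : ℝ) < 2 ^ m := by positivity
    -- On the support of `low m`, `|ξ| < √2 * 2 ^ m ≤ 2 ^ n`, where `low n` equals `1`.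
    rw [low_eq_one (n := n), mul_one]
    refine abs_le_of_sq_le_sq ?_ (by positivity)
    rw [pow_succ] at h2
    nlinarith

theorem dyadicCutoff_mul_low {j n : ℕ} (h : j < n) : dyadicCutoff j * low n = dyadicCutoff j := by
  cases j with
  | zero => rw [dyadicCutoff_zero, low_mul_low h]
  | succ j => rw [dyadicCutoff_succ, sub_mul, low_mul_low h, low_mul_low (by omega)]

theorem dyadicCutoff_mul_low_eq_zero {j n : ℕ} (h : n + 2 ≤ j) : dyadicCutoff j * low n = 0 := by
  obtain ⟨i, rfl⟩ : ∃ i, j = i + 1 := ⟨j - 1, by omega⟩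
  rw [dyadicCutoff_succ, sub_mul, mul_comm, low_mul_low (by omega), mul_comm,
    low_mul_low (by omega), sub_self]

/-- The spectrum of a dyadic block avoids low frequencies. -/
theorem lt_abs_of_dyadicCutoff_ne_zero {j : ℕ} {ξ : ℝ} (h : dyadicCutoff (j + 1) ξ ≠ 0) :
    2 ^ j < |ξ| := by
  by_contra hc
  apply h
  rw [dyadicCutoff_succ, Pi.sub_apply, low_eq_one (not_lt.mp hc), low_eq_one, sub_self]
  exact (not_lt.mp hc).trans (pow_le_pow_right₀ one_le_two (Nat.le_succ j))

/-- The low-frequency part of a tempered distribution. -/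
def lowBlock (n : ℕ) : 𝓢'(ℝ, ℂ) →L[ℂ] 𝓢'(ℝ, ℂ) :=
  TemperedDistribution.fourierMultiplierCLM ℂ (low n)

theorem multiplier_comp {a b : ℝ → ℂ} (ha : a.HasTemperateGrowth) (hb : b.HasTemperateGrowth)
    (f : 𝓢'(ℝ, ℂ)) : TemperedDistribution.fourierMultiplierCLM ℂ a
      (TemperedDistribution.fourierMultiplierCLM ℂ b f) =
      TemperedDistribution.fourierMultiplierCLM ℂ (a * b) f := by
  rw [TemperedDistribution.fourierMultiplierCLM_fourierMultiplierCLM_apply hb ha, mul_comm]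

theorem multiplier_comm {a b : ℝ → ℂ} (ha : a.HasTemperateGrowth) (hb : b.HasTemperateGrowth)
    (f : 𝓢'(ℝ, ℂ)) : TemperedDistribution.fourierMultiplierCLM ℂ a
      (TemperedDistribution.fourierMultiplierCLM ℂ b f) =
      TemperedDistribution.fourierMultiplierCLM ℂ b
      (TemperedDistribution.fourierMultiplierCLM ℂ a f) := by
  rw [multiplier_comp ha hb, multiplier_comp hb ha, mul_comm]

theorem multiplier_sub {a b : ℝ → ℂ} (ha : a.HasTemperateGrowth) (hb : b.HasTemperateGrowth)
    (f : 𝓢'(ℝ, ℂ)) : TemperedDistribution.fourierMultiplierCLM ℂ (a - b) f =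
      TemperedDistribution.fourierMultiplierCLM ℂ a f -
      TemperedDistribution.fourierMultiplierCLM ℂ b f := by
  rw [TemperedDistribution.fourierMultiplierCLM_apply, TemperedDistribution.smulLeftCLM_sub ha hb]
  exact map_sub (FourierTransform.fourierInvCLM ℂ 𝓢'(ℝ, ℂ)) _ _

theorem dyadicBlock_zero : dyadicBlock 0 = lowBlock 0 := by
  rw [dyadicBlock, dyadicCutoff_zero, lowBlock]

theorem dyadicBlock_succ (j : ℕ) (f : 𝓢'(ℝ, ℂ)) :
    dyadicBlock (j + 1) f = lowBlock (j + 1) f - lowBlock j f := by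
  rw [dyadicBlock, dyadicCutoff_succ, multiplier_sub (temperate_low _) (temperate_low _)]
  rfl

theorem sum_dyadicBlock (n : ℕ) (f : 𝓢'(ℝ, ℂ)) :
    ∑ j ∈ Finset.range (n + 1), dyadicBlock j f = lowBlock n f := by
  induction n with
  | zero => simp [dyadicBlock_zero]
  | succ n ih => rw [Finset.sum_range_succ, ih, dyadicBlock_succ, add_sub_cancel]

theorem dyadicBlock_lowBlock {j n : ℕ} (h : j < n) (f : 𝓢'(ℝ, ℂ)) :
    dyadicBlock j (lowBlock n f) = dyadicBlock j f := by
  rw [dyadicBlock, lowBlock, multiplier_comp (temperate_dyadicCutoff j) (temperate_low n),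
    dyadicCutoff_mul_low h]

theorem dyadicBlock_lowBlock_eq_zero {j n : ℕ} (h : n + 2 ≤ j) (f : 𝓢'(ℝ, ℂ)) :
    dyadicBlock j (lowBlock n f) = 0 := by
  rw [dyadicBlock, lowBlock, multiplier_comp (temperate_dyadicCutoff j) (temperate_low n),
    dyadicCutoff_mul_low_eq_zero h]
  have : (0 : ℝ → ℂ) = fun _ => 0 := rfl
  rw [this, TemperedDistribution.fourierMultiplierCLM_const]
  simp

/-- The low-frequency parts converge to the distribution: `low n` is the dilate of `low 0` by
`2 ^ (-n)`, and multiplication by it converges to the identity on the Schwartz space. -/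
theorem tendsto_lowBlock_apply (f : 𝓢'(ℝ, ℂ)) (θ : 𝓢(ℝ, ℂ)) :
    Tendsto (fun n => lowBlock n f θ) atTop (𝓝 (f θ)) := by
  have h1 := tendsto_dilate_smul (lowS 0) (𝓕⁻ θ)
  have h2 : Tendsto (fun n : ℕ => ((2 : ℝ)⁻¹) ^ n) atTop (𝓝 0) :=
    tendsto_pow_atTop_nhds_zero_of_lt_one (by norm_num) (by norm_num)
  have h3 : (lowS 0) 0 = 1 := low_eq_one (by simp)
  rw [h3, one_smul] at h1
  have h4 := ((f.continuous.comp
    (FourierTransform.fourierCLM ℂ 𝓢(ℝ, ℂ)).continuous).tendsto (𝓕⁻ θ)).comp (h1.comp h2)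
  have h5 : f (𝓕 (𝓕⁻ θ)) = f θ := by rw [FourierTransform.fourier_fourierInv_eq]
  change Tendsto _ atTop (𝓝 (f (𝓕 (𝓕⁻ θ)))) at h4
  rw [h5] at h4
  refine h4.congr fun n => ?_
  rw [lowBlock, TemperedDistribution.fourierMultiplierCLM_apply_apply]
  have : (fun x : ℝ => (lowS 0) (2⁻¹ ^ n * x)) = low n := by
    funext x
    simp only [lowS_coe, low, pow_zero, div_one, inv_pow]
    rw [inv_mul_eq_div]
  rw [← this]
  rfl

theorem eq_zero_of_lowBlock {f : 𝓢'(ℝ, ℂ)} (h : ∀ n, lowBlock n f = 0) : f = 0 := by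
  ext θ
  refine tendsto_nhds_unique (tendsto_lowBlock_apply f θ) ?_
  simp only [h]
  exact tendsto_const_nhds

theorem eq_zero_of_dyadicBlock {f : 𝓢'(ℝ, ℂ)} (h : ∀ j, dyadicBlock j f = 0) : f = 0 := by
  refine eq_zero_of_lowBlock fun n => ?_
  rw [← sum_dyadicBlock]
  exact Finset.sum_eq_zero fun j _ => h j

/-! ### The kernels of the low-frequency cut-offs -/

/-- The convolution kernel of `lowBlock n`. -/
def lowKernel (n : ℕ) : 𝓢(ℝ, ℂ) := 𝓕⁻ (lowS n)

theorem fourier_lowKernel (n : ℕ) : 𝓕 (lowKernel n : ℝ → ℂ) = low n := by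
  rw [← SchwartzMap.fourier_coe, lowKernel, FourierTransform.fourier_fourierInv_eq, lowS_coe]

theorem lowKernel_apply (n : ℕ) (x : ℝ) :
    lowKernel n x = 2 ^ n * lowKernel 0 (2 ^ n * x) := by
  rw [lowKernel, lowKernel, SchwartzMap.fourierInv_coe, SchwartzMap.fourierInv_coe,
    Real.fourierInv_eq, Real.fourierInv_eq]
  have hp : (0 : ℝ) < 2 ^ n := by positivity
  have h := Measure.integral_comp_div (fun v : ℝ => Real.fourierChar (inner ℝ v (2 ^ n * x)) •
    (lowS 0) v) (2 ^ n)
  rw [abs_of_pos hp] at h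
  rw [show ((2 : ℂ) ^ n) * (∫ v : ℝ, Real.fourierChar (inner ℝ v (2 ^ n * x)) • (lowS 0) v) =
    (2 ^ n : ℝ) • ∫ v : ℝ, Real.fourierChar (inner ℝ v (2 ^ n * x)) • (lowS 0) v by
      simp [Complex.real_smul], ← h]
  refine integral_congr_ae (Eventually.of_forall fun v => ?_)
  simp only [lowS_coe, low, pow_zero, div_one, RCLike.inner_apply, conj_trivial]
  rw [show 2 ^ n * x * (v / 2 ^ n) = x * v by field_simp]

theorem lowKernel_neg (n : ℕ) (x : ℝ) : lowKernel n (-x) = lowKernel n x := by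
  rw [lowKernel, SchwartzMap.fourierInv_coe, Real.fourierInv_eq, Real.fourierInv_eq,
    ← integral_neg_eq_self]
  refine integral_congr_ae (Eventually.of_forall fun v => ?_)
  simp [low_neg]

theorem integral_lowKernel (n : ℕ) : ∫ x, lowKernel n x = 1 := by
  have h := congrFun (fourier_lowKernel n) 0
  rw [Real.fourier_eq, low_eq_one (by simp)] at h
  simpa using h

/-- The `L_1` norm of the low-frequency kernels does not depend on the frequency. -/
def lowConst : ℝ := ∫ x, ‖lowKernel 0 x‖

theorem lowConst_nonneg : 0 ≤ lowConst := integral_nonneg fun _ => norm_nonneg _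

theorem integral_norm_lowKernel (n : ℕ) : ∫ x, ‖lowKernel n x‖ = lowConst := by
  have h := Measure.integral_comp_mul_left (fun x : ℝ => ‖lowKernel 0 x‖) (2 ^ n)
  have hp : (0 : ℝ) < 2 ^ n := by positivity
  simp_rw [lowKernel_apply n, norm_mul, norm_pow, Complex.norm_ofNat, integral_const_mul]
  rw [h, abs_of_pos (by positivity), smul_eq_mul, ← mul_assoc, mul_inv_cancel₀ hp.ne', one_mul]
  rfl

theorem integral_abs_mul_norm_lowKernel (n : ℕ) :
    ∫ x, |x| * ‖lowKernel n x‖ = (2 ^ n)⁻¹ * ∫ x, |x| * ‖lowKernel 0 x‖ := by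
  have hp : (0 : ℝ) < 2 ^ n := by positivity
  have h := Measure.integral_comp_mul_left (fun x : ℝ => |x| * ‖lowKernel 0 x‖) (2 ^ n)
  rw [abs_of_pos (by positivity), smul_eq_mul] at h
  rw [← h]
  refine integral_congr_ae (Eventually.of_forall fun x => ?_)
  simp only
  rw [lowKernel_apply n, norm_mul, norm_pow, Complex.norm_ofNat, abs_mul, abs_of_pos hp]
  ring

theorem integral_norm_deriv_lowKernel (n : ℕ) :
    ∫ x, ‖deriv (lowKernel n) x‖ = 2 ^ n * ∫ x, ‖deriv (lowKernel 0) x‖ := by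
  have hp : (0 : ℝ) < 2 ^ n := by positivity
  have h := Measure.integral_comp_mul_left (fun x : ℝ => ‖deriv (lowKernel 0) x‖) (2 ^ n)
  rw [abs_of_pos (by positivity), smul_eq_mul] at h
  have hd : ∀ x, deriv (lowKernel n) x = 2 ^ n * (2 ^ n * deriv (lowKernel 0) (2 ^ n * x)) := by
    intro x
    have e : (lowKernel n : ℝ → ℂ) = fun x => 2 ^ n * lowKernel 0 (2 ^ n * x) :=
      funext (lowKernel_apply n)
    have hx := ((lowKernel 0).hasDerivAt (2 ^ n * x)).scomp x
      ((hasDerivAt_id x).const_mul ((2 : ℝ) ^ n))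
    rw [e]
    have := (hx.const_mul ((2 : ℂ) ^ n)).deriv
    simpa [Function.comp_def, Complex.real_smul] using this
  simp_rw [hd, norm_mul, norm_pow, Complex.norm_ofNat, integral_const_mul]
  rw [h]
  field_simp

/-! ### Low-frequency cut-offs on `L_q` -/

/-- `lowBlock n` as an operator on `L_q`. -/
def lowLp (hq : q ≠ ⊤) (n : ℕ) : LpC q →L[ℂ] LpC q := convCLM hq (lowKernel n).integrable

theorem toDist_lowLp (hq : q ≠ ⊤) (n : ℕ) (F : LpC q) :
    toDist (lowLp hq n F) = lowBlock n (toDist F) := by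
  have h := toDist_conv hq (lowKernel n).integrable
    (by rw [fourier_lowKernel]; exact temperate_low n) F
  rw [fourier_lowKernel] at h
  exact h

theorem norm_lowLp_le (hq : q ≠ ⊤) (n : ℕ) (F : LpC q) : ‖lowLp hq n F‖ ≤ lowConst * ‖F‖ := by
  rw [← integral_norm_lowKernel n]
  exact norm_conv_le _ F

/-- `dyadicBlock j` as an operator on `L_q`. -/
def blockLp (hq : q ≠ ⊤) : ℕ → LpC q →L[ℂ] LpC q
  | 0 => lowLp hq 0
  | j + 1 => lowLp hq (j + 1) - lowLp hq j

theorem toDist_blockLp (hq : q ≠ ⊤) (j : ℕ) (F : LpC q) :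
    toDist (blockLp hq j F) = dyadicBlock j (toDist F) := by
  cases j with
  | zero => rw [dyadicBlock_zero, ← toDist_lowLp hq]; rfl
  | succ j =>
    rw [dyadicBlock_succ, ← toDist_lowLp hq, ← toDist_lowLp hq, ← map_sub]
    rfl

theorem norm_blockLp_le (hq : q ≠ ⊤) (j : ℕ) (F : LpC q) :
    ‖blockLp hq j F‖ ≤ 2 * lowConst * ‖F‖ := by
  have h0 := mul_nonneg lowConst_nonneg (norm_nonneg F)
  cases j with
  | zero =>
    have := norm_lowLp_le hq 0 F
    change ‖lowLp hq 0 F‖ ≤ _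
    linarith
  | succ j =>
    change ‖lowLp hq (j + 1) F - lowLp hq j F‖ ≤ _
    have h1 := norm_sub_le (lowLp hq (j + 1) F) (lowLp hq j F)
    have h2 := norm_lowLp_le hq (j + 1) F
    have h3 := norm_lowLp_le hq j F
    linarith

theorem translate_translate (s t : ℝ) (F : LpC q) :
    translate s (translate t F) = translate (t + s) F := by
  apply toDist_injective
  ext θ
  rw [toDist_translate, toDist_translate]
  have h := toDist_translate t F (SchwartzMap.compSubConstCLM ℂ (-s) θ)
  rw [toDist_apply] at h
  simp only [SchwartzMap.compSubConstCLM_apply, sub_neg_eq_add] at h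
  rw [h]
  simp only [add_assoc]

theorem translate_zero (F : LpC q) : translate 0 F = F := by
  apply toDist_injective
  ext θ
  rw [toDist_translate, toDist_apply]
  simp

theorem translate_conv (hq : q ≠ ⊤) {k : ℝ → ℂ} (hk : Integrable k) (s : ℝ) (F : LpC q) :
    translate s (conv k F) = conv (fun t => k (t - s)) F := by
  have h := (translate (q := q) s).toContinuousLinearMap.integral_comp_comm
    (integrable_conv hq hk F)
  change ∫ t, translate s (k t • translate t F) = translate s (conv k F) at h
  rw [← h, conv, ← integral_sub_right_eq_self (fun t => translate s (k t • translate t F)) s]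
  refine integral_congr_ae (Eventually.of_forall fun t => ?_)
  simp only [map_smul]
  rw [translate_translate, sub_add_cancel]

/-- Kernels whose second differences are of first order in `L_1`; convolution with such a kernel
raises the smoothness by one. -/
def IsZygmundKernel (k : ℝ → ℂ) : Prop :=
  ∃ C : ℝ, ∀ s : ℝ, ∫ t, ‖k (t - s) + k (t + s) - (2 : ℂ) * k t‖ ≤ C * |s|

/-- A second difference of a convolution is the convolution with the second difference of the
kernel. -/
theorem norm_secondDifference_conv_le (hq : q ≠ ⊤) {k : ℝ → ℂ} (hk : Integrable k) (s : ℝ)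
    (F : LpC q) : ‖translate s (conv k F) + translate (-s) (conv k F) - (2 : ℂ) • conv k F‖ ≤
      (∫ t, ‖k (t - s) + k (t + s) - (2 : ℂ) * k t‖) * ‖F‖ := by
  have h1 : Integrable fun t => k (t - s) := hk.comp_sub_right s
  have h2 : Integrable fun t => k (t + s) := hk.comp_add_right s
  have e : translate s (conv k F) + translate (-s) (conv k F) - (2 : ℂ) • conv k F =
      conv (fun t => k (t - s) + k (t + s) - (2 : ℂ) * k t) F := by
    rw [translate_conv hq hk, translate_conv hq hk]
    simp only [sub_neg_eq_add, conv]
    have i12 : Integrable fun t => k (t - s) • translate t F + k (t + s) • translate t F :=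
      (integrable_conv hq h1 F).add (integrable_conv hq h2 F)
    have i3 : Integrable fun t => (2 : ℂ) • k t • translate t F :=
      (integrable_conv hq hk F).smul (2 : ℂ)
    rw [← integral_add (integrable_conv hq h1 F) (integrable_conv hq h2 F), ← integral_smul,
      ← integral_sub i12 i3]
    refine integral_congr_ae (Eventually.of_forall fun t => ?_)
    simp only [sub_smul, add_smul, mul_smul]
  rw [e]
  exact norm_conv_le _ F

/-- As `lowKernel n` is even and has integral `1`, the difference between `lowLp n G` and `G` is
an average of second differences of `G`. -/
theorem lowLp_sub_self_eq (hq : q ≠ ⊤) (n : ℕ) (G : LpC q) :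
    lowLp hq n G - G = (2⁻¹ : ℂ) •
      ∫ s, lowKernel n s • (translate s G + translate (-s) G - (2 : ℂ) • G) := by
  have hk := (lowKernel n).integrable (μ := volume)
  have i1 := integrable_conv hq hk G
  have i2 : Integrable fun s => lowKernel n s • translate (-s) G := by
    refine i1.comp_neg.congr (Eventually.of_forall fun s => ?_)
    simp only [lowKernel_neg]
  have i3 : Integrable fun s => lowKernel n s • (2 : ℂ) • G := hk.smul_const _
  have e2 : ∫ s, lowKernel n s • translate (-s) G = conv (lowKernel n) G := by
    rw [conv, ← integral_neg_eq_self]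
    refine integral_congr_ae (Eventually.of_forall fun s => ?_)
    simp only [lowKernel_neg, neg_neg]
  have e3 : ∫ s, lowKernel n s • (2 : ℂ) • G = (2 : ℂ) • G := by
    rw [integral_smul_const, integral_lowKernel, one_smul]
  simp only [smul_sub, smul_add]
  have i12 : Integrable fun s => lowKernel n s • translate s G + lowKernel n s • translate (-s) G :=
    i1.add i2
  rw [integral_sub i12 i3, integral_add i1 i2, e2, e3]
  change _ = (2⁻¹ : ℂ) • (conv (lowKernel n) G + conv (lowKernel n) G - (2 : ℂ) • G)
  rw [← two_smul ℂ (conv _ G), ← smul_sub, smul_smul]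
  norm_num
  rfl

/-- Convolutions with a Zygmund kernel are approximated by their low-frequency parts at the rate
`2 ^ (-n)`, since `∫ |s| ‖lowKernel n s‖ ds` is a multiple of `2 ^ (-n)`. -/
theorem norm_lowLp_conv_sub_le (hq : q ≠ ⊤) {k : ℝ → ℂ} (hk : Integrable k)
    (hz : IsZygmundKernel k) : ∃ C : ℝ, 0 ≤ C ∧ ∀ (n : ℕ) (F : LpC q),
      ‖lowLp hq n (conv k F) - conv k F‖ ≤ C * (2 ^ n)⁻¹ * ‖F‖ := by
  obtain ⟨C, hC⟩ := hz
  have hC0 : 0 ≤ C := by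
    have := (integral_nonneg fun _ => norm_nonneg _).trans (hC 1)
    simpa using this
  refine ⟨2⁻¹ * (C * ∫ x, |x| * ‖lowKernel 0 x‖), by
    have : 0 ≤ ∫ x, |x| * ‖lowKernel 0 x‖ := integral_nonneg fun x => by positivity
    positivity, fun n F => ?_⟩
  rw [lowLp_sub_self_eq, norm_smul]
  have h1 : ‖∫ s, lowKernel n s • (translate s (conv k F) + translate (-s) (conv k F) -
      (2 : ℂ) • conv k F)‖ ≤ ∫ s, (C * ‖F‖) * (|s| * ‖lowKernel n s‖) := by
    refine norm_integral_le_of_norm_le ?_ (Eventually.of_forall fun s => ?_)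
    · have := (lowKernel n).integrable_pow_mul volume 1
      simp only [pow_one, Real.norm_eq_abs] at this
      exact this.const_mul _
    · rw [norm_smul]
      have h2 := norm_secondDifference_conv_le hq hk s F
      have h3 := mul_le_mul_of_nonneg_right (hC s) (norm_nonneg F)
      have h4 := mul_le_mul_of_nonneg_left (h2.trans h3) (norm_nonneg (lowKernel n s))
      refine h4.trans (le_of_eq ?_)
      ring
  rw [integral_const_mul, integral_abs_mul_norm_lowKernel] at h1
  refine (mul_le_mul_of_nonneg_left h1 (norm_nonneg _)).trans (le_of_eq ?_)
  norm_num
  ring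

/-! ### Operators between Besov spaces -/

variable {p : ℝ≥0∞} [Fact (1 ≤ p)] {σ τ ρ : ℝ}

/-- The weight `2^{jσ}`. -/
def wt (j : ℕ) (σ : ℝ) : ℝ := (2 : ℝ) ^ ((j : ℝ) * σ)

theorem wt_pos (j : ℕ) (σ : ℝ) : 0 < wt j σ := Real.rpow_pos_of_pos two_pos _

theorem wt_add (j : ℕ) (σ τ : ℝ) : wt j (σ + τ) = wt j σ * wt j τ := by
  rw [wt, mul_add, Real.rpow_add two_pos]; rfl

theorem wt_index_add (i j : ℕ) (σ : ℝ) : wt (i + j) σ = wt i σ * wt j σ := by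
  rw [wt, Nat.cast_add, add_mul, Real.rpow_add two_pos]; rfl

theorem wt_neg (j : ℕ) (σ : ℝ) : wt j (-σ) = (wt j σ)⁻¹ := by
  rw [wt, mul_neg, Real.rpow_neg two_pos.le]; rfl

theorem wt_one (j : ℕ) : wt j 1 = 2 ^ j := by
  rw [wt, mul_one, Real.rpow_natCast]

theorem wt_nat (j n : ℕ) : wt j n = (2 ^ j) ^ n := by
  rw [wt, ← Nat.cast_mul, Real.rpow_natCast, pow_mul]

theorem wt_eq_pow (j : ℕ) (σ : ℝ) : wt j σ = ((2 : ℝ) ^ σ) ^ j := by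
  rw [wt, mul_comm, Real.rpow_mul two_pos.le, Real.rpow_natCast]

theorem summable_wt (h : σ < 0) : Summable fun j => wt j σ := by
  simp_rw [wt_eq_pow]
  exact summable_geometric_of_lt_one (Real.rpow_nonneg two_pos.le _)
    (Real.rpow_lt_one_of_one_lt_of_neg one_lt_two h)

theorem p_ne_zero : p ≠ 0 := (zero_lt_one.trans_le (Fact.out : 1 ≤ p)).ne'

theorem dist_injective : Function.Injective (Besov.dist (σ := σ) (p := p)) :=
  Subtype.val_injective

theorem toDist_blocks (f : Besov σ p) (j : ℕ) :
    toDist (Besov.blocks f j) = ((wt j σ : ℝ) : ℂ) • dyadicBlock j (Besov.dist f) :=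
  Besov.blocksFun_spec f j

theorem norm_eq_norm_blocks (f : Besov σ p) : ‖f‖ = ‖Besov.blocks f‖ := rfl

theorem norm_blocks_le (f : Besov σ p) (j : ℕ) : ‖Besov.blocks f j‖ ≤ ‖f‖ :=
  lp.norm_apply_le_norm p_ne_zero (Besov.blocks f) j

theorem blocks_injective : Function.Injective (Besov.blocks (σ := σ) (p := p)) := by
  refine (injective_iff_map_eq_zero _).mpr fun f hf => dist_injective ?_
  rw [map_zero]
  refine eq_zero_of_dyadicBlock fun j => ?_
  have h := toDist_blocks f j
  rw [hf, lp.coeFn_zero, Pi.zero_apply, map_zero] at h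
  exact (smul_eq_zero.mp h.symm).resolve_left (by exact_mod_cast (wt_pos j σ).ne')

theorem isometry_blocks : Isometry (Besov.blocks (σ := σ) (p := p)) :=
  AddMonoidHomClass.isometry_of_norm _ fun _ => rfl

instance : T2Space (Besov σ p) :=
  T2Space.of_injective_continuous blocks_injective isometry_blocks.continuous

/-- The Littlewood–Paley block `F⁻¹ φ_j F f` as an `L_p` function. -/
def piece (f : Besov σ p) (j : ℕ) : LpC p := ((wt j σ : ℝ) : ℂ)⁻¹ • Besov.blocks f j

theorem toDist_piece (f : Besov σ p) (j : ℕ) :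
    toDist (piece f j) = dyadicBlock j (Besov.dist f) := by
  rw [piece, map_smul, toDist_blocks, smul_smul, inv_mul_cancel₀, one_smul]
  exact_mod_cast (wt_pos j σ).ne'

theorem blocks_eq_smul_piece (f : Besov σ p) (j : ℕ) :
    Besov.blocks f j = ((wt j σ : ℝ) : ℂ) • piece f j := by
  rw [piece, smul_smul, mul_inv_cancel₀, one_smul]
  exact_mod_cast (wt_pos j σ).ne'

theorem norm_wt_smul (j : ℕ) (σ : ℝ) (F : LpC p) :
    ‖((wt j σ : ℝ) : ℂ) • F‖ = wt j σ * ‖F‖ := by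
  rw [norm_smul, Complex.norm_real, Real.norm_of_nonneg (wt_pos j σ).le]

theorem norm_blocks_eq (f : Besov σ p) (j : ℕ) :
    ‖Besov.blocks f j‖ = wt j σ * ‖piece f j‖ := by
  rw [blocks_eq_smul_piece, norm_wt_smul]

theorem norm_piece_le (f : Besov σ p) (j : ℕ) : ‖piece f j‖ ≤ wt j (-σ) * ‖f‖ := by
  rw [wt_neg, ← div_eq_inv_mul, le_div_iff₀' (wt_pos j σ), ← norm_blocks_eq]
  exact norm_blocks_le f j

/-- A distribution whose blocks are dominated by a `p`-summable sequence lies in the Besov space. -/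
theorem exists_besov (f : 𝓢'(ℝ, ℂ)) (G : ℕ → LpC p) (b : lp (fun _ : ℕ => ℝ) p)
    (hG : ∀ j, toDist (G j) = dyadicBlock j f) (hb : ∀ j, wt j τ * ‖G j‖ ≤ b j) :
    ∃ u : Besov τ p, Besov.dist u = f ∧ ‖u‖ ≤ ‖b‖ := by
  have hb' : ∀ j, ‖((wt j τ : ℝ) : ℂ) • G j‖ ≤ b j := fun j => by rw [norm_wt_smul]; exact hb j
  have hmem : Memℓp (fun j => ((wt j τ : ℝ) : ℂ) • G j) p := (lp.memℓp b).mono hb'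
  let u : Besov τ p := ⟨f, ⟨⟨_, hmem⟩, fun j => by
    change toDist (((wt j τ : ℝ) : ℂ) • G j) = _
    rw [map_smul, hG]; rfl⟩⟩
  refine ⟨u, rfl, ?_⟩
  rw [norm_eq_norm_blocks]
  refine lp.norm_mono p_ne_zero fun j => ?_
  have : Besov.blocks u j = ((wt j τ : ℝ) : ℂ) • G j := by
    apply toDist_injective
    rw [toDist_blocks, map_smul, hG]; rfl
  rw [this]
  exact (hb' j).trans (le_abs_self _)

variable (p) in
/-- `T` maps `B^σ_{p,p}` to `B^τ_{p,p}` with norm at most `C`. -/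
def BesovBound (C : ℝ) (T : 𝓢'(ℝ, ℂ) →L[ℂ] 𝓢'(ℝ, ℂ)) (σ τ : ℝ) : Prop :=
  ∀ f : Besov σ p, ∃ g : Besov τ p, Besov.dist g = T (Besov.dist f) ∧ ‖g‖ ≤ C * ‖f‖

namespace BesovBound

variable {C C' : ℝ} {T T' : 𝓢'(ℝ, ℂ) →L[ℂ] 𝓢'(ℝ, ℂ)}

/-- The bounded operator between Besov spaces. -/
def clm (h : BesovBound p C T σ τ) : Besov σ p →L[ℂ] Besov τ p :=
  LinearMap.mkContinuous
    { toFun := fun f => (h f).choose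
      map_add' := fun f g => dist_injective <| by
        refine (h (f + g)).choose_spec.1.trans ?_
        rw [map_add Besov.dist, map_add, map_add Besov.dist, (h f).choose_spec.1,
          (h g).choose_spec.1]
      map_smul' := fun c f => dist_injective <| by
        refine (h (c • f)).choose_spec.1.trans ?_
        rw [map_smul Besov.dist, map_smul, map_smul Besov.dist, (h f).choose_spec.1]; rfl }
    C fun f => (h f).choose_spec.2

@[simp]
theorem dist_clm (h : BesovBound p C T σ τ) (f : Besov σ p) :
    Besov.dist (h.clm f) = T (Besov.dist f) := (h f).choose_spec.1

theorem norm_clm_le (h : BesovBound p C T σ τ) (f : Besov σ p) : ‖h.clm f‖ ≤ C * ‖f‖ :=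
  (h f).choose_spec.2

theorem mono (h : BesovBound p C T σ τ) (hC : C ≤ C') : BesovBound p C' T σ τ := fun f => by
  obtain ⟨g, h1, h2⟩ := h f
  exact ⟨g, h1, h2.trans (mul_le_mul_of_nonneg_right hC (norm_nonneg _))⟩

theorem comp (h' : BesovBound p C' T' τ ρ) (h : BesovBound p C T σ τ) (hC : 0 ≤ C') :
    BesovBound p (C' * C) (T' ∘L T) σ ρ := fun f => by
  obtain ⟨g, h1, h2⟩ := h f
  obtain ⟨k, h3, h4⟩ := h' g
  refine ⟨k, by rw [h3, h1]; rfl, h4.trans ?_⟩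
  rw [mul_assoc]
  exact mul_le_mul_of_nonneg_left h2 hC

theorem add (h : BesovBound p C T σ τ) (h' : BesovBound p C' T' σ τ) :
    BesovBound p (C + C') (T + T') σ τ := fun f => by
  obtain ⟨g, h1, h2⟩ := h f
  obtain ⟨k, h3, h4⟩ := h' f
  refine ⟨g + k, by rw [map_add, h1, h3]; rfl, (norm_add_le _ _).trans ?_⟩
  rw [add_mul]
  exact add_le_add h2 h4

theorem smul (h : BesovBound p C T σ τ) (c : ℂ) :
    BesovBound p (‖c‖ * C) (c • T) σ τ := fun f => by
  obtain ⟨g, h1, h2⟩ := h f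
  refine ⟨c • g, by rw [map_smul, h1]; rfl, ?_⟩
  rw [norm_smul, mul_assoc]
  exact mul_le_mul_of_nonneg_left h2 (norm_nonneg _)

theorem sub (h : BesovBound p C T σ τ) (h' : BesovBound p C' T' σ τ) :
    BesovBound p (C + C') (T - T') σ τ := by
  have := h.add (h'.smul (-1))
  rwa [norm_neg, norm_one, one_mul, neg_one_smul, ← sub_eq_add_neg] at this

end BesovBound

/-- An operator that acts on each block, gaining `σ - τ` derivatives uniformly in the block. -/
theorem besovBound_of_blocks {C : ℝ} (T : 𝓢'(ℝ, ℂ) →L[ℂ] 𝓢'(ℝ, ℂ))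
    (h : ∀ (f : 𝓢'(ℝ, ℂ)) (j : ℕ) (F : LpC p), toDist F = dyadicBlock j f →
      ∃ G : LpC p, toDist G = dyadicBlock j (T f) ∧ wt j (τ - σ) * ‖G‖ ≤ C * ‖F‖) :
    BesovBound p C T σ τ := fun f => by
  rcases lt_or_ge C 0 with hC | hC
  -- A negative constant forces `f = 0`.
  · have hz : ∀ j, dyadicBlock j (Besov.dist f) = 0 := fun j => by
      obtain ⟨G, -, h2⟩ := h _ j _ (toDist_piece f j)
      have : 0 ≤ C * ‖piece f j‖ := (mul_nonneg (wt_pos _ _).le (norm_nonneg _)).trans h2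
      have : ‖piece f j‖ = 0 := le_antisymm (by nlinarith [norm_nonneg (piece f j)]) (norm_nonneg _)
      rw [← toDist_piece, norm_eq_zero.mp this, map_zero]
    have : f = 0 := dist_injective (by rw [eq_zero_of_dyadicBlock hz, map_zero])
    exact ⟨0, by rw [this, map_zero, map_zero, map_zero],
      by rw [this, norm_zero, norm_zero, mul_zero]⟩
  choose G hG1 hG2 using fun j => h _ j _ (toDist_piece f j)
  obtain ⟨u, hu, hu'⟩ := exists_besov (τ := τ) (T (Besov.dist f)) G (C • lp.toNorm (Besov.blocks f))
    hG1 fun j => by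
      rw [lp.coeFn_smul, Pi.smul_apply, smul_eq_mul]
      change _ ≤ C * ‖Besov.blocks f j‖
      rw [norm_blocks_eq]
      have : wt j τ = wt j σ * wt j (τ - σ) := by rw [← wt_add]; congr 1; ring
      rw [this, mul_assoc, mul_left_comm C]
      exact mul_le_mul_of_nonneg_left (hG2 j) (wt_pos _ _).le
  refine ⟨u, hu, hu'.trans ?_⟩
  rw [norm_smul, lp.norm_toNorm, Real.norm_of_nonneg hC]; rfl

/-- The multiplier with symbol `a`. -/
abbrev mult (a : ℝ → ℂ) : 𝓢'(ℝ, ℂ) →L[ℂ] 𝓢'(ℝ, ℂ) := TemperedDistribution.fourierMultiplierCLM ℂ a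

theorem dyadicBlock_mult {a : ℝ → ℂ} (ha : a.HasTemperateGrowth) (j : ℕ) (f : 𝓢'(ℝ, ℂ)) :
    dyadicBlock j (mult a f) = mult a (dyadicBlock j f) :=
  multiplier_comm (temperate_dyadicCutoff j) ha f

theorem besovBound_embedding (h : τ ≤ σ) : BesovBound p 1 (ContinuousLinearMap.id ℂ _) σ τ :=
  besovBound_of_blocks _ fun f j F hF => ⟨F, hF, by
    refine mul_le_mul_of_nonneg_right ?_ (norm_nonneg _)
    exact Real.rpow_le_one_of_one_le_of_nonpos one_le_two
      (mul_nonpos_of_nonneg_of_nonpos j.cast_nonneg (by linarith))⟩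

theorem besovBound_conv (hp : p ≠ ⊤) {k : ℝ → ℂ} (hk : IsMomentKernel k) :
    BesovBound p (∫ s, ‖k s‖) (mult (𝓕 k)) σ σ :=
  besovBound_of_blocks _ fun f j F hF => ⟨conv k F, by
    rw [toDist_conv hp hk.integrable hk.temperate, hF, dyadicBlock_mult hk.temperate], by
    rw [sub_self, wt, mul_zero, Real.rpow_zero, one_mul]
    exact norm_conv_le k F⟩

theorem besovBound_lowBlock (hp : p ≠ ⊤) (n : ℕ) : BesovBound p lowConst (lowBlock n) σ σ := by
  have := besovBound_conv (p := p) (σ := σ) hp (isMomentKernel_schwartz (lowKernel n))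
  rwa [fourier_lowKernel, integral_norm_lowKernel] at this

/-- Removing the frequencies below `2^n` costs a factor `2^{-n}` per derivative. -/
theorem besovBound_id_sub_lowBlock (hp : p ≠ ⊤) (n : ℕ) :
    BesovBound p ((1 + lowConst) * (2 ^ n)⁻¹) (ContinuousLinearMap.id ℂ _ - lowBlock n) (σ + 1) σ :=
  besovBound_of_blocks _ fun f j F hF => by
    have hd : dyadicBlock j ((ContinuousLinearMap.id ℂ 𝓢'(ℝ, ℂ) - lowBlock n) f) =
        dyadicBlock j f - lowBlock n (dyadicBlock j f) := by
      change dyadicBlock j (f - lowBlock n f) = _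
      rw [map_sub]; congr 1
      exact dyadicBlock_mult (temperate_low n) j f
    have hw : wt j (σ - (σ + 1)) = (2 ^ j)⁻¹ := by
      rw [← wt_one, ← wt_neg]; congr 1; ring
    -- `lowBlock n` reproduces the blocks `j < n`; for `j ≥ n` the weight
    -- gains `2 ^ (-j) ≤ 2 ^ (-n)`.
    rcases lt_or_ge j n with h | h
    · refine ⟨0, ?_, ?_⟩
      · have h1 : lowBlock n (dyadicBlock j f) = dyadicBlock j f :=
          (dyadicBlock_mult (temperate_low n) j f).symm.trans (dyadicBlock_lowBlock h f)
        rw [hd, h1, sub_self, map_zero]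
      · rw [norm_zero, mul_zero]
        have := lowConst_nonneg
        positivity
    · refine ⟨F - lowLp hp n F, by rw [hd, map_sub, toDist_lowLp, hF], ?_⟩
      have h1 : ‖F - lowLp hp n F‖ ≤ (1 + lowConst) * ‖F‖ := by
        refine (norm_sub_le _ _).trans ?_
        rw [add_mul, one_mul]
        exact add_le_add le_rfl (norm_lowLp_le hp n F)
      have h2 : ((2 : ℝ) ^ j)⁻¹ ≤ (2 ^ n)⁻¹ :=
        inv_anti₀ (by positivity) (pow_le_pow_right₀ one_le_two h)
      rw [hw]
      calc ((2 : ℝ) ^ j)⁻¹ * ‖F - lowLp hp n F‖ ≤ (2 ^ n)⁻¹ * ((1 + lowConst) * ‖F‖) := by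
            gcongr
        _ = _ := by ring

/-- Convolution with a Zygmund kernel gains one derivative: the block of index `j = n + 2` is
annihilated by `lowBlock n`, so that its convolution with `k` equals the approximation error of
`norm_lowLp_conv_sub_le`, which is `O(2 ^ (-n))`. -/
theorem besovBound_zygmund (hp : p ≠ ⊤) {k : ℝ → ℂ} (hk : IsMomentKernel k)
    (hz : IsZygmundKernel k) : ∃ C, 0 ≤ C ∧ ∀ σ, BesovBound p C (mult (𝓕 k)) σ (σ + 1) := by
  obtain ⟨C, hC, h⟩ := norm_lowLp_conv_sub_le hp hk.integrable hz
  have hk0 : 0 ≤ ∫ s, ‖k s‖ := integral_nonneg fun _ => norm_nonneg _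
  refine ⟨4 * C + 2 * ∫ s, ‖k s‖, by positivity, fun σ => ?_⟩
  refine besovBound_of_blocks _ fun f j F hF => ⟨conv k F, by
    rw [toDist_conv hp hk.integrable hk.temperate, hF, dyadicBlock_mult hk.temperate], ?_⟩
  rw [add_sub_cancel_left, wt_one]
  rcases lt_or_ge j 2 with hj | hj
  -- The two lowest blocks contribute only a bounded weight.
  · have h1 : (2 : ℝ) ^ j ≤ 2 := by
      calc (2 : ℝ) ^ j ≤ 2 ^ 1 := pow_le_pow_right₀ one_le_two (by omega)
        _ = 2 := pow_one 2
    calc (2 : ℝ) ^ j * ‖conv k F‖ ≤ 2 * ((∫ s, ‖k s‖) * ‖F‖) :=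
          mul_le_mul h1 (norm_conv_le k F) (norm_nonneg _) two_pos.le
      _ ≤ _ := by nlinarith [mul_nonneg hC (norm_nonneg F)]
  · obtain ⟨n, rfl⟩ := Nat.exists_eq_add_of_le' hj
    have h0 : lowLp hp n (conv k F) = 0 := by
      apply toDist_injective
      rw [toDist_lowLp, toDist_conv hp hk.integrable hk.temperate, hF, map_zero]
      rw [lowBlock, multiplier_comm (temperate_low n) hk.temperate]
      have : TemperedDistribution.fourierMultiplierCLM ℂ (low n) (dyadicBlock (n + 2) f) = 0 := by
        rw [← dyadicBlock_mult (temperate_low n)]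
        exact dyadicBlock_lowBlock_eq_zero le_rfl f
      rw [this, map_zero]
    have h1 := h n F
    rw [h0, zero_sub, norm_neg] at h1
    calc (2 : ℝ) ^ (n + 2) * ‖conv k F‖ ≤ 2 ^ (n + 2) * (C * (2 ^ n)⁻¹ * ‖F‖) := by gcongr
      _ = 4 * C * ‖F‖ := by rw [pow_add]; field_simp; ring
      _ ≤ _ := by nlinarith [mul_nonneg hk0 (norm_nonneg F)]


/-! ### Differentiation and its resolvent -/

/-- The derivative of tempered distributions. -/
abbrev D : 𝓢'(ℝ, ℂ) →L[ℂ] 𝓢'(ℝ, ℂ) := TemperedDistribution.derivCLM ℂ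

/-- The symbol `2πiξ` of the derivative. -/
def derivSymbol (ξ : ℝ) : ℂ := 2 * Real.pi * Complex.I * ξ

theorem temperate_derivSymbol : derivSymbol.HasTemperateGrowth := by
  unfold derivSymbol
  fun_prop

theorem D_eq_mult : D = mult derivSymbol := by
  ext f θ
  have h := TemperedDistribution.lineDeriv_eq_fourierMultiplierCLM (F := ℂ) (1 : ℝ) f
  have h1 : D f = LineDeriv.lineDerivOp (1 : ℝ) f := by
    ext η
    rw [TemperedDistribution.derivCLM_apply_apply, TemperedDistribution.lineDerivOp_apply_apply]
    congr 2
  have h2 : derivSymbol = (2 * Real.pi * Complex.I : ℂ) • fun x : ℝ => ((inner ℝ x 1 : ℝ) : ℂ) := by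
    ext x
    simp [derivSymbol]
  rw [h1, h, mult, h2, TemperedDistribution.fourierMultiplierCLM_smul (by
    simp only [inner, RCLike.re, AddMonoidHom.id_apply, one_mul]
    fun_prop)]
  rfl

theorem fourier_deriv_lowKernel (n : ℕ) :
    𝓕 (SchwartzMap.derivCLM ℂ ℂ (lowKernel n) : ℝ → ℂ) = derivSymbol * low n := by
  have h : (SchwartzMap.derivCLM ℂ ℂ (lowKernel n) : ℝ → ℂ) = deriv (lowKernel n) := by
    ext x; rw [SchwartzMap.derivCLM_apply]
  rw [h, Real.fourier_deriv (lowKernel n).integrable (lowKernel n).differentiable (by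
    rw [← h]; exact (SchwartzMap.derivCLM ℂ ℂ (lowKernel n)).integrable), fourier_lowKernel]
  ext x
  simp [derivSymbol]

/-- Bernstein's inequality: a block of index `j` is its own convolution with `lowKernel (j + 1)`,
whose derivative has `L_1` norm `O(2 ^ j)`. -/
theorem besovBound_D (hp : p ≠ ⊤) : ∃ C, 0 ≤ C ∧ ∀ σ, BesovBound p C D (σ + 1) σ := by
  refine ⟨2 * ∫ x, ‖deriv (lowKernel 0) x‖, by
    have : 0 ≤ ∫ x, ‖deriv (lowKernel 0) x‖ := integral_nonneg fun _ => norm_nonneg _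
    positivity, fun σ => besovBound_of_blocks _ fun f j F hF => ?_⟩
  have hk := isMomentKernel_schwartz (SchwartzMap.derivCLM ℂ ℂ (lowKernel (j + 1)))
  refine ⟨conv (SchwartzMap.derivCLM ℂ ℂ (lowKernel (j + 1))) F, ?_, ?_⟩
  · rw [toDist_conv hp hk.integrable hk.temperate, hF, fourier_deriv_lowKernel,
      ← multiplier_comp temperate_derivSymbol (temperate_low _), D_eq_mult,
      dyadicBlock_mult temperate_derivSymbol]
    congr 1
    exact (dyadicBlock_mult (temperate_low _) j f).symm.trans
      (dyadicBlock_lowBlock (Nat.lt_succ_self j) f)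
  · have h1 := norm_conv_le (SchwartzMap.derivCLM ℂ ℂ (lowKernel (j + 1))) F
    simp only [SchwartzMap.derivCLM_apply] at h1
    rw [integral_norm_deriv_lowKernel] at h1
    have hw : wt j (σ - (σ + 1)) = (2 ^ j)⁻¹ := by
      rw [← wt_one, ← wt_neg]; congr 1; ring
    rw [hw]
    refine (mul_le_mul_of_nonneg_left h1 (by positivity)).trans (le_of_eq ?_)
    rw [pow_succ]
    field_simp

/-- The kernel `e^{-t} 1_{t > 0}` of `(∂ + 1)⁻¹`. -/
def expKernel (t : ℝ) : ℂ := if 0 < t then (Real.exp (-t) : ℂ) else 0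

theorem expKernel_eq_indicator :
    expKernel = (Ioi (0 : ℝ)).indicator fun t => (Real.exp (-t) : ℂ) := by
  ext t; simp [expKernel, indicator]

theorem expKernel_of_nonpos {t : ℝ} (h : t ≤ 0) : expKernel t = 0 := if_neg h.not_gt

theorem isMomentKernel_expKernel : IsMomentKernel expKernel where
  meas := by
    rw [expKernel_eq_indicator]
    exact (by fun_prop : Continuous fun t : ℝ => (Real.exp (-t) : ℂ)).aestronglyMeasurable.indicator
      measurableSet_Ioi
  moment n := by
    have h : (fun x : ℝ => |x| ^ n * ‖expKernel x‖) =
        (Ioi (0 : ℝ)).indicator fun x => Real.exp (-x) * x ^ ((n + 1 : ℝ) - 1) := by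
      ext x
      rw [expKernel_eq_indicator]
      by_cases hx : 0 < x
      · rw [indicator_of_mem (mem_Ioi.mpr hx), indicator_of_mem (mem_Ioi.mpr hx),
          Complex.norm_real, Real.norm_of_nonneg (Real.exp_pos _).le, abs_of_pos hx,
          add_sub_cancel_right, Real.rpow_natCast, mul_comm]
      · rw [indicator_of_notMem (by simpa using hx), indicator_of_notMem (by simpa using hx)]
        simp
    rw [h, integrable_indicator_iff measurableSet_Ioi]
    exact Real.GammaIntegral_convergent (by positivity)

/-- A kernel that is Lipschitz in `L_1` under translations is a Zygmund kernel. -/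
theorem isZygmundKernel_of_lipschitz {k : ℝ → ℂ} (hk : Integrable k) {C : ℝ}
    (h : ∀ s : ℝ, 0 ≤ s → ∫ t, ‖k (t - s) - k t‖ ≤ C * s) : IsZygmundKernel k := by
  have key : ∀ s : ℝ, 0 ≤ s → ∫ t, ‖k (t - s) + k (t + s) - (2 : ℂ) * k t‖ ≤ 2 * C * s := by
    intro s hs
    have i1 : Integrable fun t => ‖k (t - s) - k t‖ := ((hk.comp_sub_right s).sub hk).norm
    have i2 : Integrable fun t => ‖k t - k (t + s)‖ := (hk.sub (hk.comp_add_right s)).norm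
    have e2 : ∫ t, ‖k t - k (t + s)‖ = ∫ t, ‖k (t - s) - k t‖ := by
      rw [← integral_sub_right_eq_self (fun t => ‖k t - k (t + s)‖) s]
      simp
    calc ∫ t, ‖k (t - s) + k (t + s) - (2 : ℂ) * k t‖
        ≤ ∫ t, (‖k (t - s) - k t‖ + ‖k t - k (t + s)‖) := by
          refine integral_mono_of_nonneg (Eventually.of_forall fun _ => norm_nonneg _)
            (i1.add i2) (Eventually.of_forall fun t => ?_)
          have : k (t - s) + k (t + s) - 2 * k t = (k (t - s) - k t) - (k t - k (t + s)) := by ring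
          change ‖_‖ ≤ _
          rw [this]
          exact norm_sub_le _ _
      _ ≤ 2 * C * s := by
          rw [integral_add i1 i2, e2]
          linarith [h s hs]
  refine ⟨2 * C, fun s => ?_⟩
  rcases le_total 0 s with hs | hs
  · rw [abs_of_nonneg hs]; exact key s hs
  · rw [abs_of_nonpos hs]
    have := key (-s) (by linarith)
    simp only [sub_neg_eq_add, ← sub_eq_add_neg] at this
    simpa only [add_comm] using this

/-- The kernel is decreasing after its jump at `0`, so that `∫ |k(t - s) - k(t)| dt` is controlled
by the jump and a telescoping difference of integrals. -/
theorem isZygmundKernel_expKernel : IsZygmundKernel expKernel := by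
  have hi := isMomentKernel_expKernel.integrable
  refine isZygmundKernel_of_lipschitz hi (C := 2) fun s hs => ?_
  have hr : Integrable fun t => (expKernel t).re := hi.re
  have i1 : Integrable fun t => (expKernel (t - s)).re - (expKernel t).re :=
    (hr.comp_sub_right s).sub hr
  have i2 : Integrable ((Ioc (0 : ℝ) s).indicator fun _ => (2 : ℝ)) :=
    (integrable_indicator_iff measurableSet_Ioc).mpr (by simp)
  calc ∫ t, ‖expKernel (t - s) - expKernel t‖
      ≤ ∫ t, (((expKernel (t - s)).re - (expKernel t).re) +
          (Ioc (0 : ℝ) s).indicator (fun _ => (2 : ℝ)) t) := by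
        refine integral_mono_of_nonneg (Eventually.of_forall fun _ => norm_nonneg _)
          (i1.add i2) (Eventually.of_forall fun t => ?_)
        change ‖expKernel (t - s) - expKernel t‖ ≤ ((expKernel (t - s)).re - (expKernel t).re) +
          (Ioc (0 : ℝ) s).indicator (fun _ => (2 : ℝ)) t
        by_cases h1 : t ≤ 0
        · rw [expKernel_of_nonpos h1, expKernel_of_nonpos (by linarith), indicator_of_notMem
            (fun h => absurd h.1 h1.not_gt)]
          simp
        by_cases h2 : t ≤ s
        · rw [expKernel_of_nonpos (by linarith : t - s ≤ 0),
            indicator_of_mem (show t ∈ Ioc 0 s from ⟨not_le.mp h1, h2⟩),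
            expKernel, if_pos (not_le.mp h1)]
          have : Real.exp (-t) ≤ 1 := Real.exp_le_one_iff.mpr (by linarith)
          rw [zero_sub, norm_neg, Complex.norm_real, Real.norm_of_nonneg (Real.exp_pos _).le,
            Complex.zero_re, Complex.ofReal_re]
          linarith
        · rw [indicator_of_notMem (fun h => absurd h.2 h2), expKernel, expKernel,
            if_pos (by linarith), if_pos (not_le.mp h1), ← Complex.ofReal_sub, Complex.norm_real,
            Complex.ofReal_re, Complex.ofReal_re, add_zero, Real.norm_of_nonneg]
          have : Real.exp (-t) ≤ Real.exp (-(t - s)) := Real.exp_le_exp.mpr (by linarith)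
          linarith
    _ = 2 * s := by
        rw [integral_add i1 i2, integral_sub (hr.comp_sub_right s) hr,
          integral_sub_right_eq_self (fun t => (expKernel t).re) s, sub_self, zero_add,
          integral_indicator measurableSet_Ioc]
        simp [hs, mul_comm]

theorem fourier_expKernel (ξ : ℝ) : (derivSymbol ξ + 1) * 𝓕 expKernel ξ = 1 := by
  have h0 : (derivSymbol ξ + 1).re = 1 := by simp [derivSymbol]
  have hne : derivSymbol ξ + 1 ≠ 0 := fun h => by rw [h] at h0; simp at h0
  rw [Real.fourier_eq']
  have h1 : (fun v : ℝ => Complex.exp (((-2 * Real.pi * inner ℝ v ξ : ℝ) : ℂ) * Complex.I) •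
      expKernel v) = (Ioi (0 : ℝ)).indicator
        fun v => Complex.exp (-(derivSymbol ξ + 1) * v) := by
    ext v
    rw [expKernel_eq_indicator]
    by_cases hv : v ∈ Ioi (0 : ℝ)
    · rw [indicator_of_mem hv, indicator_of_mem hv, Complex.ofReal_exp, smul_eq_mul,
        ← Complex.exp_add]
      congr 1
      simp [derivSymbol]
      ring
    · rw [indicator_of_notMem hv, indicator_of_notMem hv, smul_zero]
  rw [h1, integral_indicator measurableSet_Ioi,
    integral_exp_mul_complex_Ioi (by rw [Complex.neg_re, h0]; norm_num)]
  simp only [Complex.ofReal_zero, mul_zero, Complex.exp_zero]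
  field_simp

/-- The operator `(∂ + 1)⁻¹`, convolution with `e^{-t} 1_{t > 0}`. -/
def resolvent : 𝓢'(ℝ, ℂ) →L[ℂ] 𝓢'(ℝ, ℂ) := mult (𝓕 expKernel)

theorem D_resolvent (f : 𝓢'(ℝ, ℂ)) : D (resolvent f) + resolvent f = f := by
  have hE := isMomentKernel_expKernel.temperate
  rw [D_eq_mult, resolvent, multiplier_comp temperate_derivSymbol hE]
  have h : mult (fun _ => (1 : ℂ)) f =
      mult (derivSymbol * 𝓕 expKernel) f + mult (𝓕 expKernel) f := by
    have : (derivSymbol * 𝓕 expKernel : ℝ → ℂ) = (fun _ => (1 : ℂ)) - 𝓕 expKernel := by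
      ext ξ
      have := fourier_expKernel ξ
      simp only [Pi.mul_apply, Pi.sub_apply]
      linear_combination this
    rw [this, multiplier_sub (by fun_prop) hE, sub_add_cancel]
  rw [← h, mult, TemperedDistribution.fourierMultiplierCLM_const]
  simp

theorem D_mult {a : ℝ → ℂ} (ha : a.HasTemperateGrowth) (f : 𝓢'(ℝ, ℂ)) :
    D (mult a f) = mult a (D f) := by
  rw [D_eq_mult]
  exact multiplier_comm temperate_derivSymbol ha f

theorem resolvent_D (f : 𝓢'(ℝ, ℂ)) : resolvent (D f + f) = f := by
  rw [map_add, resolvent, ← D_mult isMomentKernel_expKernel.temperate]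
  exact D_resolvent f

theorem besovBound_resolvent (hp : p ≠ ⊤) :
    ∃ C, 0 ≤ C ∧ ∀ σ, BesovBound p C resolvent σ (σ + 1) :=
  besovBound_zygmund hp isMomentKernel_expKernel isZygmundKernel_expKernel

theorem besovBound_D_add_id (hp : p ≠ ⊤) :
    ∃ C, 0 ≤ C ∧ ∀ σ, BesovBound p C (D + ContinuousLinearMap.id ℂ _) (σ + 1) σ := by
  obtain ⟨C, hC, h⟩ := besovBound_D (p := p) hp
  exact ⟨C + 1, by positivity, fun σ => (h σ).add (besovBound_embedding (by linarith))⟩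

/-- The isomorphism `∂ + 1 : B^{σ+1} → B^σ`. -/
def derivEquiv (hp : p ≠ ⊤) (σ : ℝ) : Besov (σ + 1) p ≃L[ℂ] Besov σ p :=
  ContinuousLinearEquiv.equivOfInverse
    ((besovBound_D_add_id hp).choose_spec.2 σ).clm ((besovBound_resolvent hp).choose_spec.2 σ).clm
    (fun f => dist_injective (by
      rw [BesovBound.dist_clm, BesovBound.dist_clm]; exact resolvent_D _))
    (fun f => dist_injective (by
      rw [BesovBound.dist_clm, BesovBound.dist_clm]; exact D_resolvent _))

@[simp]
theorem dist_derivEquiv (hp : p ≠ ⊤) (f : Besov (σ + 1) p) :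
    Besov.dist (derivEquiv hp σ f) = D (Besov.dist f) + Besov.dist f :=
  BesovBound.dist_clm _ _

@[simp]
theorem dist_derivEquiv_symm (hp : p ≠ ⊤) (f : Besov σ p) :
    Besov.dist ((derivEquiv hp σ).symm f) = resolvent (Besov.dist f) :=
  BesovBound.dist_clm _ _

/-- A property of all smoothness orders can be proved for positive ones and then carried
downwards by the isomorphism `∂ + 1`. -/
theorem downward_induction {P : ℝ → Prop} (h0 : ∀ σ, 0 < σ → P σ) (h1 : ∀ σ, P (σ + 1) → P σ)
    (σ : ℝ) : P σ := by
  have h : ∀ (n : ℕ) (σ : ℝ), 0 < σ + n → P σ := by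
    intro n
    induction n with
    | zero => intro σ hσ; exact h0 σ (by simpa using hσ)
    | succ n ih =>
      intro σ hσ
      refine h1 σ (ih (σ + 1) ?_)
      push_cast at hσ
      linarith
  obtain ⟨n, hn⟩ := exists_nat_gt (-σ)
  exact h n σ (by linarith)

/-! ### Besov spaces and `L_p`, completeness -/

theorem summable_norm_piece (hσ : 0 < σ) (f : Besov σ p) : Summable fun j => ‖piece f j‖ :=
  Summable.of_nonneg_of_le (fun _ => norm_nonneg _) (norm_piece_le f)
    ((summable_wt (by linarith : -σ < 0)).mul_right _)

/-- The `L_p` function underlying an element of a Besov space of positive order. -/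
def toLp (f : Besov σ p) : LpC p := ∑' j, piece f j

theorem toDist_toLp_besov (hσ : 0 < σ) (f : Besov σ p) : toDist (toLp f) = Besov.dist f := by
  ext θ
  have hs : Summable fun j => piece f j := (summable_norm_piece hσ f).of_norm
  have h1 := ((continuous_toDist_apply θ).tendsto _).comp
    (hs.hasSum.tendsto_sum_nat.comp (tendsto_add_atTop_nat 1))
  have h2 : ((fun F : LpC p => toDist F θ) ∘
      ((fun n => ∑ j ∈ Finset.range n, piece f j) ∘ fun n => n + 1)) =
      fun n => lowBlock n (Besov.dist f) θ := by
    ext n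
    simp only [Function.comp, map_sum, toDist_piece, sum_dyadicBlock]
  rw [h2] at h1
  exact tendsto_nhds_unique h1 (tendsto_lowBlock_apply _ θ)

theorem norm_toLp_le (hσ : 0 < σ) (f : Besov σ p) : ‖toLp f‖ ≤ (∑' j, wt j (-σ)) * ‖f‖ := by
  rw [← tsum_mul_right]
  exact tsum_of_norm_bounded
    ((summable_wt (by linarith : -σ < 0)).mul_right _).hasSum (norm_piece_le f)

/-- `L_p` embeds into every Besov space of negative order. -/
theorem exists_besov_toDist (hp : p ≠ ⊤) (hσ : σ < 0) :
    ∃ C, 0 ≤ C ∧ ∀ F : LpC p, ∃ f : Besov σ p, Besov.dist f = toDist F ∧ ‖f‖ ≤ C * ‖F‖ := by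
  have hm : Memℓp (fun j => wt j σ * (2 * lowConst)) p := by
    refine memℓp_gen ?_ |>.of_exponent_ge (Fact.out : 1 ≤ p)
    simp only [ENNReal.toReal_one, Real.rpow_one]
    exact ((summable_wt hσ).mul_right _).norm
  let b : lp (fun _ : ℕ => ℝ) p := ⟨_, hm⟩
  refine ⟨‖b‖, norm_nonneg _, fun F => ?_⟩
  obtain ⟨u, h1, h2⟩ := exists_besov (τ := σ) (toDist F) (fun j => blockLp hp j F) (‖F‖ • b)
    (fun j => toDist_blockLp hp j F) fun j => by
      change _ ≤ ‖F‖ * (wt j σ * (2 * lowConst))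
      refine (mul_le_mul_of_nonneg_left (norm_blockLp_le hp j F) (wt_pos j σ).le).trans
        (le_of_eq ?_)
      ring
  refine ⟨u, h1, h2.trans (le_of_eq ?_)⟩
  rw [norm_smul, norm_norm, mul_comm]

/-- Completeness for positive order: a Cauchy sequence converges both in `L_p` and blockwise, and
the limit of the blocks is the sequence of blocks of the `L_p` limit. -/
theorem completeSpace_of_pos (hp : p ≠ ⊤) (hσ : 0 < σ) : CompleteSpace (Besov σ p) := by
  refine Metric.complete_of_cauchySeq_tendsto fun u hu => ?_
  obtain ⟨B, hB⟩ := cauchySeq_tendsto_of_complete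
    (isometry_blocks.lipschitz.uniformContinuous.comp_cauchySeq hu)
  have hlin : ∀ f g : Besov σ p, toLp f - toLp g = toLp (f - g) := fun f g => by
    apply toDist_injective
    rw [map_sub, toDist_toLp_besov hσ, toDist_toLp_besov hσ, toDist_toLp_besov hσ, map_sub]
  have hlip : LipschitzWith (∑' j, wt j (-σ)).toNNReal (toLp : Besov σ p → LpC p) := by
    refine LipschitzWith.of_dist_le_mul fun f g => ?_
    rw [dist_eq_norm, dist_eq_norm, hlin,
      Real.coe_toNNReal _ (tsum_nonneg fun j => (wt_pos _ _).le)]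
    exact norm_toLp_le hσ _
  obtain ⟨e, he⟩ := cauchySeq_tendsto_of_complete (hlip.uniformContinuous.comp_cauchySeq hu)
  have hBe : ∀ j, B j = ((wt j σ : ℝ) : ℂ) • blockLp hp j e := fun j => by
    have h1 : Tendsto (fun n => Besov.blocks (u n) j) atTop (𝓝 (B j)) := by
      have hc : Continuous fun F : DyadicSeq p => F j := by
        refine LipschitzWith.continuous (K := 1) (LipschitzWith.of_dist_le_mul fun F G => ?_)
        rw [dist_eq_norm, dist_eq_norm, NNReal.coe_one, one_mul]
        exact lp.norm_apply_le_norm p_ne_zero (F - G) j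
      exact (hc.tendsto _).comp hB
    have h2 : Tendsto (fun n => ((wt j σ : ℝ) : ℂ) • blockLp hp j (toLp (u n))) atTop
        (𝓝 (((wt j σ : ℝ) : ℂ) • blockLp hp j e)) :=
      (((blockLp hp j).continuous.tendsto e).comp he).const_smul _
    refine tendsto_nhds_unique h1 (h2.congr fun n => ?_)
    apply toDist_injective
    rw [map_smul, toDist_blockLp, toDist_toLp_besov hσ, toDist_blocks]
  obtain ⟨f, hf, -⟩ := exists_besov (τ := σ) (toDist e) (fun j => blockLp hp j e) (lp.toNorm B)
    (fun j => toDist_blockLp hp j e) fun j => by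
      change _ ≤ ‖B j‖
      rw [hBe, norm_wt_smul]
  refine ⟨f, isometry_blocks.isUniformInducing.isInducing.tendsto_nhds_iff.mpr ?_⟩
  have : Besov.blocks f = B := by
    apply lp.ext
    funext j
    apply toDist_injective
    rw [toDist_blocks, hf, hBe, map_smul, toDist_blockLp]
  rw [this]
  exact hB

theorem completeSpace_besov (hp : p ≠ ⊤) (σ : ℝ) : CompleteSpace (Besov σ p) :=
  downward_induction (P := fun σ => CompleteSpace (Besov σ p))
    (fun _ hσ => completeSpace_of_pos hp hσ)
    (fun σ h => (completeSpace_congr (derivEquiv hp σ).isUniformEmbedding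
      (e := (derivEquiv hp σ).toEquiv)).mp h) σ

/-- Convergence in a Besov space implies convergence of distributions, for positive order by the
embedding into `L_p`, for general order through `f = (∂ + 1) (∂ + 1)⁻¹ f`. -/
theorem continuous_dist_apply (hp : p ≠ ⊤) (σ : ℝ) :
    ∀ θ : 𝓢(ℝ, ℂ), Continuous fun f : Besov σ p => Besov.dist f θ := by
  refine downward_induction (P := fun σ => ∀ θ : 𝓢(ℝ, ℂ), Continuous
    fun f : Besov σ p => Besov.dist f θ) (fun σ hσ θ => ?_) (fun σ h θ => ?_) σ
  · have hC : ∃ C, ∀ f : Besov σ p, ‖Besov.dist f θ‖ ≤ C * ‖f‖ := by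
      refine ⟨‖pairCLM (q := p) θ‖ * ∑' j, wt j (-σ), fun f => ?_⟩
      rw [← toDist_toLp_besov hσ, mul_assoc]
      exact ((pairCLM (q := p) θ).le_opNorm (toLp f)).trans
        (mul_le_mul_of_nonneg_left (norm_toLp_le hσ f) (norm_nonneg _))
    obtain ⟨C, hC⟩ := hC
    let ℓ : Besov σ p →ₗ[ℂ] ℂ :=
      { toFun := fun f => Besov.dist f θ
        map_add' := fun f g => by rw [map_add]; rfl
        map_smul' := fun c f => by rw [map_smul]; rfl }
    exact (ℓ.mkContinuous C hC).continuous
  · have e : (fun f : Besov σ p => Besov.dist f θ) = fun f =>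
        Besov.dist ((derivEquiv hp σ).symm f) (-SchwartzMap.derivCLM ℂ ℂ θ) +
        Besov.dist ((derivEquiv hp σ).symm f) θ := by
      ext f
      conv_lhs => rw [← (derivEquiv hp σ).apply_symm_apply f, dist_derivEquiv]
      rfl
    rw [e]
    exact ((h _).comp (derivEquiv hp σ).symm.continuous).add
      ((h _).comp (derivEquiv hp σ).symm.continuous)


/-! ### Reflection -/

/-- Reflection of Schwartz functions. -/
def reflS : 𝓢(ℝ, ℂ) →L[ℂ] 𝓢(ℝ, ℂ) :=
  SchwartzMap.compCLMOfContinuousLinearEquiv ℂ (ContinuousLinearEquiv.neg ℝ)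

@[simp]
theorem reflS_apply (θ : 𝓢(ℝ, ℂ)) (x : ℝ) : reflS θ x = θ (-x) := rfl

/-- The reflection `f ↦ f(-·)` of tempered distributions. -/
def refl : 𝓢'(ℝ, ℂ) →L[ℂ] 𝓢'(ℝ, ℂ) := PointwiseConvergenceCLM.precomp ℂ reflS

theorem refl_apply (f : 𝓢'(ℝ, ℂ)) (θ : 𝓢(ℝ, ℂ)) : refl f θ = f (reflS θ) := rfl

theorem reflS_reflS (θ : 𝓢(ℝ, ℂ)) : reflS (reflS θ) = θ := by ext x; simp

@[simp]
theorem refl_refl (f : 𝓢'(ℝ, ℂ)) : refl (refl f) = f := by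
  ext θ; rw [refl_apply, refl_apply, reflS_reflS]

theorem temperate_comp_neg {a : ℝ → ℂ} (ha : a.HasTemperateGrowth) :
    (fun x => a (-x)).HasTemperateGrowth :=
  ha.comp (by fun_prop : (fun x : ℝ => -x).HasTemperateGrowth)

theorem reflS_fourier (θ : 𝓢(ℝ, ℂ)) : reflS (𝓕 θ) = 𝓕⁻ θ := by
  ext x
  rw [reflS_apply, SchwartzMap.fourier_coe, SchwartzMap.fourierInv_coe,
    Real.fourierInv_eq_fourier_neg]

theorem fourier_reflS (θ : 𝓢(ℝ, ℂ)) : 𝓕 (reflS θ) = 𝓕⁻ θ := by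
  ext x
  rw [SchwartzMap.fourier_coe, SchwartzMap.fourierInv_coe, Real.fourierInv_eq_fourier_comp_neg]
  rfl

theorem fourierInv_reflS (θ : 𝓢(ℝ, ℂ)) : 𝓕⁻ (reflS θ) = 𝓕 θ := by
  rw [← fourier_reflS, reflS_reflS]

theorem reflS_smulLeft {a : ℝ → ℂ} (ha : a.HasTemperateGrowth) (θ : 𝓢(ℝ, ℂ)) :
    reflS (SchwartzMap.smulLeftCLM ℂ a θ) =
      SchwartzMap.smulLeftCLM ℂ (fun x => a (-x)) (reflS θ) := by
  ext x
  rw [reflS_apply, SchwartzMap.smulLeftCLM_apply_apply ha,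
    SchwartzMap.smulLeftCLM_apply_apply (temperate_comp_neg ha), reflS_apply]

theorem refl_smulLeft {a : ℝ → ℂ} (ha : a.HasTemperateGrowth) (f : 𝓢'(ℝ, ℂ)) :
    refl (TemperedDistribution.smulLeftCLM ℂ a f) =
      TemperedDistribution.smulLeftCLM ℂ (fun x => a (-x)) (refl f) := by
  ext θ
  rw [refl_apply, TemperedDistribution.smulLeftCLM_apply_apply,
    TemperedDistribution.smulLeftCLM_apply_apply, refl_apply,
    reflS_smulLeft (temperate_comp_neg ha)]
  simp only [neg_neg]

theorem refl_mult {a : ℝ → ℂ} (ha : a.HasTemperateGrowth) (f : 𝓢'(ℝ, ℂ)) :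
    refl (mult a f) = mult (fun x => a (-x)) (refl f) := by
  ext θ
  rw [refl_apply, mult, TemperedDistribution.fourierMultiplierCLM_apply_apply, mult,
    TemperedDistribution.fourierMultiplierCLM_apply_apply, refl_apply, fourierInv_reflS]
  rw [reflS_fourier, ← fourier_reflS, reflS_smulLeft (temperate_comp_neg ha), ← reflS_fourier,
    reflS_reflS]
  simp only [neg_neg]

theorem refl_D (f : 𝓢'(ℝ, ℂ)) : refl (D f) = -D (refl f) := by
  ext θ
  have e : -SchwartzMap.derivCLM ℂ ℂ (reflS θ) = -reflS (-SchwartzMap.derivCLM ℂ ℂ θ) := by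
    ext x
    change -(deriv (reflS θ) x) = -(-(deriv θ (-x)))
    have : (reflS θ : ℝ → ℂ) = fun x => θ (-x) := rfl
    rw [this, deriv_comp_neg]
  change f (-SchwartzMap.derivCLM ℂ ℂ (reflS θ)) = -f (reflS (-SchwartzMap.derivCLM ℂ ℂ θ))
  rw [e, map_neg]

/-- Reflection of `L_p` functions. -/
def reflLp : LpC p →ₗᵢ[ℂ] LpC p :=
  Lp.compMeasurePreservingₗᵢ ℂ (fun x => -x) (Measure.measurePreserving_neg volume)

theorem toDist_reflLp (F : LpC p) : toDist (reflLp F) = refl (toDist F) := by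
  ext θ
  rw [refl_apply, toDist_apply, toDist_apply, ← integral_neg_eq_self]
  refine integral_congr_ae ?_
  have h := Lp.coeFn_compMeasurePreserving F (Measure.measurePreserving_neg (volume : Measure ℝ))
  have h2 := (Measure.measurePreserving_neg (volume : Measure ℝ)).quasiMeasurePreserving.ae h
  filter_upwards [h2] with x hx
  change θ (-x) * (reflLp F) (-x) = _
  have : (reflLp F) (-x) = F x := by
    refine hx.trans ?_
    simp
  rw [this]; rfl

theorem dyadicCutoff_neg (j : ℕ) (ξ : ℝ) : dyadicCutoff j (-ξ) = dyadicCutoff j ξ := by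
  cases j with
  | zero => rw [dyadicCutoff_zero, low_neg]
  | succ j => rw [dyadicCutoff_succ, Pi.sub_apply, Pi.sub_apply, low_neg, low_neg]

theorem refl_dyadicBlock (j : ℕ) (f : 𝓢'(ℝ, ℂ)) :
    refl (dyadicBlock j f) = dyadicBlock j (refl f) := by
  have h := refl_mult (temperate_dyadicCutoff j) f
  simp only [dyadicCutoff_neg] at h
  exact h

theorem besovBound_refl : BesovBound p 1 refl σ σ :=
  besovBound_of_blocks _ fun f j F hF => ⟨reflLp F, by
    rw [toDist_reflLp, hF, refl_dyadicBlock], by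
    rw [sub_self, wt, mul_zero, Real.rpow_zero, reflLp.norm_map]⟩

theorem isVanishingOn_refl {f : 𝓢'(ℝ, ℂ)} {U V : Set ℝ} (hf : Distribution.IsVanishingOn f U)
    (h : ∀ x ∈ V, -x ∈ U) : Distribution.IsVanishingOn (refl f) V := by
  intro θ hθ
  rw [refl_apply]
  refine hf _ ?_
  have h1 : tsupport (reflS θ) ⊆ (fun x => -x) ⁻¹' tsupport θ :=
    tsupport_comp_subset_preimage θ continuous_neg
  intro x hx
  have := h _ (hθ (h1 hx))
  rwa [neg_neg] at this

/-! ### Supports -/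

theorem isVanishingOn_D {f : 𝓢'(ℝ, ℂ)} {U : Set ℝ} (hf : Distribution.IsVanishingOn f U) :
    Distribution.IsVanishingOn (D f) U := fun θ hθ => by
  rw [TemperedDistribution.derivCLM_apply_apply, map_neg, neg_eq_zero]
  exact hf _ ((SchwartzMap.tsupport_derivCLM_subset ℂ θ).trans hθ)

/-- Convolution with a kernel supported in `[b, ∞)` moves the support to the right by `b`. -/
theorem isVanishingOn_conv {f : 𝓢'(ℝ, ℂ)} {a b : ℝ} (hf : Distribution.IsVanishingOn f (Iio a))
    {k : ℝ → ℂ} (hk : IsMomentKernel k) (hb : ∀ t < b, k t = 0) :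
    Distribution.IsVanishingOn (mult (𝓕 k) f) (Iio (a + b)) := by
  refine isVanishingOn_of_compactSupport fun θ hc hθ => ?_
  rw [mult, TemperedDistribution.fourierMultiplierCLM_apply_apply]
  rcases (tsupport θ).eq_empty_or_nonempty with he | hne
  · have : θ = 0 := by
      ext x; exact image_eq_zero_of_notMem_tsupport (by rw [he]; exact notMem_empty x)
    rw [this]; simp
  -- For `c = max (tsupport θ)`, the correlation of `θ` with `k` lives in `(-∞, c - b]`, and
  -- `c < a + b`.
  obtain ⟨c, hc1, hc2⟩ := hc.isCompact.exists_isMaxOn hne continuousOn_id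
  have hca : c < a + b := hθ hc1
  refine hf _ ((closure_minimal (s := Function.support _) (t := Iic (c - b)) (fun x hx => ?_)
    isClosed_Iic).trans (fun x (hx : x ≤ c - b) => show x < a by linarith))
  by_contra hcon
  apply hx
  rw [fourier_smulLeft_fourierInv_apply hk.integrable hk.temperate]
  rw [integral_eq_zero_of_ae]
  refine Eventually.of_forall fun s => ?_
  change k s * θ (x + s) = 0
  rcases lt_or_ge s b with h | h
  · rw [hb s h, zero_mul]
  · rw [image_eq_zero_of_notMem_tsupport (f := θ), mul_zero]
    intro hm
    have := hc2 hm
    have h3 : x + s ≤ c := this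
    have h4 : c - b < x := not_le.mp hcon
    linarith

theorem isVanishingOn_resolvent {f : 𝓢'(ℝ, ℂ)} {a : ℝ}
    (hf : Distribution.IsVanishingOn f (Iio a)) :
    Distribution.IsVanishingOn (resolvent f) (Iio a) := by
  have := isVanishingOn_conv hf isMomentKernel_expKernel (b := 0)
    fun t ht => expKernel_of_nonpos ht.le
  rwa [add_zero] at this

/-! ### Multiplication by Schwartz functions -/

/-- Multiplication of a tempered distribution by a function of temperate growth. -/
abbrev smulD (g : ℝ → ℂ) : 𝓢'(ℝ, ℂ) →L[ℂ] 𝓢'(ℝ, ℂ) := TemperedDistribution.smulLeftCLM ℂ g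

/-- Leibniz' rule. -/
theorem D_smulD (g : 𝓢(ℝ, ℂ)) (f : 𝓢'(ℝ, ℂ)) :
    D (smulD g f) = smulD (SchwartzMap.derivCLM ℂ ℂ g) f + smulD g (D f) := by
  ext θ
  have e : SchwartzMap.smulLeftCLM ℂ g (-SchwartzMap.derivCLM ℂ ℂ θ) =
      SchwartzMap.smulLeftCLM ℂ (SchwartzMap.derivCLM ℂ ℂ g) θ +
      -SchwartzMap.derivCLM ℂ ℂ (SchwartzMap.smulLeftCLM ℂ g θ) := by
    ext x
    have h1 : (SchwartzMap.smulLeftCLM ℂ g θ : ℝ → ℂ) = fun x => g x * θ x := by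
      ext x; rw [SchwartzMap.smulLeftCLM_apply_apply g.hasTemperateGrowth]; rfl
    have h2 := deriv_fun_mul (g.differentiableAt (x := x)) (θ.differentiableAt (x := x))
    rw [SchwartzMap.smulLeftCLM_apply_apply g.hasTemperateGrowth]
    change g x • -deriv θ x = SchwartzMap.smulLeftCLM ℂ (SchwartzMap.derivCLM ℂ ℂ g) θ x +
      -deriv (SchwartzMap.smulLeftCLM ℂ g θ) x
    rw [SchwartzMap.smulLeftCLM_apply_apply (SchwartzMap.hasTemperateGrowth _), h1, h2,
      SchwartzMap.derivCLM_apply, smul_eq_mul, smul_eq_mul]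
    ring
  change f (SchwartzMap.smulLeftCLM ℂ g (-SchwartzMap.derivCLM ℂ ℂ θ)) = f _ + f _
  rw [e, map_add]
  rfl

/-- The low-frequency part of a Schwartz function. -/
def lowSchwartz (n : ℕ) (g : 𝓢(ℝ, ℂ)) : 𝓢(ℝ, ℂ) := 𝓕⁻ (SchwartzMap.smulLeftCLM ℂ (low n) (𝓕 g))

/-- Schwartz functions have negligible high frequencies. -/
theorem norm_sub_lowSchwartz_le (g : 𝓢(ℝ, ℂ)) (N : ℕ) :
    ∃ C, 0 ≤ C ∧ ∀ n x, ‖(g - lowSchwartz n g) x‖ ≤ C * ((2 ^ n) ^ N)⁻¹ := by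
  refine ⟨∫ ξ, ‖ξ‖ ^ N * ‖𝓕 g ξ‖, integral_nonneg fun _ => by positivity, fun n x => ?_⟩
  have h1 : g - lowSchwartz n g = 𝓕⁻ (𝓕 g - SchwartzMap.smulLeftCLM ℂ (low n) (𝓕 g)) := by
    have := map_sub (FourierTransform.fourierInvCLM ℂ 𝓢(ℝ, ℂ)) (𝓕 g)
      (SchwartzMap.smulLeftCLM ℂ (low n) (𝓕 g))
    simp only [FourierTransform.fourierInvCLM_apply] at this
    rw [this, lowSchwartz, FourierTransform.fourierInv_fourier_eq]
  rw [h1, SchwartzMap.fourierInv_coe, Real.fourierInv_eq', ← integral_mul_const]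
  refine norm_integral_le_of_norm_le (((𝓕 g).integrable_pow_mul volume N).mul_const _)
    (Eventually.of_forall fun ξ => ?_)
  have h2 : (𝓕 g - SchwartzMap.smulLeftCLM ℂ (low n) (𝓕 g)) ξ = (1 - low n ξ) * 𝓕 g ξ := by
    change 𝓕 g ξ - SchwartzMap.smulLeftCLM ℂ (low n) (𝓕 g) ξ = _
    rw [SchwartzMap.smulLeftCLM_apply_apply (temperate_low n), smul_eq_mul]; ring
  rw [norm_smul, Complex.norm_exp_ofReal_mul_I, one_mul, h2, norm_mul]
  rcases le_or_gt |ξ| (2 ^ n) with h | h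
  · rw [low_eq_one h, sub_self, norm_zero, zero_mul]; positivity
  · have h3 : ‖1 - low n ξ‖ ≤ 1 := norm_lowPass_sub_one_le _
    have h4 : (1 : ℝ) ≤ ‖ξ‖ ^ N * ((2 ^ n) ^ N)⁻¹ := by
      rw [← div_eq_mul_inv, one_le_div (by positivity)]
      exact pow_le_pow_left₀ (by positivity) h.le N
    calc ‖1 - low n ξ‖ * ‖𝓕 g ξ‖ ≤ 1 * ‖𝓕 g ξ‖ := by gcongr
      _ ≤ (‖ξ‖ ^ N * ((2 ^ n) ^ N)⁻¹) * ‖𝓕 g ξ‖ := by gcongr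
      _ = _ := by ring

/-- The product of two low-frequency parts has low frequencies: sums of two frequencies of modulus
below `√2 * 2 ^ n` stay below `2 ^ (n + 2)`, the lower bound for the block of index `n + 3`. -/
theorem dyadicBlock_smulD_lowBlock (n : ℕ) (g : 𝓢(ℝ, ℂ)) (f : 𝓢'(ℝ, ℂ)) :
    dyadicBlock (n + 3) (smulD (lowSchwartz n g) (lowBlock n f)) = 0 := by
  ext θ
  rw [dyadicBlock, TemperedDistribution.fourierMultiplierCLM_apply_apply,
    TemperedDistribution.smulLeftCLM_apply_apply, lowBlock,
    TemperedDistribution.fourierMultiplierCLM_apply_apply,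
    smulLeft_fourierInv_mul_eq_zero (temperate_low n)]
  · simp
  intro ξ η h1 h2 h3
  have h1' := sq_lt_of_low_ne_zero h1
  rw [FourierTransform.fourierInv_fourier_eq,
    SchwartzMap.smulLeftCLM_apply_apply (temperate_dyadicCutoff _)] at h3
  have h3' := lt_abs_of_dyadicCutoff_ne_zero (left_ne_zero_of_smul h3)
  rw [lowSchwartz, ← reflS_fourier, FourierTransform.fourier_fourierInv_eq, reflS_apply,
    SchwartzMap.smulLeftCLM_apply_apply (temperate_low n)] at h2
  have h2' := sq_lt_of_low_ne_zero (left_ne_zero_of_smul h2)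
  -- Contradiction: `|η| > 4 * 2 ^ n`, while `|ξ|` and `|η - ξ|` are below `√2 * 2 ^ n`.
  have h4 : (2 : ℝ) ^ (n + 2) = 4 * 2 ^ n := by rw [pow_add]; norm_num; ring
  rw [h4] at h3'
  have h5 : (4 * 2 ^ n : ℝ) ^ 2 < η ^ 2 := by
    rw [← sq_abs η]
    exact pow_lt_pow_left₀ h3' (by positivity) two_ne_zero
  nlinarith [sq_nonneg (ξ + (ξ - η)), sq_nonneg ((2 : ℝ) ^ n)]

/-- The high-frequency part of an element of positive order is the tail of its block series. -/
theorem toLp_sub_lowLp (hp : p ≠ ⊤) (hσ : 0 < σ) (f : Besov σ p) (n : ℕ) :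
    toLp f - lowLp hp n (toLp f) = ∑' i, piece f (i + (n + 1)) := by
  have hs : Summable fun j => piece f j := (summable_norm_piece hσ f).of_norm
  have h : lowLp hp n (toLp f) = ∑ j ∈ Finset.range (n + 1), piece f j := by
    apply toDist_injective
    rw [toDist_lowLp, toDist_toLp_besov hσ, map_sum]
    simp only [toDist_piece, sum_dyadicBlock]
  rw [h, toLp, ← hs.sum_add_tsum_nat_add (n + 1), add_sub_cancel_left]

/-- Reindexing by a map that is injective on `S`, with zeros off `S`, does not increase the `ℓ_p`
norm. -/
theorem exists_lp_comp (hp : p ≠ ⊤) (a : lp (fun _ : ℕ => ℝ) p) (e : ℕ → ℕ) (S : Set ℕ)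
    (he : InjOn e S) : ∃ b : lp (fun _ : ℕ => ℝ) p,
      (∀ j, b j = S.indicator (fun j => a (e j)) j) ∧ ‖b‖ ≤ ‖a‖ := by
  classical
  have hp0 : 0 < p.toReal := ENNReal.toReal_pos p_ne_zero hp
  have key : ∀ s : Finset ℕ, ∑ j ∈ s, ‖S.indicator (fun j => a (e j)) j‖ ^ p.toReal ≤
      ‖a‖ ^ p.toReal := by
    intro s
    have h1 : ∑ j ∈ s, ‖S.indicator (fun j => a (e j)) j‖ ^ p.toReal =
        ∑ j ∈ s.filter (· ∈ S), ‖a (e j)‖ ^ p.toReal := by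
      rw [Finset.sum_filter]
      refine Finset.sum_congr rfl fun j _ => ?_
      by_cases h : j ∈ S
      · rw [indicator_of_mem h, if_pos h]
      · rw [indicator_of_notMem h, if_neg h, norm_zero, Real.zero_rpow hp0.ne']
    rw [h1, ← Finset.sum_image (f := fun k => ‖a k‖ ^ p.toReal) (g := e) (s := s.filter (· ∈ S))
      (fun x hx y hy hxy => he (Finset.mem_filter.mp hx).2 (Finset.mem_filter.mp hy).2 hxy)]
    exact lp.sum_rpow_le_norm_rpow hp0 a _
  exact ⟨⟨_, memℓp_gen' key⟩, fun j => rfl, lp.norm_le_of_forall_sum_le hp0 (norm_nonneg _) key⟩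

theorem exists_lp_wt (hσ : σ < 0) : ∃ b : lp (fun _ : ℕ => ℝ) p, ∀ j, b j = wt j σ := by
  have hm : Memℓp (fun j => wt j σ) p := by
    refine memℓp_gen ?_ |>.of_exponent_ge (Fact.out : 1 ≤ p)
    simp only [ENNReal.toReal_one, Real.rpow_one]
    exact (summable_wt hσ).norm
  exact ⟨⟨_, hm⟩, fun _ => rfl⟩

/-- Tails of a `p`-summable sequence, averaged with geometric weights, are `p`-summable. -/
theorem exists_lp_tails (hp : p ≠ ⊤) (hσ : 0 < σ) (a : lp (fun _ : ℕ => ℝ) p) :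
    ∃ c : lp (fun _ : ℕ => ℝ) p, (∀ n, c (n + 3) = ∑' i, wt i (-σ) * a (i + (n + 1))) ∧
      (∀ j < 3, c j = 0) ∧ ‖c‖ ≤ (∑' i, wt i (-σ)) * ‖a‖ := by
  have hw := summable_wt (by linarith : -σ < 0)
  -- `s i` is `a`, shifted by `i - 2` and cut off below the index `3`.
  choose s hs1 hs2 using fun i => exists_lp_comp hp a (fun j => i + (j - 2)) (Ici 3)
    (fun x hx y hy hxy => by simp only [mem_Ici] at hx hy hxy; omega)
  have hb : ∀ i, ‖wt i (-σ) • s i‖ ≤ wt i (-σ) * ‖a‖ := fun i => by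
    rw [norm_smul, Real.norm_of_nonneg (wt_pos _ _).le]
    exact mul_le_mul_of_nonneg_left (hs2 i) (wt_pos _ _).le
  have hsum : Summable fun i => wt i (-σ) • s i := Summable.of_norm_bounded (hw.mul_right _) hb
  have hj : ∀ j, (∑' i, wt i (-σ) • s i : lp (fun _ : ℕ => ℝ) p) j =
      ∑' i, wt i (-σ) * s i j := fun j => by
    have := (lp.evalCLM ℝ (fun _ : ℕ => ℝ) p j).map_tsum hsum
    exact this
  refine ⟨∑' i, wt i (-σ) • s i, fun n => ?_, fun j h => ?_, ?_⟩
  · rw [hj]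
    refine tsum_congr fun i => ?_
    rw [hs1, indicator_of_mem (by simp)]
    rfl
  · rw [hj]
    refine (tsum_congr fun i => ?_).trans tsum_zero
    rw [hs1, indicator_of_notMem (by simpa using h), mul_zero]
  · rw [← tsum_mul_right]
    exact tsum_of_norm_bounded (hw.mul_right _).hasSum hb

theorem exists_norm_le (g : 𝓢(ℝ, ℂ)) : ∃ C, 0 ≤ C ∧ ∀ x, ‖g x‖ ≤ C := by
  obtain ⟨C, hC⟩ := g.decay 0 0
  exact ⟨C, hC.1.le, fun x => by simpa using hC.2 x⟩

/-- A high block of a product `g F` sees only the high-frequency part of `F` or of `g`, since the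
product of the two low-frequency parts does not reach it. -/
theorem blockLp_mulLp (hp : p ≠ ⊤) (n : ℕ) (g : 𝓢(ℝ, ℂ)) (F : LpC p) :
    blockLp hp (n + 3) (mulLp g F) = blockLp hp (n + 3) (mulLp g (F - lowLp hp n F)) +
      blockLp hp (n + 3) (mulLp (g - lowSchwartz n g) (lowLp hp n F)) := by
  have h0 : blockLp hp (n + 3) (mulLp (lowSchwartz n g) (lowLp hp n F)) = 0 := by
    apply toDist_injective
    rw [toDist_blockLp, toDist_mulLp, toDist_lowLp, map_zero]
    exact dyadicBlock_smulD_lowBlock n g (toDist F)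
  have h1 : mulLp (g - lowSchwartz n g) (lowLp hp n F) =
      mulLp g (lowLp hp n F) - mulLp (lowSchwartz n g) (lowLp hp n F) := by
    apply Lp.ext
    filter_upwards [coeFn_mulLp (g - lowSchwartz n g) (lowLp hp n F),
      coeFn_mulLp g (lowLp hp n F), coeFn_mulLp (lowSchwartz n g) (lowLp hp n F),
      Lp.coeFn_sub (mulLp g (lowLp hp n F)) (mulLp (lowSchwartz n g) (lowLp hp n F))]
      with x e1 e2 e3 e4
    rw [e1, e4, Pi.sub_apply, e2, e3]
    exact sub_mul _ _ _
  rw [h1, (blockLp hp (n + 3)).map_sub, h0, sub_zero, (mulLp g).map_sub,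
    (blockLp hp (n + 3)).map_sub, sub_add_cancel]

/-- The weighted high-frequency part is dominated by a geometrically weighted tail of the block
norms. -/
theorem wt_mul_norm_sub_lowLp_le (hp : p ≠ ⊤) (hσ : 0 < σ) (f : Besov σ p) (n : ℕ) :
    wt (n + 3) σ * ‖toLp f - lowLp hp n (toLp f)‖ ≤
      wt 2 σ * ∑' i, wt i (-σ) * ‖Besov.blocks f (i + (n + 1))‖ := by
  have hsn : Summable fun i => ‖piece f (i + (n + 1))‖ :=
    (summable_norm_piece hσ f).comp_injective (add_left_injective (n + 1))
  have h3 : ‖∑' i, piece f (i + (n + 1))‖ ≤ ∑' i, ‖piece f (i + (n + 1))‖ :=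
    norm_tsum_le_tsum_norm hsn
  have h4 : ∀ i, wt (n + 3) σ * ‖piece f (i + (n + 1))‖ =
      wt 2 σ * (wt i (-σ) * ‖Besov.blocks f (i + (n + 1))‖) := fun i => by
    have h1 : wt (n + 3) σ = wt 2 σ * wt (n + 1) σ := by
      rw [← wt_index_add]; congr 1; ring
    have := (wt_pos i σ).ne'
    rw [norm_blocks_eq, wt_neg, h1, wt_index_add i (n + 1)]
    field_simp
  rw [toLp_sub_lowLp hp hσ, ← tsum_mul_left, ← tsum_congr h4, tsum_mul_left]
  exact mul_le_mul_of_nonneg_left h3 (wt_pos _ _).le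

theorem norm_blockLp_mulLp_le (hp : p ≠ ⊤) (n : ℕ) (g : 𝓢(ℝ, ℂ)) (F : LpC p) {G K : ℝ}
    (hG : ∀ x, ‖g x‖ ≤ G) (hK : ∀ x, ‖(g - lowSchwartz n g) x‖ ≤ K) :
    ‖blockLp hp (n + 3) (mulLp g F)‖ ≤ 2 * lowConst * (G * ‖F - lowLp hp n F‖) +
      2 * lowConst * (K * (lowConst * ‖F‖)) := by
  have hL := lowConst_nonneg
  have hK0 : 0 ≤ K := (norm_nonneg _).trans (hK 0)
  have hL2 : 0 ≤ 2 * lowConst := by linarith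
  rw [blockLp_mulLp]
  refine (norm_add_le _ _).trans (add_le_add ?_ ?_)
  · exact (norm_blockLp_le hp _ _).trans
      (mul_le_mul_of_nonneg_left (norm_mulLp_le g hG _) hL2)
  · exact (norm_blockLp_le hp _ _).trans (mul_le_mul_of_nonneg_left
      ((norm_mulLp_le _ hK _).trans
        (mul_le_mul_of_nonneg_left (norm_lowLp_le hp n F) hK0)) hL2)

/-- Multiplication by a Schwartz function for positive order: by `blockLp_mulLp` a high block of
`g f` has a part controlled by the high frequencies of `f`, whose weighted norms are `p`-summable
by `exists_lp_tails`, and a part controlled by the high frequencies of `g`, which are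
`O(2 ^ (-N n))` with `N > σ`. -/
theorem besovBound_smulD_of_pos (hp : p ≠ ⊤) (hσ : 0 < σ) (g : 𝓢(ℝ, ℂ)) :
    ∃ C, 0 ≤ C ∧ BesovBound p C (smulD g) σ σ := by
  obtain ⟨N, hN⟩ := exists_nat_gt σ
  obtain ⟨K, hK0, hK⟩ := norm_sub_lowSchwartz_le g N
  obtain ⟨G, hG0, hG⟩ := exists_norm_le g
  obtain ⟨d, hd⟩ := exists_lp_wt (p := p) (by linarith : σ - N < 0)
  have hL := lowConst_nonneg
  obtain ⟨W, hWdef⟩ : ∃ W, W = ∑' i, wt i (-σ) := ⟨_, rfl⟩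
  have hW : 0 ≤ W := hWdef ▸ tsum_nonneg fun _ => (wt_pos _ _).le
  obtain ⟨A, hA⟩ : ∃ A, A = 2 * lowConst * G * wt 2 σ := ⟨_, rfl⟩
  obtain ⟨B, hB⟩ : ∃ B, B = wt 3 N * (2 * lowConst * (G + K * lowConst)) := ⟨_, rfl⟩
  have hA0 : 0 ≤ A := by have := (wt_pos 2 σ).le; rw [hA]; positivity
  have hB0 : 0 ≤ B := by have := (wt_pos 3 N).le; rw [hB]; positivity
  refine ⟨A * W + B * W * ‖d‖, by positivity, fun f => ?_⟩
  obtain ⟨c, hc1, hc2, hc3⟩ := exists_lp_tails hp hσ (lp.toNorm (Besov.blocks f))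
  have hF : ‖toLp f‖ ≤ W * ‖f‖ := hWdef ▸ norm_toLp_le hσ f
  have hcn : ‖c‖ ≤ W * ‖f‖ := hc3.trans_eq (by rw [lp.norm_toNorm, hWdef]; rfl)
  have hF0 := norm_nonneg (toLp f)
  have hblock : ∀ j, wt j σ * ‖blockLp hp j (mulLp g (toLp f))‖ ≤
      A * c j + (B * ‖toLp f‖) * wt j (σ - N) := fun j => by
    have hσN : wt j σ = wt j (σ - N) * wt j N := by rw [← wt_add]; congr 1; ring
    have w1 := (wt_pos j (σ - N)).le
    have w2 := (wt_pos 3 N).le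
    rcases lt_or_ge j 3 with h | h
    · have h3 : wt j N ≤ wt 3 N := by
        rw [wt_nat, wt_nat]; gcongr; norm_num
      have h4 : ‖blockLp hp j (mulLp g (toLp f))‖ ≤
          2 * lowConst * ((G + K * lowConst) * ‖toLp f‖) :=
        (norm_blockLp_le hp j _).trans (mul_le_mul_of_nonneg_left ((norm_mulLp_le g hG _).trans
          (mul_le_mul_of_nonneg_right (by linarith [mul_nonneg hK0 hL]) hF0)) (by linarith))
      rw [hc2 j h, mul_zero, zero_add, hσN]
      calc wt j (σ - N) * wt j N * ‖blockLp hp j (mulLp g (toLp f))‖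
          ≤ wt j (σ - N) * wt 3 N * (2 * lowConst * ((G + K * lowConst) * ‖toLp f‖)) :=
            mul_le_mul (mul_le_mul_of_nonneg_left h3 w1) h4 (norm_nonneg _) (mul_nonneg w1 w2)
        _ = _ := by rw [hB]; ring
    · obtain ⟨n, rfl⟩ := Nat.exists_eq_add_of_le' h
      have hh : wt (n + 3) σ * ‖toLp f - lowLp hp n (toLp f)‖ ≤ wt 2 σ * c (n + 3) := by
        rw [hc1]; exact wt_mul_norm_sub_lowLp_le hp hσ f n
      have hl : wt (n + 3) σ * (K * ((2 ^ n) ^ N)⁻¹) = wt (n + 3) (σ - N) * (wt 3 N * K) := by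
        rw [hσN, wt_nat, wt_nat, pow_add, mul_pow]
        field_simp
      have h5 := mul_le_mul_of_nonneg_left
        (norm_blockLp_mulLp_le hp n g (toLp f) hG (hK n)) (wt_pos (n + 3) σ).le
      have h6 := mul_le_mul_of_nonneg_left hh (by positivity : 0 ≤ 2 * lowConst * G)
      have h7 : 0 ≤ wt (n + 3) (σ - N) * wt 3 N * (2 * lowConst * G * ‖toLp f‖) :=
        mul_nonneg (mul_nonneg w1 w2) (by positivity)
      refine h5.trans ?_
      rw [hA, hB]
      linear_combination h6 + (2 * lowConst * lowConst * ‖toLp f‖) * hl + h7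
  obtain ⟨u, h1, h2⟩ := exists_besov (τ := σ) (smulD g (Besov.dist f))
    (fun j => blockLp hp j (mulLp g (toLp f))) (A • c + (B * ‖toLp f‖) • d)
    (fun j => by rw [toDist_blockLp, toDist_mulLp, toDist_toLp_besov hσ]) fun j => by
      change _ ≤ A * c j + (B * ‖toLp f‖) * d j
      rw [hd]
      exact hblock j
  refine ⟨u, h1, h2.trans ((norm_add_le _ _).trans ?_)⟩
  rw [norm_smul, norm_smul, Real.norm_of_nonneg hA0, Real.norm_of_nonneg (by positivity)]
  calc A * ‖c‖ + B * ‖toLp f‖ * ‖d‖ ≤ A * (W * ‖f‖) + B * (W * ‖f‖) * ‖d‖ := by gcongr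
    _ = _ := by ring

/-- Multiplication by a Schwartz function is bounded on all Besov spaces. The downward step uses
`g f = (∂ + 1) (g R f) - g' R f` with `R = (∂ + 1)⁻¹`. -/
theorem besovBound_smulD (hp : p ≠ ⊤) (σ : ℝ) :
    ∀ g : 𝓢(ℝ, ℂ), ∃ C, 0 ≤ C ∧ BesovBound p C (smulD g) σ σ := by
  refine downward_induction (P := fun σ => ∀ g : 𝓢(ℝ, ℂ), ∃ C, 0 ≤ C ∧
    BesovBound p C (smulD g) σ σ) (fun σ hσ g => besovBound_smulD_of_pos hp hσ g)
    (fun σ h g => ?_) σ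
  obtain ⟨C, hC, h1⟩ := h g
  obtain ⟨C', hC', h2⟩ := h (SchwartzMap.derivCLM ℂ ℂ g)
  obtain ⟨R, hR, hr⟩ := besovBound_resolvent (p := p) hp
  obtain ⟨E, hE, he⟩ := besovBound_D_add_id (p := p) hp
  have hB := (((he σ).comp h1 hE).comp (hr σ) (by positivity)).sub
    (((besovBound_embedding (p := p) (by linarith : σ ≤ σ + 1)).comp h2 zero_le_one).comp (hr σ)
      (by positivity))
  have e : smulD g = ((D + ContinuousLinearMap.id ℂ _) ∘L smulD g) ∘L resolvent -
      ((ContinuousLinearMap.id ℂ _) ∘L smulD (SchwartzMap.derivCLM ℂ ℂ g)) ∘L resolvent := by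
    refine ContinuousLinearMap.ext fun f => ?_
    change smulD g f = (D (smulD g (resolvent f)) + smulD g (resolvent f)) -
      smulD (SchwartzMap.derivCLM ℂ ℂ g) (resolvent f)
    conv_lhs => rw [← D_resolvent f]
    rw [map_add, D_smulD]
    abel
  rw [e]
  exact ⟨_, by positivity, hB⟩


/-! ### Compactness of multiplication operators with loss of one derivative -/

/-- Even smooth cut-offs that are `1` on `[-a, a]` and `0` outside `(-b, b)`. -/
theorem exists_even_cutoff_within {a b : ℝ} (ha : 0 < a) (hab : a < b) : ∃ χ : 𝓢(ℝ, ℂ),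
    HasCompactSupport χ ∧ (∀ x, |x| ≤ a → χ x = 1) ∧ (∀ x, b ≤ |x| → χ x = 0) ∧
      ∀ x, χ (-x) = χ x := by
  let β : ContDiffBump (0 : ℝ) := ⟨a, b, ha, hab⟩
  have h1 : HasCompactSupport (fun x : ℝ => (β x : ℂ)) :=
    β.hasCompactSupport.comp_left (g := fun t : ℝ => (t : ℂ)) (by simp)
  have h2 : ContDiff ℝ ∞ (fun x : ℝ => (β x : ℂ)) :=
    Complex.ofRealCLM.contDiff.comp β.contDiff
  refine ⟨h1.toSchwartzMap h2, h1, fun x hx => ?_, fun x hx => ?_, fun x => ?_⟩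
  · change (β x : ℂ) = 1
    rw [β.one_of_mem_closedBall (by simpa using hx), Complex.ofReal_one]
  · change (β x : ℂ) = 0
    rw [β.zero_of_le_dist (by simpa using hx), Complex.ofReal_zero]
  · change (β (-x) : ℂ) = β x
    rw [β.neg]

theorem exists_even_cutoff {R : ℝ} (hR : 0 < R) : ∃ χ : 𝓢(ℝ, ℂ), HasCompactSupport χ ∧
    (∀ x, |x| ≤ R → χ x = 1) ∧ ∀ x, χ (-x) = χ x := by
  obtain ⟨χ, h1, h2, -, h3⟩ := exists_even_cutoff_within hR (lt_add_one R)
  exact ⟨χ, h1, h2, h3⟩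

theorem exists_cutoff_on {K : Set ℝ} (hK : IsCompact K) : ∃ χ : 𝓢(ℝ, ℂ), HasCompactSupport χ ∧
    (∀ x ∈ K, χ x = 1) ∧ ∀ x, χ (-x) = χ x := by
  obtain ⟨R, hR, h⟩ := hK.isBounded.exists_pos_norm_le
  obtain ⟨χ, h1, h2, h3⟩ := exists_even_cutoff hR
  exact ⟨χ, h1, fun x hx => h2 x (h x hx), h3⟩

/-- The product of a compactly supported function with the character `e^{2πiξx}`. -/
def modulate {χ : 𝓢(ℝ, ℂ)} (hχ : HasCompactSupport χ) (ξ : ℝ) : 𝓢(ℝ, ℂ) :=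
  HasCompactSupport.toSchwartzMap
    (f := fun x : ℝ => Complex.exp (2 * Real.pi * ξ * x * Complex.I) * χ x)
    hχ.mul_left (by
      have := χ.smooth ⊤
      have h2 : ContDiff ℝ ∞ fun x : ℝ => Complex.exp (2 * Real.pi * ξ * x * Complex.I) := by
        have : ContDiff ℝ ∞ fun x : ℝ => (x : ℂ) := Complex.ofRealCLM.contDiff
        exact ((contDiff_const.mul this).mul contDiff_const).cexp
      exact h2.mul this)

theorem modulate_apply {χ : 𝓢(ℝ, ℂ)} (hχ : HasCompactSupport χ) (ξ x : ℝ) :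
    modulate hχ ξ x = Complex.exp (2 * Real.pi * ξ * x * Complex.I) * χ x := rfl

/-- The multiplications by `e^{2πiξx} χ(x)` depend continuously on `ξ` in the operator norm,
because `x χ(x)` is bounded. -/
theorem continuous_mulLp_modulate {χ : 𝓢(ℝ, ℂ)} (hχ : HasCompactSupport χ) :
    Continuous fun ξ => (mulLp (modulate hχ ξ) : LpC p →L[ℂ] LpC p) := by
  obtain ⟨C, hC⟩ := χ.decay 1 0
  have hCx : ∀ x, |x| * ‖χ x‖ ≤ C := fun x => by simpa using hC.2 x
  have key : ∀ ξ η x : ℝ, ‖(modulate hχ ξ - modulate hχ η) x‖ ≤ 2 * Real.pi * C * |ξ - η| := by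
    intro ξ η x
    have e : (modulate hχ ξ - modulate hχ η) x = Complex.exp (2 * Real.pi * η * x * Complex.I) *
        ((Complex.exp (Complex.I * ((2 * Real.pi * (ξ - η) * x : ℝ) : ℂ)) - 1) * χ x) := by
      change modulate hχ ξ x - modulate hχ η x = _
      rw [modulate_apply, modulate_apply, sub_mul, mul_sub, ← mul_assoc, ← Complex.exp_add, one_mul]
      congr 3
      push_cast
      ring
    have e2 : ‖Complex.exp (2 * Real.pi * η * x * Complex.I)‖ = 1 := by
      have := Complex.norm_exp_ofReal_mul_I (2 * Real.pi * η * x)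
      push_cast at this
      exact this
    have e3 := Real.norm_exp_I_mul_ofReal_sub_one_le (x := 2 * Real.pi * (ξ - η) * x)
    have e4 : ‖2 * Real.pi * (ξ - η) * x‖ = 2 * Real.pi * |ξ - η| * |x| := by
      rw [norm_mul, norm_mul, norm_mul, Real.norm_eq_abs, Real.norm_eq_abs, Real.norm_eq_abs,
        Real.norm_eq_abs, abs_of_pos Real.pi_pos, abs_two]
    rw [e, norm_mul, norm_mul, e2, one_mul]
    calc _ ≤ (2 * Real.pi * |ξ - η| * |x|) * ‖χ x‖ := by
          rw [← e4]; exact mul_le_mul_of_nonneg_right e3 (norm_nonneg _)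
      _ = 2 * Real.pi * |ξ - η| * (|x| * ‖χ x‖) := by ring
      _ ≤ 2 * Real.pi * |ξ - η| * C := by
          have := Real.pi_pos
          exact mul_le_mul_of_nonneg_left (hCx x) (by positivity)
      _ = _ := by ring
  have hC0 : 0 ≤ 2 * Real.pi * C := by have := Real.pi_pos; have := hC.1; positivity
  refine LipschitzWith.continuous (K := (2 * Real.pi * C).toNNReal)
    (LipschitzWith.of_dist_le_mul fun ξ η => ?_)
  rw [dist_eq_norm, Real.coe_toNNReal _ hC0, Real.dist_eq]
  refine ContinuousLinearMap.opNorm_le_bound _ (by positivity) fun F => ?_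
  have e : (mulLp (modulate hχ ξ) - mulLp (modulate hχ η) : LpC p →L[ℂ] LpC p) F =
      mulLp (modulate hχ ξ - modulate hχ η) F := by
    apply Lp.ext
    filter_upwards [coeFn_mulLp (modulate hχ ξ - modulate hχ η) F,
      coeFn_mulLp (modulate hχ ξ) F, coeFn_mulLp (modulate hχ η) F,
      Lp.coeFn_sub (mulLp (modulate hχ ξ) F) (mulLp (modulate hχ η) F)] with x e1 e2 e3 e4
    rw [e1]
    refine e4.trans ?_
    rw [Pi.sub_apply, e2, e3]
    exact (sub_mul _ _ _).symm
  rw [e]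
  exact norm_mulLp_le _ (key ξ η) F

theorem integral_mem_of_isClosed {X : Type*} [NormedAddCommGroup X] [NormedSpace ℂ X]
    [CompleteSpace X] (S : Submodule ℂ X) (hS : IsClosed (S : Set X)) {A : ℝ → X}
    (hc : Continuous A) (hs : HasCompactSupport A) (hA : ∀ ξ, A ξ ∈ S) : ∫ ξ, A ξ ∈ S := by
  have : CompleteSpace S := hS.completeSpace_coe
  let B : ℝ → S := fun ξ => ⟨A ξ, hA ξ⟩
  have hB : Continuous B := hc.subtype_mk _
  have hBs : HasCompactSupport B := hs.mono fun ξ hξ h => hξ (Subtype.ext h)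
  have h2 : (∫ ξ, A ξ) = ((∫ ξ, B ξ : S) : X) :=
    S.subtypeL.integral_comp_comm (hB.integrable_of_hasCompactSupport hBs)
  rw [h2]
  exact (∫ ξ, B ξ : S).2

/-- The integral of a continuous compactly supported family of compact operators is compact. -/
theorem isCompactOperator_integral {E : Type*} [NormedAddCommGroup E] [NormedSpace ℂ E]
    [CompleteSpace E] {A : ℝ → E →L[ℂ] E} (hc : Continuous A) (hs : HasCompactSupport A)
    (hA : ∀ ξ, IsCompactOperator (A ξ)) : IsCompactOperator (∫ ξ, A ξ : E →L[ℂ] E) :=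
  integral_mem_of_isClosed (compactOperator (RingHom.id ℂ) E E)
    isClosed_setOfPred_isCompactOperator hc hs hA

theorem isCompactOperator_smulRight {E F : Type*} [NormedAddCommGroup E] [NormedSpace ℂ E]
    [NormedAddCommGroup F] [NormedSpace ℂ F] (ℓ : E →L[ℂ] ℂ) (v : F) :
    IsCompactOperator (ℓ.smulRight v) :=
  (isCompactOperator_of_locallyCompactSpace_rng
    ((ContinuousLinearMap.id ℂ ℂ).smulRight v)).comp_clm ℓ

theorem toDist_mulLp_modulate_toLp {χ c : 𝓢(ℝ, ℂ)} (hχ : HasCompactSupport χ)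
    (h : ∀ x, χ x * c x = c x) (ξ : ℝ) (θ : 𝓢(ℝ, ℂ)) :
    toDist (mulLp (modulate hχ ξ) (c.toLp p : LpC p)) θ =
      𝓕⁻ (SchwartzMap.smulLeftCLM ℂ c θ) ξ := by
  rw [toDist_apply, SchwartzMap.fourierInv_coe, Real.fourierInv_eq']
  refine integral_congr_ae ?_
  filter_upwards [coeFn_mulLp (modulate hχ ξ) (c.toLp p : LpC p), c.coeFn_toLp p volume]
    with x h1 h2
  have e : Complex.exp (((2 * Real.pi * inner ℝ x ξ : ℝ) : ℂ) * Complex.I) =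
      Complex.exp (2 * Real.pi * ξ * x * Complex.I) := by
    congr 1
    simp only [RCLike.inner_apply, conj_trivial]
    push_cast
    ring
  rw [h1, h2, modulate_apply, SchwartzMap.smulLeftCLM_apply_apply c.hasTemperateGrowth, e,
    smul_eq_mul, smul_eq_mul]
  linear_combination (Complex.exp (2 * Real.pi * ξ * x * Complex.I) * θ x) * h x

theorem toDist_mulLp_modulate {χ b : 𝓢(ℝ, ℂ)} (hχ : HasCompactSupport χ)
    (h : ∀ x, χ x * b x = b x) (ξ : ℝ) (F : LpC p) :
    VectorFourier.fourierIntegral Real.fourierChar volume (innerₗ ℝ).flip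
      (fun y => b y * F y) ξ = toDist (mulLp (modulate hχ (-ξ)) F) b := by
  rw [toDist_apply]
  refine integral_congr_ae ?_
  filter_upwards [coeFn_mulLp (modulate hχ (-ξ)) F] with y hy
  rw [hy, modulate_apply, Circle.smul_def, Real.fourierChar_apply, smul_eq_mul]
  have e : Complex.exp (((2 * Real.pi * -((innerₗ ℝ).flip y ξ) : ℝ) : ℂ) * Complex.I) =
      Complex.exp (2 * Real.pi * ((-ξ : ℝ) : ℂ) * y * Complex.I) := by
    congr 1
    simp only [LinearMap.flip_apply, innerₗ_apply_apply, RCLike.inner_apply, conj_trivial]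
    push_cast
    ring
  rw [e]
  linear_combination -(Complex.exp (2 * Real.pi * ((-ξ : ℝ) : ℂ) * y * Complex.I) * F y) * h y

/-- The composition of a low-frequency cut-off with two multiplications has the kernel
`∫ low_n(ξ) e^{2πiξx} c(x) e^{-2πiξy} b(y) dξ`. -/
theorem toDist_mulLp_lowLp_mulLp (hp : p ≠ ⊤) (n : ℕ) {χ c b : 𝓢(ℝ, ℂ)} (hχ : HasCompactSupport χ)
    (hχc : ∀ x, χ x * c x = c x) (hχb : ∀ x, χ x * b x = b x) (F : LpC p) (θ : 𝓢(ℝ, ℂ)) :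
    toDist (mulLp c (lowLp hp n (mulLp b F))) θ =
      ∫ ξ, low n ξ * (toDist (mulLp (modulate hχ ξ) (c.toLp p : LpC p)) θ *
        toDist (mulLp (modulate hχ (-ξ)) F) b) := by
  rw [toDist_mulLp, TemperedDistribution.smulLeftCLM_apply_apply, toDist_lowLp, lowBlock,
    TemperedDistribution.fourierMultiplierCLM_apply_apply, toDist_mulLp,
    TemperedDistribution.smulLeftCLM_apply_apply, toDist_apply]
  obtain ⟨η, hη⟩ : ∃ η,
      η = SchwartzMap.smulLeftCLM ℂ (low n) (𝓕⁻ (SchwartzMap.smulLeftCLM ℂ c θ)) :=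
    ⟨_, rfl⟩
  rw [← hη]
  have hbF : Integrable fun y => b y * F y :=
    (b.memLp p.conjExponent volume).integrable_mul (Lp.memLp F)
  have hflip := VectorFourier.integral_fourierIntegral_smul_eq_flip (L := innerₗ ℝ)
    (μ := volume) (ν := volume) (e := Real.fourierChar) (f := η) (g := fun y => b y * F y)
    Real.continuous_fourierChar continuous_inner η.integrable hbF
  have e1 : ∫ y, SchwartzMap.smulLeftCLM ℂ b (𝓕 η) y * F y =
      ∫ y, VectorFourier.fourierIntegral Real.fourierChar volume (innerₗ ℝ) η y • (b y * F y) := by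
    refine integral_congr_ae (Eventually.of_forall fun y => ?_)
    simp only
    rw [SchwartzMap.smulLeftCLM_apply_apply b.hasTemperateGrowth, SchwartzMap.fourier_coe]
    simp only [smul_eq_mul]
    change b y * _ * _ = 𝓕 (η : ℝ → ℂ) y * _
    ring
  rw [e1, hflip]
  refine integral_congr_ae (Eventually.of_forall fun ξ => ?_)
  simp only
  rw [toDist_mulLp_modulate hχ hχb, toDist_mulLp_modulate_toLp hχ hχc, hη,
    SchwartzMap.smulLeftCLM_apply_apply (temperate_low n), smul_eq_mul, smul_eq_mul, mul_assoc]

/-- The rank one operators `F ↦ low_n(ξ) (∫ e^{-2πiξy} χ(y) b(y) F(y) dy) e^{2πiξx} χ(x) c(x)`. -/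
def modulatedRankOne (n : ℕ) {χ : 𝓢(ℝ, ℂ)} (hχ : HasCompactSupport χ) (c b : 𝓢(ℝ, ℂ)) (ξ : ℝ) :
    LpC p →L[ℂ] LpC p :=
  low n ξ • (mulLp (modulate hχ ξ) ∘L ((pairCLM b).smulRight (c.toLp p : LpC p) ∘L
    mulLp (modulate hχ (-ξ))))

theorem continuous_modulatedRankOne (n : ℕ) {χ : 𝓢(ℝ, ℂ)} (hχ : HasCompactSupport χ)
    (c b : 𝓢(ℝ, ℂ)) : Continuous (modulatedRankOne (p := p) n hχ c b) :=
  (contDiff_low n).continuous.smul ((continuous_mulLp_modulate hχ).clm_comp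
    (continuous_const.clm_comp ((continuous_mulLp_modulate hχ).comp continuous_neg)))

theorem hasCompactSupport_modulatedRankOne (n : ℕ) {χ : 𝓢(ℝ, ℂ)} (hχ : HasCompactSupport χ)
    (c b : 𝓢(ℝ, ℂ)) : HasCompactSupport (modulatedRankOne (p := p) n hχ c b) :=
  (hasCompactSupport_low n).mono fun ξ hξ h => hξ (by
    rw [modulatedRankOne, h, zero_smul])

theorem modulatedRankOne_apply (n : ℕ) {χ : 𝓢(ℝ, ℂ)} (hχ : HasCompactSupport χ)
    (c b : 𝓢(ℝ, ℂ)) (ξ : ℝ) (F : LpC p) : modulatedRankOne n hχ c b ξ F =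
      low n ξ • toDist (mulLp (modulate hχ (-ξ)) F) b •
        mulLp (modulate hχ ξ) (c.toLp p : LpC p) := by
  rw [← (mulLp (modulate hχ ξ)).map_smul]
  rfl

theorem isCompactOperator_modulatedRankOne (n : ℕ) {χ : 𝓢(ℝ, ℂ)} (hχ : HasCompactSupport χ)
    (c b : 𝓢(ℝ, ℂ)) (ξ : ℝ) : IsCompactOperator (modulatedRankOne (p := p) n hχ c b ξ) := by
  have h : modulatedRankOne (p := p) n hχ c b ξ =
      (pairCLM b ∘L mulLp (modulate hχ (-ξ))).smulRight
        (low n ξ • mulLp (modulate hχ ξ) (c.toLp p : LpC p)) := by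
    refine ContinuousLinearMap.ext fun F => ?_
    rw [modulatedRankOne_apply, smul_comm]
    rfl
  rw [h]
  exact isCompactOperator_smulRight _ _

/-- Between two compactly supported multiplications, a low-frequency cut-off is a compact operator
of `L_p`: its kernel is a superposition of products `e^{2πiξx} e^{-2πiξy}`. -/
theorem isCompactOperator_mulLp_lowLp_mulLp (hp : p ≠ ⊤) (n : ℕ) {c b : 𝓢(ℝ, ℂ)}
    (hc : HasCompactSupport c) (hb : HasCompactSupport b) :
    IsCompactOperator (mulLp c ∘L lowLp hp n ∘L mulLp b : LpC p →L[ℂ] LpC p) := by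
  obtain ⟨χ, hχ, hχ1, -⟩ := exists_cutoff_on (hc.isCompact.union hb.isCompact)
  have hχc : ∀ x, χ x * c x = c x := fun x => by
    by_cases h : x ∈ tsupport c
    · rw [hχ1 x (Or.inl h), one_mul]
    · rw [image_eq_zero_of_notMem_tsupport h, mul_zero]
  have hχb : ∀ x, χ x * b x = b x := fun x => by
    by_cases h : x ∈ tsupport b
    · rw [hχ1 x (Or.inr h), one_mul]
    · rw [image_eq_zero_of_notMem_tsupport h, mul_zero]
  have hint : Integrable (modulatedRankOne (p := p) n hχ c b) :=
    (continuous_modulatedRankOne n hχ c b).integrable_of_hasCompactSupport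
      (hasCompactSupport_modulatedRankOne n hχ c b)
  have key : (mulLp c ∘L lowLp hp n ∘L mulLp b : LpC p →L[ℂ] LpC p) =
      ∫ ξ, modulatedRankOne n hχ c b ξ := by
    refine ContinuousLinearMap.ext fun F => ?_
    rw [ContinuousLinearMap.integral_apply hint]
    apply toDist_injective
    ext θ
    have h1 : toDist (∫ ξ, modulatedRankOne n hχ c b ξ F) θ =
        ∫ ξ, pairCLM θ (modulatedRankOne n hχ c b ξ F) :=
      ((pairCLM (q := p) θ).integral_comp_comm (hint.apply_continuousLinearMap F)).symm
    rw [h1]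
    refine (toDist_mulLp_lowLp_mulLp hp n hχ hχc hχb F θ).trans ?_
    refine integral_congr_ae (Eventually.of_forall fun ξ => ?_)
    simp only
    rw [modulatedRankOne_apply, (pairCLM θ).map_smul, (pairCLM θ).map_smul, smul_eq_mul,
      smul_eq_mul]
    congr 1
    exact mul_comm _ _
  rw [key]
  exact isCompactOperator_integral (continuous_modulatedRankOne n hχ c b)
    (hasCompactSupport_modulatedRankOne n hχ c b) (isCompactOperator_modulatedRankOne n hχ c b)

theorem norm_clm_sub_le {T T' : 𝓢'(ℝ, ℂ) →L[ℂ] 𝓢'(ℝ, ℂ)} {C : ℝ} {A B : Besov σ p →L[ℂ] Besov τ p}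
    (hA : ∀ f, Besov.dist (A f) = T (Besov.dist f))
    (hB : ∀ f, Besov.dist (B f) = T' (Besov.dist f)) (hC : 0 ≤ C)
    (h : BesovBound p C (T - T') σ τ) : ‖A - B‖ ≤ C := by
  refine ContinuousLinearMap.opNorm_le_bound _ hC fun f => ?_
  have : (A - B) f = h.clm f := dist_injective (by
    rw [BesovBound.dist_clm]
    change Besov.dist (A f - B f) = _
    rw [map_sub, hA, hB]; rfl)
  rw [this]
  exact h.norm_clm_le f

/-- Low-frequency parts of distributions in a Besov space, as `L_p` functions. -/
theorem exists_lowBlock_toLp (σ : ℝ) (n : ℕ) :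
    ∃ A : Besov σ p →L[ℂ] LpC p, ∀ f, toDist (A f) = lowBlock n (Besov.dist f) := by
  let A : Besov σ p →ₗ[ℂ] LpC p :=
    { toFun := fun f => ∑ j ∈ Finset.range (n + 1), piece f j
      map_add' := fun f g => by
        simp only [piece, map_add, lp.coeFn_add, Pi.add_apply, smul_add, Finset.sum_add_distrib]
      map_smul' := fun c f => by
        simp only [piece, map_smul, lp.coeFn_smul, Pi.smul_apply, RingHom.id_apply,
          Finset.smul_sum]
        exact Finset.sum_congr rfl fun j _ => smul_comm _ _ _ }
  refine ⟨A.mkContinuous (∑ j ∈ Finset.range (n + 1), wt j (-σ)) fun f => ?_, fun f => ?_⟩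
  · rw [Finset.sum_mul]
    exact (norm_sum_le _ _).trans (Finset.sum_le_sum fun j _ => norm_piece_le f j)
  · change toDist (∑ j ∈ Finset.range (n + 1), piece f j) = _
    rw [map_sum, ← sum_dyadicBlock]
    exact Finset.sum_congr rfl fun j _ => toDist_piece f j

/-- Low-frequency parts of `L_p` functions lie in Besov spaces of every order, as only finitely
many blocks are different from zero. -/
theorem exists_lowBlock_besov (hp : p ≠ ⊤) (σ : ℝ) (n : ℕ) :
    ∃ A : LpC p →L[ℂ] Besov σ p, ∀ F, Besov.dist (A F) = lowBlock n (toDist F) := by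
  have hm : Memℓp (fun j => if j < n + 2 then wt j σ * (2 * lowConst * lowConst) else 0) p := by
    refine memℓp_gen ?_ |>.of_exponent_ge (Fact.out : 1 ≤ p)
    simp only [ENNReal.toReal_one, Real.rpow_one]
    refine summable_of_ne_finset_zero (s := Finset.range (n + 2)) fun j hj => ?_
    rw [if_neg (by simpa using hj), norm_zero]
  let b : lp (fun _ : ℕ => ℝ) p := ⟨_, hm⟩
  have key : ∀ F : LpC p, ∃ f : Besov σ p, Besov.dist f = lowBlock n (toDist F) ∧
      ‖f‖ ≤ ‖b‖ * ‖F‖ := fun F => by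
    obtain ⟨u, h1, h2⟩ := exists_besov (τ := σ) (lowBlock n (toDist F))
      (fun j => blockLp hp j (lowLp hp n F)) (‖F‖ • b)
      (fun j => by rw [toDist_blockLp, toDist_lowLp]) fun j => by
        change _ ≤ ‖F‖ * (if j < n + 2 then wt j σ * (2 * lowConst * lowConst) else 0)
        split_ifs with h
        · have h3 : ‖blockLp hp j (lowLp hp n F)‖ ≤ 2 * lowConst * (lowConst * ‖F‖) :=
            (norm_blockLp_le hp j _).trans (mul_le_mul_of_nonneg_left (norm_lowLp_le hp n F)
              (by linarith [lowConst_nonneg]))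
          refine (mul_le_mul_of_nonneg_left h3 (wt_pos j σ).le).trans (le_of_eq ?_)
          ring
        · have : blockLp hp j (lowLp hp n F) = 0 := by
            apply toDist_injective
            rw [toDist_blockLp, toDist_lowLp, map_zero,
              dyadicBlock_lowBlock_eq_zero (not_lt.mp h)]
          rw [this, norm_zero, mul_zero, mul_zero]
    refine ⟨u, h1, h2.trans (le_of_eq ?_)⟩
    rw [norm_smul, norm_norm, mul_comm]
  choose A hA1 hA2 using key
  exact ⟨LinearMap.mkContinuous
    { toFun := A
      map_add' := fun F G => dist_injective (by rw [map_add, hA1, hA1, hA1, map_add, map_add])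
      map_smul' := fun c F => dist_injective (by
        rw [map_smul, hA1, hA1, map_smul, map_smul]; rfl) } ‖b‖ hA2, hA1⟩

/-- Multiplication by a test function is compact from `B^{σ+1}` to `B^σ`. With `b = 1` on the
support of `c` and `S_n` the low-frequency cut-offs, `c = c b` is the limit in the operator norm,
at the rate `2 ^ (-n)`, of the operators `S_n c S_n b S_n`, which factor through the compact
operators `c S_n b` of `L_p`. -/
theorem isCompactOperator_of_smulD (hp : p ≠ ⊤) {c : 𝓢(ℝ, ℂ)} (hc : HasCompactSupport c)
    (A : Besov (σ + 1) p →L[ℂ] Besov σ p)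
    (hA : ∀ f, Besov.dist (A f) = smulD c (Besov.dist f)) : IsCompactOperator A := by
  obtain ⟨b, hb, hb1, -⟩ := exists_cutoff_on hc.isCompact
  have hbc : (b : ℝ → ℂ) * c = c := by
    ext x
    by_cases h : x ∈ tsupport c
    · rw [Pi.mul_apply, hb1 x h, one_mul]
    · rw [Pi.mul_apply, image_eq_zero_of_notMem_tsupport h, mul_zero]
  choose S hS using exists_lowBlock_toLp (p := p) (σ + 1)
  choose S' hS' using exists_lowBlock_besov (p := p) hp σ
  let B : ℕ → Besov (σ + 1) p →L[ℂ] Besov σ p := fun n =>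
    S' n ∘L (mulLp c ∘L lowLp hp n ∘L mulLp b) ∘L S n
  have hBc : ∀ n, IsCompactOperator (B n) := fun n =>
    ((isCompactOperator_mulLp_lowLp_mulLp hp n hc hb).comp_clm (S n)).clm_comp (S' n)
  have hBd : ∀ n f, Besov.dist (B n f) = (lowBlock n ∘L smulD c ∘L lowBlock n ∘L smulD b ∘L
      lowBlock n) (Besov.dist f) := fun n f => by
    change Besov.dist (S' n (mulLp c (lowLp hp n (mulLp b (S n f))))) = _
    rw [hS', toDist_mulLp, toDist_lowLp, toDist_mulLp, hS]
    rfl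
  have hAd : ∀ f, Besov.dist (A f) = (smulD c ∘L smulD b) (Besov.dist f) := fun f => by
    rw [hA, ContinuousLinearMap.comp_apply, smulD,
      TemperedDistribution.smulLeftCLM_smulLeftCLM_apply b.hasTemperateGrowth c.hasTemperateGrowth,
      hbc]
  obtain ⟨c0, hc0, h_c0⟩ := besovBound_smulD (p := p) hp σ c
  obtain ⟨c1, hc1, h_c1⟩ := besovBound_smulD (p := p) hp (σ + 1) c
  obtain ⟨b0, hb0, h_b0⟩ := besovBound_smulD (p := p) hp σ b
  obtain ⟨b1, hb1', h_b1⟩ := besovBound_smulD (p := p) hp (σ + 1) b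
  have hL := lowConst_nonneg
  have hnorm : ∀ n, ‖A - B n‖ ≤ ((1 + lowConst) * (c1 * b1) +
      lowConst * (c0 * ((1 + lowConst) * b1)) +
      lowConst * (c0 * (lowConst * (b0 * (1 + lowConst))))) * (2 ^ n)⁻¹ := fun n => by
    have hl0 := besovBound_lowBlock (p := p) (σ := σ) hp n
    have hl1 := besovBound_id_sub_lowBlock (p := p) (σ := σ) hp n
    have t1 := hl1.comp (h_c1.comp h_b1 hc1) (by positivity)
    have t2 := hl0.comp (h_c0.comp (hl1.comp h_b1 (by positivity)) hc0) hL
    have t3 := hl0.comp (h_c0.comp (hl0.comp (h_b0.comp hl1 hb0) hL) hc0) hL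
    have t := (t1.add t2).add t3
    refine norm_clm_sub_le hAd (hBd n) (by positivity) ?_
    -- Telescoping: the cut-offs are inserted one at a time, from the left to the right.
    have e : smulD c ∘L smulD b - lowBlock n ∘L smulD c ∘L lowBlock n ∘L smulD b ∘L lowBlock n =
        (ContinuousLinearMap.id ℂ _ - lowBlock n) ∘L smulD c ∘L smulD b +
        lowBlock n ∘L smulD c ∘L (ContinuousLinearMap.id ℂ _ - lowBlock n) ∘L smulD b +
        lowBlock n ∘L smulD c ∘L lowBlock n ∘L smulD b ∘L
          (ContinuousLinearMap.id ℂ _ - lowBlock n) := by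
      refine ContinuousLinearMap.ext fun f => ?_
      change smulD c (smulD b f) - lowBlock n (smulD c (lowBlock n (smulD b (lowBlock n f)))) =
        (smulD c (smulD b f) - lowBlock n (smulD c (smulD b f))) +
        lowBlock n (smulD c (smulD b f - lowBlock n (smulD b f))) +
        lowBlock n (smulD c (lowBlock n (smulD b (f - lowBlock n f))))
      simp only [map_sub]
      abel
    rw [e]
    refine t.mono (le_of_eq ?_)
    ring
  have := completeSpace_besov hp σ
  refine isCompactOperator_of_tendsto (F := B) (l := atTop) ?_ (Eventually.of_forall hBc)
  rw [tendsto_iff_norm_sub_tendsto_zero]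
  have h0 : Tendsto (fun n : ℕ => ((2 : ℝ) ^ n)⁻¹) atTop (𝓝 0) := by
    simp_rw [← inv_pow]
    exact tendsto_pow_atTop_nhds_zero_of_lt_one (by norm_num) (by norm_num)
  have h1 := h0.const_mul ((1 + lowConst) * (c1 * b1) + lowConst * (c0 * ((1 + lowConst) * b1))
      + lowConst * (c0 * (lowConst * (b0 * (1 + lowConst)))))
  rw [mul_zero] at h1
  exact squeeze_zero (fun _ => norm_nonneg _) (fun n => by rw [norm_sub_rev]; exact hnorm n) h1


/-! ### Approximation by test functions -/

/-- Mollifiers supported to the right of the origin. -/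
theorem exists_mollifier : ∃ ρ : ℕ → 𝓢(ℝ, ℂ), (∀ n, HasCompactSupport (ρ n)) ∧
    (∀ n, ∫ x, ‖ρ n x‖ = 1) ∧ (∀ n, ∫ x, ρ n x = 1) ∧
    ∀ n x, ρ n x ≠ 0 → x ∈ Icc ((n : ℝ) + 1)⁻¹ (2 * ((n : ℝ) + 1)⁻¹) := by
  have hd : ∀ n : ℕ, 0 < ((n : ℝ) + 1)⁻¹ := fun n => by positivity
  let b : ∀ n : ℕ, ContDiffBump (3 / 2 * ((n : ℝ) + 1)⁻¹) := fun n =>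
    ⟨1 / 4 * ((n : ℝ) + 1)⁻¹, 1 / 2 * ((n : ℝ) + 1)⁻¹, by linarith [hd n], by linarith [hd n]⟩
  have h1 : ∀ n, HasCompactSupport fun x => (((b n).normed volume x : ℝ) : ℂ) := fun n =>
    (b n).hasCompactSupport_normed.comp_left (g := fun t : ℝ => (t : ℂ)) (by simp)
  have h2 : ∀ n, ContDiff ℝ ∞ fun x => (((b n).normed volume x : ℝ) : ℂ) := fun n =>
    Complex.ofRealCLM.contDiff.comp (b n).contDiff_normed
  refine ⟨fun n => (h1 n).toSchwartzMap (h2 n), h1, fun n => ?_, fun n => ?_, fun n x hx => ?_⟩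
  · change ∫ x, ‖(((b n).normed volume x : ℝ) : ℂ)‖ = 1
    refine Eq.trans (integral_congr_ae (Eventually.of_forall fun x => ?_))
      ((b n).integral_normed (μ := volume))
    simp only
    rw [Complex.norm_real, Real.norm_of_nonneg ((b n).nonneg_normed x)]
  · change ∫ x, (((b n).normed volume x : ℝ) : ℂ) = 1
    rw [integral_complex_ofReal, (b n).integral_normed, Complex.ofReal_one]
  · have hx' : x ∈ Function.support ((b n).normed volume) := fun h => hx (by
      change (((b n).normed volume x : ℝ) : ℂ) = 0
      rw [h, Complex.ofReal_zero])
    rw [(b n).support_normed_eq, Metric.mem_ball, Real.dist_eq, abs_lt] at hx'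
    change -(1 / 2 * ((n : ℝ) + 1)⁻¹) < x - _ ∧ x - _ < 1 / 2 * ((n : ℝ) + 1)⁻¹ at hx'
    exact ⟨by linarith [hx'.1], by linarith [hx'.2]⟩

/-- Mollification converges in `L_p`: `ρ_n * F - F` is an average of `F(· - s) - F` over small
`s`. -/
theorem tendsto_conv_mollifier (hp : p ≠ ⊤) {ρ : ℕ → 𝓢(ℝ, ℂ)} (h1 : ∀ n, ∫ x, ‖ρ n x‖ = 1)
    (h2 : ∀ n, ∫ x, ρ n x = 1)
    (h3 : ∀ n x, ρ n x ≠ 0 → x ∈ Icc ((n : ℝ) + 1)⁻¹ (2 * ((n : ℝ) + 1)⁻¹)) (F : LpC p) :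
    Tendsto (fun n => ‖conv (ρ n) F - F‖) atTop (𝓝 0) := by
  rw [Metric.tendsto_atTop]
  intro ε hε
  have hc := (continuous_translate hp F).tendsto 0
  rw [translate_zero] at hc
  obtain ⟨δ, hδ, h⟩ := Metric.tendsto_nhds_nhds.mp hc (ε / 2) (by positivity)
  have h0 : Tendsto (fun n : ℕ => 2 * ((n : ℝ) + 1)⁻¹) atTop (𝓝 0) := by
    have := (tendsto_one_div_add_atTop_nhds_zero_nat (𝕜 := ℝ)).const_mul 2
    simpa using this
  obtain ⟨N, hN⟩ := (h0.eventually (gt_mem_nhds hδ)).exists_forall_of_atTop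
  refine ⟨N, fun n hn => ?_⟩
  rw [dist_zero_right, norm_norm]
  have e : conv (ρ n) F - F = ∫ s, ρ n s • (translate s F - F) := by
    have h4 : ∫ s, ρ n s • F = F := by rw [integral_smul_const, h2, one_smul]
    simp only [smul_sub]
    rw [integral_sub (integrable_conv hp (ρ n).integrable F)
      ((ρ n).integrable.smul_const F), h4, conv]
  rw [e]
  have hb : ‖∫ s, ρ n s • (translate s F - F)‖ ≤ ∫ s, ‖ρ n s‖ * (ε / 2) := by
    refine norm_integral_le_of_norm_le ((ρ n).integrable.norm.mul_const _)
      (Eventually.of_forall fun s => ?_)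
    rw [norm_smul]
    by_cases hs : ρ n s = 0
    · rw [hs, norm_zero, zero_mul, zero_mul]
    · have hs' := h3 n s hs
      have : (0 : ℝ) < ((n : ℝ) + 1)⁻¹ := by positivity
      have hd : dist s 0 < δ := by
        rw [dist_zero_right, Real.norm_of_nonneg (by linarith [hs'.1])]
        exact hs'.2.trans_lt (hN n hn)
      have := (h hd).le
      rw [dist_eq_norm] at this
      exact mul_le_mul_of_nonneg_left this (norm_nonneg _)
  rw [integral_mul_const, h1, one_mul] at hb
  linarith

/-- Mollification converges in all Besov spaces, by dominated convergence in the sum over the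
blocks. -/
theorem tendsto_mollifier_besov (hp : p ≠ ⊤) {ρ : ℕ → 𝓢(ℝ, ℂ)} (h1 : ∀ n, ∫ x, ‖ρ n x‖ = 1)
    (h2 : ∀ n, ∫ x, ρ n x = 1)
    (h3 : ∀ n x, ρ n x ≠ 0 → x ∈ Icc ((n : ℝ) + 1)⁻¹ (2 * ((n : ℝ) + 1)⁻¹)) (f : Besov σ p)
    (u : ℕ → Besov σ p) (hu : ∀ n, Besov.dist (u n) = mult (𝓕 (ρ n : ℝ → ℂ)) (Besov.dist f)) :
    Tendsto u atTop (𝓝 f) := by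
  have hp0 : 0 < p.toReal := ENNReal.toReal_pos p_ne_zero hp
  have hb : ∀ n j, Besov.blocks (u n - f) j = conv (ρ n) (Besov.blocks f j) - Besov.blocks f j := by
    intro n j
    have hk := isMomentKernel_schwartz (ρ n)
    apply toDist_injective
    have h4 : toDist (conv (ρ n) (Besov.blocks f j) - Besov.blocks f j) =
        mult (𝓕 (ρ n : ℝ → ℂ)) (((wt j σ : ℝ) : ℂ) • dyadicBlock j (Besov.dist f)) -
          ((wt j σ : ℝ) : ℂ) • dyadicBlock j (Besov.dist f) := by
      rw [map_sub toDist, toDist_conv hp hk.integrable hk.temperate, toDist_blocks]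
    rw [h4, toDist_blocks, map_sub Besov.dist, map_sub, hu, dyadicBlock_mult hk.temperate, smul_sub,
      map_smul]
  have hbound : ∀ n j, ‖Besov.blocks (u n - f) j‖ ≤ 2 * ‖Besov.blocks f j‖ := by
    intro n j
    rw [hb]
    refine (norm_sub_le _ _).trans ?_
    have := norm_conv_le (ρ n) (Besov.blocks f j)
    rw [h1, one_mul] at this
    linarith
  have hnorm : ∀ n, ‖u n - f‖ = (∑' j, ‖Besov.blocks (u n - f) j‖ ^ p.toReal) ^ (1 / p.toReal) :=
    fun n => lp.norm_eq_tsum_rpow hp0 _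
  rw [tendsto_iff_norm_sub_tendsto_zero]
  simp_rw [hnorm]
  have hsum : Summable fun j => (2 * ‖Besov.blocks f j‖) ^ p.toReal := by
    have := ((lp.memℓp (Besov.blocks f)).summable hp0).mul_left (2 ^ p.toReal)
    refine this.congr fun j => ?_
    rw [Real.mul_rpow two_pos.le (norm_nonneg _)]
  have hlim : Tendsto (fun n => ∑' j, ‖Besov.blocks (u n - f) j‖ ^ p.toReal) atTop
      (𝓝 (∑' _ : ℕ, (0 : ℝ))) := by
    refine tendsto_tsum_of_dominated_convergence hsum (fun j => ?_)
      (Eventually.of_forall fun n j => ?_)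
    · have := (tendsto_conv_mollifier hp h1 h2 h3 (Besov.blocks f j)).rpow_const
        (Or.inr hp0.le : (0 : ℝ) ≠ 0 ∨ 0 ≤ p.toReal)
      rw [Real.zero_rpow hp0.ne'] at this
      simp_rw [hb]
      exact this
    · rw [Real.norm_of_nonneg (Real.rpow_nonneg (norm_nonneg _) _)]
      exact Real.rpow_le_rpow (norm_nonneg _) (hbound n j) hp0.le
  rw [tsum_zero] at hlim
  have := hlim.rpow_const (Or.inr (by positivity) : (0 : ℝ) ≠ 0 ∨ 0 ≤ 1 / p.toReal)
  rwa [Real.zero_rpow (by positivity)] at this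

theorem fourier_derivCLM_add (k : 𝓢(ℝ, ℂ)) :
    𝓕 ((SchwartzMap.derivCLM ℂ ℂ k + k : 𝓢(ℝ, ℂ)) : ℝ → ℂ) =
      derivSymbol * 𝓕 (k : ℝ → ℂ) + 𝓕 (k : ℝ → ℂ) := by
  have h0 : ((SchwartzMap.derivCLM ℂ ℂ k + k : 𝓢(ℝ, ℂ)) : ℝ → ℂ) = fun x => deriv k x + k x := by
    ext x
    change SchwartzMap.derivCLM ℂ ℂ k x + k x = _
    rw [SchwartzMap.derivCLM_apply]
  have h1 : Integrable (deriv k) := by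
    have := (SchwartzMap.derivCLM ℂ ℂ k).integrable (μ := volume)
    refine this.congr (Eventually.of_forall fun x => ?_)
    rw [SchwartzMap.derivCLM_apply]
  have h2 := Real.fourier_deriv k.integrable k.differentiable h1
  rw [h0]
  ext ξ
  have h3 : 𝓕 (fun x => deriv k x + k x) ξ = 𝓕 (deriv k) ξ + 𝓕 (k : ℝ → ℂ) ξ := by
    rw [Real.fourier_eq, Real.fourier_eq, Real.fourier_eq, ← integral_add
      ((Real.fourierIntegral_convergent_iff ξ).mpr h1)
      ((Real.fourierIntegral_convergent_iff ξ).mpr k.integrable)]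
    simp only [smul_add]
  rw [h3, h2]
  simp [derivSymbol]

/-- Convolution with `k` is `(∂ + 1)⁻¹` after convolution with `∂k + k`. -/
theorem resolvent_mult_derivCLM_add (k : 𝓢(ℝ, ℂ)) : mult (𝓕 (k : ℝ → ℂ)) =
    resolvent ∘L mult (𝓕 ((SchwartzMap.derivCLM ℂ ℂ k + k : 𝓢(ℝ, ℂ)) : ℝ → ℂ)) := by
  have hk' := (isMomentKernel_schwartz (SchwartzMap.derivCLM ℂ ℂ k + k)).temperate
  have e : 𝓕 expKernel * 𝓕 ((SchwartzMap.derivCLM ℂ ℂ k + k : 𝓢(ℝ, ℂ)) : ℝ → ℂ) =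
      𝓕 (k : ℝ → ℂ) := by
    rw [fourier_derivCLM_add]
    ext ξ
    have := fourier_expKernel ξ
    simp only [Pi.mul_apply, Pi.add_apply]
    linear_combination (𝓕 (k : ℝ → ℂ) ξ) * this
  refine ContinuousLinearMap.ext fun f => ?_
  rw [ContinuousLinearMap.comp_apply, resolvent,
    multiplier_comp isMomentKernel_expKernel.temperate hk', e]

/-- Convolution with a Schwartz function is infinitely smoothing. -/
theorem besovBound_schwartz (hp : p ≠ ⊤) (n : ℕ) : ∀ (k : 𝓢(ℝ, ℂ)) (σ : ℝ),
    ∃ C, 0 ≤ C ∧ BesovBound p C (mult (𝓕 (k : ℝ → ℂ))) σ (σ + n) := by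
  induction n with
  | zero =>
    intro k σ
    rw [Nat.cast_zero, add_zero]
    exact ⟨_, integral_nonneg fun _ => norm_nonneg _,
      besovBound_conv hp (isMomentKernel_schwartz k)⟩
  | succ n ih =>
    intro k σ
    obtain ⟨C, hC, h⟩ := ih (SchwartzMap.derivCLM ℂ ℂ k + k) σ
    obtain ⟨R, hR, hr⟩ := besovBound_resolvent (p := p) hp
    refine ⟨R * C, by positivity, ?_⟩
    have h2 := (hr (σ + n)).comp h hR
    have e2 : σ + ((n + 1 : ℕ) : ℝ) = σ + n + 1 := by push_cast; ring
    rw [e2, resolvent_mult_derivCLM_add]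
    exact h2

/-- The dilated function `θ(· / (n + 1))`. -/
def dilS (n : ℕ) : 𝓢(ℝ, ℂ) →L[ℂ] 𝓢(ℝ, ℂ) :=
  SchwartzMap.compCLMOfContinuousLinearEquiv ℂ (ContinuousLinearEquiv.unitsEquivAut ℝ
    (Units.mk0 ((n : ℝ) + 1)⁻¹ (by positivity)))

theorem dilS_apply (n : ℕ) (θ : 𝓢(ℝ, ℂ)) (x : ℝ) : dilS n θ x = θ (((n : ℝ) + 1)⁻¹ * x) := by
  rw [mul_comm]; rfl

theorem derivCLM_dilS (n : ℕ) (θ : 𝓢(ℝ, ℂ)) : SchwartzMap.derivCLM ℂ ℂ (dilS n θ) =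
    ((((n : ℝ) + 1)⁻¹ : ℝ) : ℂ) • dilS n (SchwartzMap.derivCLM ℂ ℂ θ) := by
  ext x
  rw [SchwartzMap.derivCLM_apply]
  have h : (dilS n θ : ℝ → ℂ) = fun x => θ (((n : ℝ) + 1)⁻¹ * x) := funext (dilS_apply n θ)
  change _ = ((((n : ℝ) + 1)⁻¹ : ℝ) : ℂ) • dilS n (SchwartzMap.derivCLM ℂ ℂ θ) x
  rw [dilS_apply, SchwartzMap.derivCLM_apply, h, deriv_comp_mul_left, Complex.real_smul,
    smul_eq_mul]

theorem tendsto_inv_nat : Tendsto (fun n : ℕ => ((n : ℝ) + 1)⁻¹) atTop (𝓝 0) := by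
  simpa using tendsto_one_div_add_atTop_nhds_zero_nat (𝕜 := ℝ)

theorem tendsto_mulLp_dilS_toLp (θ η : 𝓢(ℝ, ℂ)) :
    Tendsto (fun n => mulLp (dilS n θ) (η.toLp p volume : LpC p)) atTop
      (𝓝 (θ 0 • (η.toLp p volume : LpC p))) := by
  have h := ((SchwartzMap.toLpCLM ℂ (F := ℂ) (E := ℝ) p volume).continuous.tendsto _).comp
    ((tendsto_dilate_smul θ η).comp tendsto_inv_nat)
  rw [map_smul] at h
  refine h.congr fun n => ?_
  apply Lp.ext
  filter_upwards [coeFn_mulLp (dilS n θ) (η.toLp p volume : LpC p), η.coeFn_toLp p volume,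
    (SchwartzMap.smulLeftCLM ℂ (fun x : ℝ => θ (((n : ℝ) + 1)⁻¹ * x)) η).coeFn_toLp p volume]
    with x h1 h2 h3
  rw [h1, h2]
  refine h3.trans ?_
  rw [SchwartzMap.smulLeftCLM_apply_apply (temperate_dilate θ _), dilS_apply, smul_eq_mul]

/-- On `L_p`, multiplication by `θ(· / (n + 1))` converges strongly to multiplication by
`θ(0)`. -/
theorem tendsto_mulLp_dilS (hp : p ≠ ⊤) (θ : 𝓢(ℝ, ℂ)) (F : LpC p) :
    Tendsto (fun n => mulLp (dilS n θ) F) atTop (𝓝 (θ 0 • F)) := by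
  obtain ⟨C, hC, hθ⟩ := exists_norm_le θ
  have hbd : ∀ n (F : LpC p), ‖mulLp (dilS n θ) F - θ 0 • F‖ ≤ 2 * C * ‖F‖ := fun n F => by
    refine (norm_sub_le _ _).trans ?_
    have h1 := norm_mulLp_le (dilS n θ) (fun x => by rw [dilS_apply]; exact hθ _) F
    have h2 : ‖θ 0 • F‖ ≤ C * ‖F‖ := by
      rw [norm_smul]; exact mul_le_mul_of_nonneg_right (hθ 0) (norm_nonneg _)
    linarith
  rw [Metric.tendsto_atTop]
  intro ε hε
  obtain ⟨G, hG, h1⟩ : ∃ G : LpC p, ‖F - G‖ < ε / (2 * (2 * C + 1)) ∧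
      Tendsto (fun n => mulLp (dilS n θ) G) atTop (𝓝 (θ 0 • G)) := by
    obtain ⟨η, hη⟩ := (SchwartzMap.denseRange_toLpCLM (E := ℝ) (F := ℂ) (μ := volume)
      hp).exists_dist_lt F (show 0 < ε / (2 * (2 * C + 1)) by positivity)
    rw [dist_eq_norm] at hη
    exact ⟨η.toLp p volume, hη, tendsto_mulLp_dilS_toLp θ η⟩
  obtain ⟨N, hN⟩ := Metric.tendsto_atTop.mp h1 (ε / 2) (by positivity)
  refine ⟨N, fun n hn => ?_⟩
  have h2 := hN n hn
  rw [dist_eq_norm] at h2 ⊢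
  have h3 := hbd n (F - G)
  have e : mulLp (dilS n θ) F - θ 0 • F =
      (mulLp (dilS n θ) (F - G) - θ 0 • (F - G)) + (mulLp (dilS n θ) G - θ 0 • G) := by
    rw [map_sub, smul_sub]; abel
  rw [e]
  refine (norm_add_le _ _).trans_lt ?_
  have h4 : 2 * C * ‖F - G‖ ≤ ε / 2 := by
    calc 2 * C * ‖F - G‖ ≤ (2 * C + 1) * (ε / (2 * (2 * C + 1))) := by
          gcongr; linarith
      _ = ε / 2 := by field_simp
  linarith

/-- Dilated cut-offs converge on distributions that belong to all Besov spaces. For negative order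
this follows from the convergence in `L_p`; the order is raised by one by applying `∂ + 1`, where
the derivative of the dilated cut-off produces a factor `1 / (n + 1)`. -/
theorem exists_tendsto_dilS (hp : p ≠ ⊤) : ∀ (m : ℕ) (σ : ℝ), σ < m →
    ∀ (θ : 𝓢(ℝ, ℂ)) (w : 𝓢'(ℝ, ℂ)), (∀ t, ∃ u : Besov t p, Besov.dist u = w) → ∃ u : ℕ → Besov σ p,
      (∀ n, Besov.dist (u n) = smulD (dilS n θ) w - θ 0 • w) ∧ Tendsto u atTop (𝓝 0) := by
  intro m
  induction m with
  | zero =>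
    intro σ hσ θ w hw
    rw [Nat.cast_zero] at hσ
    obtain ⟨v, hv⟩ := hw 1
    obtain ⟨C, hC, h⟩ := exists_besov_toDist (p := p) hp hσ
    choose u hu1 hu2 using fun n => h (mulLp (dilS n θ) (toLp v) - θ 0 • toLp v)
    refine ⟨u, fun n => ?_, ?_⟩
    · rw [hu1, map_sub, map_smul, toDist_mulLp, toDist_toLp_besov one_pos, hv]
    · rw [tendsto_zero_iff_norm_tendsto_zero]
      have h0 := ((tendsto_mulLp_dilS hp θ (toLp v)).sub_const (θ 0 • toLp v)).norm.const_mul C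
      rw [sub_self, norm_zero, mul_zero] at h0
      exact squeeze_zero (fun _ => norm_nonneg _) hu2 h0
  | succ m ih =>
    intro σ hσ θ w hw
    obtain ⟨τ, rfl⟩ : ∃ τ, σ = τ + 1 := ⟨σ - 1, by ring⟩
    have hτ : τ < m := by push_cast at hσ; linarith
    have hw' : ∀ t, ∃ u : Besov t p, Besov.dist u = D w + w := fun t => by
      obtain ⟨u, hu⟩ := hw (t + 1)
      exact ⟨derivEquiv hp t u, by rw [dist_derivEquiv, hu]⟩
    obtain ⟨u1, h1, t1⟩ := ih τ hτ θ (D w + w) hw'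
    obtain ⟨u2, h2, t2⟩ := ih τ hτ (SchwartzMap.derivCLM ℂ ℂ θ) w hw
    obtain ⟨w0, hw0⟩ := hw τ
    refine ⟨fun n => (derivEquiv hp τ).symm (u1 n + ((((n : ℝ) + 1)⁻¹ : ℝ) : ℂ) •
      (u2 n + SchwartzMap.derivCLM ℂ ℂ θ 0 • w0)), fun n => ?_, ?_⟩
    · rw [dist_derivEquiv_symm, map_add Besov.dist, map_smul, map_add Besov.dist,
        map_smul Besov.dist, h1, h2, hw0, sub_add_cancel]
      conv_rhs => rw [← resolvent_D (smulD (dilS n θ) w - θ 0 • w)]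
      congr 1
      rw [map_sub, map_smul, D_smulD, derivCLM_dilS]
      have hs : smulD ((((((n : ℝ) + 1)⁻¹ : ℝ) : ℂ) • dilS n (SchwartzMap.derivCLM ℂ ℂ θ) :
          𝓢(ℝ, ℂ)) : ℝ → ℂ) w = ((((n : ℝ) + 1)⁻¹ : ℝ) : ℂ) •
            smulD (dilS n (SchwartzMap.derivCLM ℂ ℂ θ)) w := by
        have := TemperedDistribution.smulLeftCLM_smul (F := ℂ)
          (dilS n (SchwartzMap.derivCLM ℂ ℂ θ)).hasTemperateGrowth ((((n : ℝ) + 1)⁻¹ : ℝ) : ℂ)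
        exact congrArg (fun T => T w) this
      rw [hs, map_add, smul_add]
      abel
    · have h0 : Tendsto (fun n : ℕ => ((((n : ℝ) + 1)⁻¹ : ℝ) : ℂ)) atTop (𝓝 0) := by
        have := (Complex.continuous_ofReal.tendsto 0).comp tendsto_inv_nat
        rw [Complex.ofReal_zero] at this
        exact this
      have h3 := t1.add (h0.smul (t2.add_const (SchwartzMap.derivCLM ℂ ℂ θ 0 • w0)))
      rw [zero_smul, add_zero] at h3
      have h4 := ((derivEquiv hp τ).symm.continuous.tendsto 0).comp h3
      rw [(derivEquiv hp τ).symm.map_zero] at h4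
      exact h4


/-! ### Density of test functions -/

/-- The elements of the Besov space that are test functions supported in `U`. -/
def testSet (σ : ℝ) (p : ℝ≥0∞) [Fact (1 ≤ p)] (U : Set ℝ) : Set (Besov σ p) :=
  {u | ∃ φ, IsTestFunctionOn U φ ∧ AgreesOn univ (Besov.dist u) φ}

theorem mult_apply {k : ℝ → ℂ} (hk : IsMomentKernel k) (θ : 𝓢(ℝ, ℂ)) (F : LpC p) :
    mult (𝓕 k) (toDist F) θ = ∫ x, (∫ s, k s * θ (x + s)) * F x := by
  rw [mult, TemperedDistribution.fourierMultiplierCLM_apply_apply, toDist_apply]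
  refine integral_congr_ae (Eventually.of_forall fun x => ?_)
  simp only
  rw [fourier_smulLeft_fourierInv_apply hk.integrable hk.temperate]

/-- The multiplier with symbol `𝓕 k` convolves integrable functions with `k`. -/
theorem agreesOn_mult {k : ℝ → ℂ} (hk : IsMomentKernel k) (F : LpC p) (hF : Integrable F) :
    AgreesOn univ (mult (𝓕 k) (toDist F)) (fun y => ∫ x, F x * k (y - x)) := by
  intro θ _ _
  rw [mult_apply hk]
  obtain ⟨C, hC, hθ⟩ := exists_norm_le θ
  have h1 := hF.convolution_integrand (ContinuousLinearMap.mul ℝ ℂ) hk.integrable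
  have h2 : Integrable (fun z : ℝ × ℝ => θ z.1 * (F z.2 * k (z.1 - z.2)))
      (volume.prod volume) := by
    refine (Integrable.bdd_mul (c := C) h1 ?_ ?_)
    · exact (θ.continuous.comp continuous_fst).aestronglyMeasurable
    · exact Eventually.of_forall fun z => hθ _
  have h3 := integral_integral_swap (f := fun y x => θ y * (F x * k (y - x))) h2
  simp_rw [integral_const_mul] at h3
  rw [h3]
  refine integral_congr_ae (Eventually.of_forall fun x => ?_)
  simp only
  rw [← integral_mul_const, ← integral_sub_right_eq_self (fun s => k s * θ (x + s) * F x) x]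
  refine integral_congr_ae (Eventually.of_forall fun y => ?_)
  simp only [add_sub_cancel]
  ring

/-- The Schwartz function `x ↦ k (y - x)`. -/
theorem exists_schwartz_sub (k : 𝓢(ℝ, ℂ)) (hk : HasCompactSupport k) (y : ℝ) :
    ∃ θ : 𝓢(ℝ, ℂ), ∀ x, θ x = k (y - x) := by
  have h1 : HasCompactSupport fun x => k (y - x) :=
    hk.comp_homeomorph (Homeomorph.subLeft y)
  have h2 : ContDiff ℝ ∞ fun x => k (y - x) := k.smooth'.comp (contDiff_const.sub contDiff_id)
  exact ⟨h1.toSchwartzMap h2, fun x => rfl⟩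

/-- The product of an `L_p` function with a Schwartz function is integrable, by Hölder's
inequality. -/
theorem integrable_mulLp (θ : 𝓢(ℝ, ℂ)) (F : LpC p) : Integrable (mulLp θ F) := by
  have h := (Lp.memLp F).integrable_mul (θ.memLp p.conjExponent volume)
  refine h.congr ?_
  filter_upwards [coeFn_mulLp θ F] with x hx
  rw [hx, Pi.mul_apply, mul_comm]

/-- Mollifying to the right a compactly supported function that vanishes on `(-∞, a)` gives a test
function supported in `[a, ∞)`. -/
theorem isTestFunctionOn_mollify {a : ℝ} (k θ : 𝓢(ℝ, ℂ)) (hk : HasCompactSupport k)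
    (hk0 : ∀ x, k x ≠ 0 → 0 < x) (hθ : HasCompactSupport θ) (F : LpC p)
    (hF : Distribution.IsVanishingOn (toDist F) (Iio a)) :
    IsTestFunctionOn (Ici a) (fun y => ∫ x, mulLp θ F x * k (y - x)) := by
  have hint := integrable_mulLp θ F
  have hs : ContDiff ℝ ∞ (fun y => ∫ x, mulLp θ F x * k (y - x)) :=
    hk.contDiff_convolution_right (ContinuousLinearMap.mul ℝ ℂ) hint.locallyIntegrable k.smooth'
  obtain ⟨R, hR, h1⟩ := hθ.isCompact.isBounded.exists_pos_norm_le
  obtain ⟨S, hS, h2⟩ := hk.isCompact.isBounded.exists_pos_norm_le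
  have hsupp : Function.support (fun y => ∫ x, mulLp θ F x * k (y - x)) ⊆ Icc a (R + S) := by
    intro y hy
    by_contra hn
    refine hy ?_
    -- For `y < a` the kernel `k (y - ·)` only meets `(-∞, a)`, where `F` vanishes; for `y > R + S`
    -- it does not meet the support of `θ`.
    rcases lt_or_ge y a with hya | hya
    · obtain ⟨η, hη⟩ := exists_schwartz_sub k hk y
      have hv : Distribution.IsVanishingOn (smulD θ (toDist F)) (Iio a) :=
        Distribution.TemperedDistribution.IsVanishingOn.smulLeftCLM hF θ.hasTemperateGrowth
      have e : ∫ x, mulLp θ F x * k (y - x) = smulD θ (toDist F) η := by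
        rw [← toDist_mulLp, toDist_apply]
        exact integral_congr_ae (Eventually.of_forall fun x => by simp only [hη]; ring)
      simp only
      rw [e]
      refine hv η ?_
      have hsub : tsupport η ⊆ Iic y := by
        refine closure_minimal (fun x hx => ?_) isClosed_Iic
        have := hk0 (y - x) (by rw [← hη]; exact hx)
        exact (sub_pos.mp this).le
      exact hsub.trans (Iic_subset_Iio.mpr hya)
    · have hyR : R + S < y := by
        by_contra hle
        exact hn ⟨hya, not_lt.mp hle⟩
      have e : ∀ᵐ x, mulLp θ F x * k (y - x) = 0 := by
        filter_upwards [coeFn_mulLp θ F] with x hx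
        rw [hx]
        by_cases h0 : θ x = 0
        · rw [h0, zero_mul, zero_mul]
        by_cases h3 : k (y - x) = 0
        · rw [h3, mul_zero]
        have h4 := h1 x (subset_tsupport _ h0)
        have h5 := h2 (y - x) (subset_tsupport _ h3)
        rw [Real.norm_eq_abs] at h4 h5
        have := le_abs_self x
        have := le_abs_self (y - x)
        linarith
      simp only
      rw [integral_congr_ae e, integral_zero]
  have ht : tsupport (fun y => ∫ x, mulLp θ F x * k (y - x)) ⊆ Icc a (R + S) :=
    closure_minimal hsupp isClosed_Icc
  exact ⟨hs, isCompact_Icc.of_isClosed_subset (isClosed_tsupport _) ht,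
    ht.trans Icc_subset_Ici_self⟩

theorem _root_.IsTestFunctionOn.mono {U V : Set ℝ} {φ : ℝ → ℂ} (h : IsTestFunctionOn U φ)
    (hUV : U ⊆ V) : IsTestFunctionOn V φ := ⟨h.smooth, h.compact, h.supp.trans hUV⟩

/-- The product of a cut-off with a smooth element supported in `[a, ∞)`, `a > 0`, is approximated
by its mollifications, which are test functions on `(0, ∞)`. -/
theorem mem_closure_testSet_of_smooth (hp : p ≠ ⊤) {a : ℝ} (ha : 0 < a) (σ : ℝ) (w : 𝓢'(ℝ, ℂ))
    (hw : ∀ t, ∃ u : Besov t p, Besov.dist u = w) (hv : Distribution.IsVanishingOn w (Iio a))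
    (θ : 𝓢(ℝ, ℂ)) (hθ : HasCompactSupport θ) (u : Besov σ p) (hu : Besov.dist u = smulD θ w) :
    u ∈ closure (testSet σ p (Ioi 0)) := by
  obtain ⟨ρ, h1, h2, h3, h4⟩ := exists_mollifier
  obtain ⟨v, hv1⟩ := hw 1
  have ev : toDist (toLp v) = w := by rw [toDist_toLp_besov one_pos, hv1]
  have hb : ∀ n, ∃ f : Besov σ p, Besov.dist f = mult (𝓕 (ρ n : ℝ → ℂ)) (Besov.dist u) := fun n =>
    let ⟨f, hf, _⟩ := besovBound_conv (σ := σ) hp (isMomentKernel_schwartz (ρ n)) u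
    ⟨f, hf⟩
  choose f hf using hb
  refine mem_closure_of_tendsto (tendsto_mollifier_besov hp h2 h3 h4 u f hf)
    (Eventually.of_forall fun n => ?_)
  refine ⟨fun y => ∫ x, mulLp θ (toLp v) x * ρ n (y - x),
    (isTestFunctionOn_mollify (a := a) (ρ n) θ (h1 n) (fun x hx => ?_) hθ (toLp v)
      (by rw [ev]; exact hv)).mono (Ici_subset_Ioi.mpr ha), ?_⟩
  · exact lt_of_lt_of_le (by positivity) (h4 n x hx).1
  · rw [hf, hu, ← ev, ← toDist_mulLp]
    exact agreesOn_mult (isMomentKernel_schwartz _) _ (integrable_mulLp θ _)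

theorem hasCompactSupport_dilS {θ : 𝓢(ℝ, ℂ)} (hθ : HasCompactSupport θ) (n : ℕ) :
    HasCompactSupport (dilS n θ) := by
  have h : (dilS n θ : ℝ → ℂ) = fun x => θ (((n : ℝ) + 1)⁻¹ * x) := funext (dilS_apply n θ)
  rw [h]
  exact hθ.comp_homeomorph (Homeomorph.mulLeft₀ _ (by positivity))

/-- Test functions on `(0, ∞)` are dense among the elements supported in `[0, ∞)`: first mollify to
the right, which makes the element smooth and moves its support into `(0, ∞)`, then cut off at
infinity, then mollify again. -/
theorem mem_closure_testSet_Ioi (hp : p ≠ ⊤) (f : Besov σ p)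
    (hf : Distribution.IsVanishingOn (Besov.dist f) (Iio 0)) :
    f ∈ closure (testSet σ p (Ioi 0)) := by
  obtain ⟨ρ, h1, h2, h3, h4⟩ := exists_mollifier
  obtain ⟨χ, hχ, hχ1, -⟩ := exists_even_cutoff one_pos
  have hb : ∀ n, ∃ g : Besov σ p, Besov.dist g = mult (𝓕 (ρ n : ℝ → ℂ)) (Besov.dist f) := fun n =>
    let ⟨g, hg, _⟩ := besovBound_conv (σ := σ) hp (isMomentKernel_schwartz (ρ n)) f
    ⟨g, hg⟩
  choose g hg using hb
  refine isClosed_closure.mem_of_tendsto (tendsto_mollifier_besov hp h2 h3 h4 f g hg)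
    (Eventually.of_forall fun n => ?_)
  -- The mollified element belongs to the Besov spaces of every order.
  have hsm : ∀ t, ∃ u : Besov t p, Besov.dist u = Besov.dist (g n) := fun t => by
    obtain ⟨N, hN⟩ := exists_nat_ge (t - σ)
    obtain ⟨C, -, h⟩ := besovBound_schwartz (p := p) hp N (ρ n) σ
    obtain ⟨u, hu, -⟩ := h f
    obtain ⟨v, hv, -⟩ := besovBound_embedding (p := p) (show t ≤ σ + N by linarith) u
    exact ⟨v, by rw [hv, hg, ← hu]; rfl⟩
  have hvan : Distribution.IsVanishingOn (Besov.dist (g n)) (Iio ((n : ℝ) + 1)⁻¹) := by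
    have := isVanishingOn_conv hf (isMomentKernel_schwartz (ρ n)) (b := ((n : ℝ) + 1)⁻¹)
      fun t ht => by
        by_contra h0
        exact absurd (h4 n t h0).1 (not_le.mpr ht)
    rwa [zero_add, ← hg] at this
  obtain ⟨m, hm⟩ := exists_nat_gt σ
  obtain ⟨u, hu, hu0⟩ := exists_tendsto_dilS hp m σ hm χ (Besov.dist (g n)) hsm
  have hlim : Tendsto (fun k => u k + g n) atTop (𝓝 (g n)) := by
    have := hu0.add_const (g n)
    rwa [zero_add] at this
  refine isClosed_closure.mem_of_tendsto hlim (Eventually.of_forall fun k => ?_)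
  refine mem_closure_testSet_of_smooth hp (show (0 : ℝ) < ((n : ℝ) + 1)⁻¹ by positivity) σ _ hsm
    hvan (dilS k χ) (hasCompactSupport_dilS hχ k) _ ?_
  rw [map_add Besov.dist, hu, hχ1 0 (by simp), one_smul, sub_add_cancel]

/-- Reflection on the Besov space. -/
def reflB (σ : ℝ) : Besov σ p →L[ℂ] Besov σ p := (besovBound_refl (p := p) (σ := σ)).clm

@[simp]
theorem dist_reflB (f : Besov σ p) : Besov.dist (reflB σ f) = refl (Besov.dist f) :=
  besovBound_refl.dist_clm f

@[simp]
theorem reflB_reflB (f : Besov σ p) : reflB σ (reflB σ f) = f :=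
  dist_injective (by simp)

theorem reflB_mem_testSet {U V : Set ℝ} (hUV : ∀ x ∈ U, -x ∈ V) {u : Besov σ p}
    (hu : u ∈ testSet σ p U) : reflB σ u ∈ testSet σ p V := by
  obtain ⟨φ, hφ, h⟩ := hu
  refine ⟨fun x => φ (-x), ⟨hφ.smooth.comp contDiff_neg,
    hφ.compact.comp_homeomorph (Homeomorph.neg ℝ), fun x hx => ?_⟩, fun θ hθ _ => ?_⟩
  · have h1 : -x ∈ tsupport φ := tsupport_comp_subset_preimage φ continuous_neg hx
    simpa using hUV _ (hφ.supp h1)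
  · rw [dist_reflB, refl_apply, h (reflS θ) ?_ (subset_univ _),
      ← integral_neg_eq_self]
    · refine integral_congr_ae (Eventually.of_forall fun x => ?_)
      simp [reflS_apply]
    · exact hθ.comp_homeomorph (Homeomorph.neg ℝ)

theorem mem_closure_testSet_Iio (hp : p ≠ ⊤) (f : Besov σ p)
    (hf : Distribution.IsVanishingOn (Besov.dist f) (Ioi 0)) :
    f ∈ closure (testSet σ p (Iio 0)) := by
  have h := mem_closure_testSet_Ioi hp (reflB σ f) (by
    rw [dist_reflB]
    exact isVanishingOn_refl hf fun x hx => by simpa using hx)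
  rw [← reflB_reflB f]
  exact map_mem_closure (reflB σ).continuous h fun u hu =>
    reflB_mem_testSet (fun x hx => by simpa using hx) hu


/-! ### The truncated logarithmic kernel -/

theorem locallyIntegrable_log : LocallyIntegrable Real.log volume := by
  intro x
  refine ⟨Icc (x - 1) (x + 1), Icc_mem_nhds (by linarith) (by linarith), ?_⟩
  exact (intervalIntegrable_iff_integrableOn_Icc_of_le (by linarith)).mp
    intervalIntegral.intervalIntegrable_log'

theorem integrable_mul_log {c : ℝ → ℂ} (h1 : Continuous c) (h2 : HasCompactSupport c) :
    Integrable fun t => c t * (Real.log t : ℂ) := by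
  have h := locallyIntegrable_log.integrable_smul_left_of_hasCompactSupport (g := fun t => ‖c t‖)
    h1.norm h2.norm
  refine h.mono ?_ (Eventually.of_forall fun t => ?_)
  · exact h1.aestronglyMeasurable.mul
      (Complex.measurable_ofReal.comp Real.measurable_log).aestronglyMeasurable
  · simp

/-- The second difference of `log |·|` with step `1`. -/
def logDiff (u : ℝ) : ℝ := Real.log (u - 1) + Real.log (u + 1) - 2 * Real.log u

/-- Away from the singularities, `logDiff u = log (1 - u⁻²)`. -/
theorem norm_logDiff_le {u : ℝ} (hu : 2 ≤ |u|) : ‖logDiff u‖ ≤ 4 * (1 + u ^ 2)⁻¹ := by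
  have h4 : 4 ≤ u ^ 2 := by
    have := mul_self_le_mul_self (by norm_num) hu
    rw [abs_mul_abs_self] at this
    nlinarith
  have hu0 : u ≠ 0 := fun h => by norm_num [h] at hu
  have hu1 : u - 1 ≠ 0 := fun h => by
    rw [sub_eq_zero.mp h] at h4; norm_num at h4
  have hu2 : u + 1 ≠ 0 := fun h => by
    rw [eq_neg_of_add_eq_zero_left h] at h4; norm_num at h4
  have e : logDiff u = Real.log (1 - (u ^ 2)⁻¹) := by
    rw [logDiff, ← Real.log_mul hu1 hu2, ← Nat.cast_ofNat, ← Real.log_pow,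
      ← Real.log_div (mul_ne_zero hu1 hu2) (pow_ne_zero _ hu0)]
    congr 1
    field_simp
    ring
  have hx : (u ^ 2)⁻¹ ≤ 4⁻¹ := inv_anti₀ (by norm_num) h4
  have hx0 : 0 < (u ^ 2)⁻¹ := by positivity
  have hlow := Real.one_sub_inv_le_log_of_pos (show 0 < 1 - (u ^ 2)⁻¹ by linarith)
  have hup : Real.log (1 - (u ^ 2)⁻¹) ≤ 0 := Real.log_nonpos (by linarith) (by linarith)
  rw [e, Real.norm_of_nonpos hup]
  have e2 : (1 - (u ^ 2)⁻¹)⁻¹ - 1 = (u ^ 2 - 1)⁻¹ := by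
    have : u ^ 2 - 1 ≠ 0 := by linarith
    have : 1 - (u ^ 2)⁻¹ ≠ 0 := by linarith
    field_simp
    ring
  have h5 : (u ^ 2 - 1)⁻¹ ≤ 4 * (1 + u ^ 2)⁻¹ := by
    rw [← div_eq_mul_inv, inv_eq_one_div, div_le_div_iff₀ (by linarith) (by positivity)]
    linarith
  linarith

theorem measurable_logDiff : Measurable logDiff := by
  unfold logDiff
  fun_prop

theorem integrable_logDiff : Integrable logDiff := by
  have hc : IntegrableOn logDiff (Icc (-2) 2) := by
    have h := fun a b : ℝ => (intervalIntegral.intervalIntegrable_log' (a := a) (b := b))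
    refine (intervalIntegrable_iff_integrableOn_Icc_of_le (by norm_num)).mp ?_
    refine IntervalIntegrable.sub (IntervalIntegrable.add ?_ ?_) ((h (-2) 2).const_mul 2)
    · have := (h (-3) 1).comp_sub_right 1
      norm_num at this
      exact this
    · have := (h (-1) 3).comp_add_right 1
      norm_num at this
      exact this
  have hout : IntegrableOn logDiff (Icc (-2) 2)ᶜ := by
    refine (((integrable_inv_one_add_sq.const_mul 4).integrableOn).mono'
      measurable_logDiff.aestronglyMeasurable ?_)
    refine (ae_restrict_iff' measurableSet_Icc.compl).mpr (Eventually.of_forall fun u hu => ?_)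
    refine norm_logDiff_le ?_
    by_contra hlt
    exact hu (abs_le.mp (not_le.mp hlt).le)
  have := hc.union hout
  rwa [union_compl_self, integrableOn_univ] at this

theorem logDiff_scale {s t : ℝ} (hs : s ≠ 0) (h0 : t ≠ 0) (h1 : t - s ≠ 0) (h2 : t + s ≠ 0) :
    logDiff (s⁻¹ * t) = Real.log (t - s) + Real.log (t + s) - 2 * Real.log t := by
  have e1 : s⁻¹ * t - 1 = s⁻¹ * (t - s) := by field_simp
  have e2 : s⁻¹ * t + 1 = s⁻¹ * (t + s) := by field_simp
  rw [logDiff, e1, e2, Real.log_mul (inv_ne_zero hs) h1, Real.log_mul (inv_ne_zero hs) h2,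
    Real.log_mul (inv_ne_zero hs) h0]
  ring

theorem integral_add_add {f g h : ℝ → ℝ} (hf : Integrable f) (hg : Integrable g)
    (hh : Integrable h) : ∫ t, (f t + g t + h t) = (∫ t, f t) + (∫ t, g t) + ∫ t, h t := by
  rw [← integral_add hf hg]
  exact integral_add (hf.add hg) hh

/-- It suffices to test the Zygmund condition on small positive steps. -/
theorem isZygmundKernel_of_small {k : ℝ → ℂ} (hk : Integrable k) {C : ℝ}
    (h : ∀ s : ℝ, 0 < s → s ≤ 1 → ∫ t, ‖k (t - s) + k (t + s) - (2 : ℂ) * k t‖ ≤ C * s) :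
    IsZygmundKernel k := by
  have hbig : ∀ s : ℝ, ∫ t, ‖k (t - s) + k (t + s) - (2 : ℂ) * k t‖ ≤ 4 * ∫ t, ‖k t‖ := by
    intro s
    have i1 : Integrable fun t => ‖k (t - s)‖ := (hk.comp_sub_right s).norm
    have i2 : Integrable fun t => ‖k (t + s)‖ := (hk.comp_add_right s).norm
    have i3 : Integrable fun t => 2 * ‖k t‖ := hk.norm.const_mul 2
    calc _ ≤ ∫ t, (‖k (t - s)‖ + ‖k (t + s)‖ + 2 * ‖k t‖) := by
          refine integral_mono_of_nonneg (Eventually.of_forall fun _ => norm_nonneg _)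
            ((i1.add i2).add i3) (Eventually.of_forall fun t => ?_)
          refine (norm_sub_le _ _).trans (add_le_add (norm_add_le _ _) ?_)
          rw [norm_mul]; simp
      _ = _ := by
          rw [integral_add_add i1 i2 i3, integral_const_mul,
            integral_sub_right_eq_self (fun t => ‖k t‖) s,
            integral_add_right_eq_self (fun t => ‖k t‖) s]
          ring
  have hn : 0 ≤ ∫ t, ‖k t‖ := integral_nonneg fun _ => norm_nonneg _
  have key : ∀ s : ℝ, 0 < s →
      ∫ t, ‖k (t - s) + k (t + s) - (2 : ℂ) * k t‖ ≤ max C (4 * ∫ t, ‖k t‖) * s := by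
    intro s hs
    rcases le_total s 1 with h1 | h1
    · exact (h s hs h1).trans (mul_le_mul_of_nonneg_right (le_max_left _ _) hs.le)
    · refine (hbig s).trans ((le_max_right C _).trans ?_)
      exact le_mul_of_one_le_right ((by positivity : (0 : ℝ) ≤ 4 * ∫ t, ‖k t‖).trans
        (le_max_right _ _)) h1
  refine ⟨max C (4 * ∫ t, ‖k t‖), fun s => ?_⟩
  rcases lt_trichotomy s 0 with hs | rfl | hs
  · rw [abs_of_neg hs]
    have := key (-s) (by linarith)
    simp only [sub_neg_eq_add, ← sub_eq_add_neg] at this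
    simpa only [add_comm] using this
  · have e : ∀ t, k t + k t - (2 : ℂ) * k t = 0 := fun t => by ring
    simp [e]
  · rw [abs_of_pos hs]; exact key s hs

/-- The logarithmic kernel `(1/2π) ln|t|`, truncated by the cut-off `χ`. -/
def logKernel (χ : 𝓢(ℝ, ℂ)) (t : ℝ) : ℂ := χ t * ((1 / (2 * Real.pi) * Real.log t : ℝ) : ℂ)

theorem logKernel_neg {χ : 𝓢(ℝ, ℂ)} (hχ : ∀ x, χ (-x) = χ x) (t : ℝ) :
    logKernel χ (-t) = logKernel χ t := by
  rw [logKernel, logKernel, hχ, Real.log_neg_eq_log]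

theorem isMomentKernel_logKernel {χ : 𝓢(ℝ, ℂ)} (hχ : HasCompactSupport χ) :
    IsMomentKernel (logKernel χ) where
  meas := χ.continuous.aestronglyMeasurable.mul
    (Complex.measurable_ofReal.comp
      (Real.measurable_log.const_mul (1 / (2 * Real.pi)))).aestronglyMeasurable
  moment n := by
    have h := ((integrable_mul_log (c := fun t : ℝ => ((|t| ^ n : ℝ) : ℂ) * χ t)
      (by have := χ.continuous; fun_prop) hχ.mul_left).norm).const_mul ‖1 / (2 * Real.pi)‖
    refine h.congr (Eventually.of_forall fun t => ?_)
    simp only [logKernel, norm_mul, Complex.norm_real, Real.norm_eq_abs, abs_pow, abs_abs]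
    ring

theorem norm_sub_le_of_schwartz (χ : 𝓢(ℝ, ℂ)) : ∃ M, 0 ≤ M ∧ ∀ x y, ‖χ x - χ y‖ ≤ M * |x - y| := by
  obtain ⟨M, hM, h⟩ := exists_norm_le (SchwartzMap.derivCLM ℂ ℂ χ)
  refine ⟨M, hM, fun x y => ?_⟩
  exact convex_univ.norm_image_sub_le_of_norm_deriv_le
    (fun z _ => χ.differentiable.differentiableAt)
    (fun z _ => by simpa [SchwartzMap.derivCLM_apply] using h z) (mem_univ y) (mem_univ x)

/-- For `0 < s ≤ 1` the difference `χ(x) - χ(y)`, `|x - y| = s`, is at most `M s` and vanishes for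
`x` outside a fixed compact set. -/
theorem exists_norm_sub_le {χ : 𝓢(ℝ, ℂ)} (hχ : HasCompactSupport χ) :
    ∃ (M : ℝ) (η : 𝓢(ℝ, ℂ)), 0 ≤ M ∧ HasCompactSupport η ∧
      ∀ x y, |x - y| ≤ 1 → ‖χ x - χ y‖ ≤ M * |x - y| * ‖η x‖ := by
  obtain ⟨M, hM, h⟩ := norm_sub_le_of_schwartz χ
  obtain ⟨R, hR, h1⟩ := hχ.isCompact.isBounded.exists_pos_norm_le
  obtain ⟨η, hη, h2, -⟩ := exists_even_cutoff (show 0 < R + 1 by linarith)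
  refine ⟨M, η, hM, hη, fun x y hxy => ?_⟩
  by_cases hx : |x| ≤ R + 1
  · rw [h2 x hx, norm_one, mul_one]
    exact h x y
  · have hx0 : χ x = 0 := by
      by_contra h0
      have := h1 x (subset_tsupport _ h0)
      rw [Real.norm_eq_abs] at this
      linarith
    have hy0 : χ y = 0 := by
      by_contra h0
      have := h1 y (subset_tsupport _ h0)
      rw [Real.norm_eq_abs] at this
      have h3 := abs_add_le (x - y) y
      rw [sub_add_cancel] at h3
      linarith
    rw [hx0, hy0, sub_zero, norm_zero]
    positivity

/-- The truncated logarithm is a Zygmund kernel. The second difference of `χ log|·|` with step `s`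
is `χ` times the second difference of the logarithm, which is `logDiff (t / s)` and has `L_1` norm
`O(s)` by scaling, plus two terms in which a first difference `O(s)` of `χ` multiplies an
integrable function. -/
theorem isZygmundKernel_logKernel {χ : 𝓢(ℝ, ℂ)} (hχ : HasCompactSupport χ) :
    IsZygmundKernel (logKernel χ) := by
  obtain ⟨M, η, hM, hη, h1⟩ := exists_norm_sub_le hχ
  obtain ⟨B, hB, h2⟩ := exists_norm_le χ
  set c : ℝ := 1 / (2 * Real.pi) with hc
  have hc0 : 0 ≤ c := by positivity
  set A : ℝ := ∫ t, ‖η t * (Real.log t : ℂ)‖ with hA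
  have iη : Integrable fun t => ‖η t * (Real.log t : ℂ)‖ :=
    (integrable_mul_log η.continuous hη).norm
  refine isZygmundKernel_of_small (isMomentKernel_logKernel hχ).integrable
    (C := c * B * (∫ u, ‖logDiff u‖) + 2 * (c * M * A)) fun s hs hs1 => ?_
  have i1 : Integrable fun t => c * B * ‖logDiff (s⁻¹ * t)‖ :=
    ((integrable_logDiff.comp_mul_left' (inv_ne_zero hs.ne')).norm).const_mul _
  have i2 : Integrable fun t => c * M * s * ‖η (t - s) * (Real.log (t - s) : ℂ)‖ :=
    (iη.comp_sub_right s).const_mul _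
  have i3 : Integrable fun t => c * M * s * ‖η (t + s) * (Real.log (t + s) : ℂ)‖ :=
    (iη.comp_add_right s).const_mul _
  calc _ ≤ ∫ t, (c * B * ‖logDiff (s⁻¹ * t)‖ + c * M * s * ‖η (t - s) * (Real.log (t - s) : ℂ)‖ +
        c * M * s * ‖η (t + s) * (Real.log (t + s) : ℂ)‖) := by
        refine integral_mono_of_nonneg (Eventually.of_forall fun _ => norm_nonneg _)
          ((i1.add i2).add i3) ?_
        -- The scaling identity fails at the three singular points, a null set.
        have hne : ∀ a : ℝ, ∀ᵐ t : ℝ, t ≠ a := fun a =>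
          (measure_eq_zero_iff_ae_notMem.mp (measure_singleton a)).mono fun t ht => ht
        filter_upwards [hne 0, hne s, hne (-s)] with t t0 ts tms
        have e := logDiff_scale hs.ne' t0 (sub_ne_zero.mpr ts)
          (fun h => tms (eq_neg_of_add_eq_zero_left h))
        have e2 : logKernel χ (t - s) + logKernel χ (t + s) - (2 : ℂ) * logKernel χ t =
            (c : ℂ) * (χ t * (logDiff (s⁻¹ * t) : ℂ)) +
            (c : ℂ) * ((χ (t - s) - χ t) * (Real.log (t - s) : ℂ)) +
            (c : ℂ) * ((χ (t + s) - χ t) * (Real.log (t + s) : ℂ)) := by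
          rw [e, logKernel, logKernel, logKernel, ← hc]
          push_cast
          ring
        have b1 := h1 (t - s) t (by rw [sub_sub_cancel_left, abs_neg, abs_of_pos hs]; exact hs1)
        have b2 := h1 (t + s) t (by rw [add_sub_cancel_left, abs_of_pos hs]; exact hs1)
        rw [sub_sub_cancel_left, abs_neg, abs_of_pos hs] at b1
        rw [add_sub_cancel_left, abs_of_pos hs] at b2
        rw [e2]
        refine (norm_add_le _ _).trans (add_le_add ((norm_add_le _ _).trans (add_le_add ?_ ?_)) ?_)
        · rw [norm_mul, norm_mul, Complex.norm_real, Complex.norm_real, Real.norm_of_nonneg hc0,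
            mul_assoc]
          gcongr
          exact h2 t
        · rw [norm_mul, norm_mul, norm_mul, Complex.norm_real, Real.norm_of_nonneg hc0]
          calc c * (‖χ (t - s) - χ t‖ * ‖(Real.log (t - s) : ℂ)‖)
              ≤ c * (M * s * ‖η (t - s)‖ * ‖(Real.log (t - s) : ℂ)‖) := by gcongr
            _ = _ := by ring
        · rw [norm_mul, norm_mul, norm_mul, Complex.norm_real, Real.norm_of_nonneg hc0]
          calc c * (‖χ (t + s) - χ t‖ * ‖(Real.log (t + s) : ℂ)‖)
              ≤ c * (M * s * ‖η (t + s)‖ * ‖(Real.log (t + s) : ℂ)‖) := by gcongr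
            _ = _ := by ring
    _ = _ := by
        rw [integral_add_add i1 i2 i3, integral_const_mul, integral_const_mul,
          integral_const_mul, integral_sub_right_eq_self (fun t => ‖η t * (Real.log t : ℂ)‖) s,
          integral_add_right_eq_self (fun t => ‖η t * (Real.log t : ℂ)‖) s,
          Measure.integral_comp_mul_left (fun u => ‖logDiff u‖) s⁻¹, inv_inv, abs_of_pos hs,
          smul_eq_mul]
        ring


/-! ### The boundary operators on test functions -/

theorem contDiff_mul_of_tsupport {a w : ℝ → ℂ} (hw : ContDiff ℝ ∞ w) {t : ℝ} (ht : t ∉ tsupport w)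
    (ha : ∀ x, x ≠ t → ContDiffAt ℝ ∞ a x) : ContDiff ℝ ∞ fun x => a x * w x := by
  refine contDiff_iff_contDiffAt.mpr fun x => ?_
  by_cases hx : x = t
  · refine (contDiffAt_const (c := (0 : ℂ))).congr_of_eventuallyEq ?_
    filter_upwards [notMem_tsupport_iff_eventuallyEq.mp (hx ▸ ht : x ∉ tsupport w)] with y hy
    rw [hy, Pi.zero_apply, mul_zero]
  · exact (ha x hx).mul hw.contDiffAt

theorem contDiff_deriv {w : ℝ → ℂ} (hw : ContDiff ℝ ∞ w) : ContDiff ℝ ∞ (deriv w) :=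
  (contDiff_infty_iff_deriv.mp hw).2

theorem contDiffAt_log_sub {t x : ℝ} (h : x ≠ t) :
    ContDiffAt ℝ ∞ (fun x : ℝ => (Real.log (t - x) : ℂ)) x := by
  have h1 : ContDiffAt ℝ ∞ (fun x : ℝ => Real.log (t - x)) x :=
    (contDiffAt_const.sub contDiffAt_id).log (sub_ne_zero.mpr h.symm)
  exact Complex.ofRealCLM.contDiff.contDiffAt.comp x h1

theorem contDiffAt_inv_sub {t x : ℝ} (h : x ≠ t) :
    ContDiffAt ℝ ∞ (fun x : ℝ => (((t - x : ℝ) : ℂ))⁻¹) x := by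
  have h1 : ContDiffAt ℝ ∞ (fun x : ℝ => (t - x)⁻¹) x :=
    (contDiffAt_const.sub contDiffAt_id).inv (sub_ne_zero.mpr h.symm)
  have h2 := Complex.ofRealCLM.contDiff.contDiffAt.comp x h1
  refine h2.congr_of_eventuallyEq (Eventually.of_forall fun y => ?_)
  simp

/-- Integration by parts against the logarithm, at a point outside the support. -/
theorem integral_log_mul_deriv {w : ℝ → ℂ} (hw : ContDiff ℝ ∞ w) (hc : HasCompactSupport w) {t : ℝ}
    (ht : t ∉ tsupport w) :
    ∫ x, (Real.log (t - x) : ℂ) * deriv w x = ∫ x, w x / ((t - x : ℝ) : ℂ) := by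
  have ht' : t ∉ tsupport (deriv w) := fun h => ht (tsupport_deriv_subset h)
  have c1 := contDiff_mul_of_tsupport hw ht fun x => contDiffAt_log_sub
  have c2 := contDiff_mul_of_tsupport (contDiff_deriv hw) ht' fun x => contDiffAt_log_sub
  have c3 := contDiff_mul_of_tsupport hw ht fun x => contDiffAt_inv_sub
  have i1 := c1.continuous.integrable_of_hasCompactSupport (μ := volume) hc.mul_left
  have i2 := c2.continuous.integrable_of_hasCompactSupport (μ := volume) hc.deriv.mul_left
  have i3 := c3.continuous.integrable_of_hasCompactSupport (μ := volume) hc.mul_left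
  have hd : ∀ x, HasDerivAt (fun x => (Real.log (t - x) : ℂ) * w x)
      ((Real.log (t - x) : ℂ) * deriv w x - (((t - x : ℝ) : ℂ))⁻¹ * w x) x := by
    intro x
    by_cases hx : x = t
    -- At `x = t` the function `w` vanishes in a neighbourhood, and the value of `log 0` is
    -- irrelevant.
    · subst hx
      have h0 : w =ᶠ[𝓝 x] 0 := notMem_tsupport_iff_eventuallyEq.mp ht
      have h1 : deriv w x = 0 := image_eq_zero_of_notMem_tsupport ht'
      have h2 : w x = 0 := image_eq_zero_of_notMem_tsupport ht
      rw [h1, h2, mul_zero, mul_zero, sub_zero]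
      refine (hasDerivAt_const x (0 : ℂ)).congr_of_eventuallyEq ?_
      filter_upwards [h0] with y hy
      rw [hy, Pi.zero_apply, mul_zero]
    · have h1 : HasDerivAt (fun x : ℝ => Real.log (t - x)) (-1 / (t - x)) x :=
        ((hasDerivAt_id x).const_sub t).log (sub_ne_zero.mpr (Ne.symm hx))
      have h2 := (h1.ofReal_comp).mul
        ((hw.differentiable (by simp)).differentiableAt (x := x)).hasDerivAt
      refine h2.congr_deriv ?_
      push_cast
      rw [neg_div, one_div]
      ring
  have h := integral_eq_zero_of_hasDerivAt_of_integrable hd (i2.sub i3) i1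
  rw [integral_sub i2 i3, sub_eq_zero] at h
  rw [h]
  exact integral_congr_ae (Eventually.of_forall fun x => by
    simp only; rw [div_eq_mul_inv, mul_comm])

theorem laplaceKernel_zero (x : ℝ) : laplaceKernel x 0 = 1 / (2 * Real.pi) * Real.log x := by
  rw [laplaceKernel, zero_pow two_ne_zero, add_zero, Real.sqrt_sq_eq_abs, Real.log_abs]

theorem deriv_zero_of_even {f : ℝ → ℝ} (hf : ∀ x, f (-x) = f x) : deriv f 0 = 0 := by
  have h := deriv_comp_neg f 0
  simp only [hf, neg_zero] at h
  linarith

/-- The normal derivative of the even function `y₂ ↦ K(t - τ, y₂)` vanishes on the boundary line.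
For `τ = t`, where the kernel is singular, the junk value of `deriv` is `0` as well. -/
theorem doubleLayer_eq_zero (v : ℝ → ℂ) (t : ℝ) : doubleLayer v t = 0 := by
  have h : ∀ τ, deriv (fun y₂ : ℝ => laplaceKernel (t - τ) (0 - y₂)) 0 = 0 := fun τ =>
    deriv_zero_of_even fun y => by simp [laplaceKernel]
  simp only [doubleLayer, h, neg_zero, Complex.ofReal_zero, zero_mul, integral_zero]

theorem adjointDoubleLayer_eq_zero (v : ℝ → ℂ) (t : ℝ) : adjointDoubleLayer v t = 0 := by
  have h : ∀ τ, deriv (fun x₂ : ℝ => laplaceKernel (t - τ) (x₂ - 0)) 0 = 0 := fun τ =>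
    deriv_zero_of_even fun y => by simp [laplaceKernel]
  simp only [adjointDoubleLayer, h, neg_zero, Complex.ofReal_zero, zero_mul, integral_zero]

/-- Outside the support of `w`, the derivative of the single layer potential is a Cauchy
integral. -/
theorem singleLayer_deriv {w : ℝ → ℂ} (hw : ContDiff ℝ ∞ w) (hc : HasCompactSupport w) {t : ℝ}
    (ht : t ∉ tsupport w) :
    singleLayer (deriv w) t = 1 / (2 * Real.pi) * ∫ x, w x / ((t - x : ℝ) : ℂ) := by
  rw [← integral_log_mul_deriv hw hc ht, singleLayer, ← integral_const_mul]
  refine integral_congr_ae (Eventually.of_forall fun x => ?_)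
  simp only [laplaceKernel_zero]
  push_cast
  ring

/-- Outside the support of `w` the hypersingular operator is the second derivative of the single
layer potential; the principal value is then an ordinary integral. -/
theorem hypersingular_eq {w : ℝ → ℂ} (hw : ContDiff ℝ ∞ w) (hc : HasCompactSupport w) {t : ℝ}
    (ht : t ∉ tsupport w) : hypersingular w t = singleLayer (deriv (deriv w)) t := by
  have ht' : t ∉ tsupport (deriv w) := fun h => ht (tsupport_deriv_subset h)
  have h0 : deriv w =ᶠ[𝓝 t] 0 := notMem_tsupport_iff_eventuallyEq.mp ht'
  obtain ⟨δ, hδ, hb⟩ := Metric.eventually_nhds_iff.mp h0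
  have hlim : Tendsto (fun ε : ℝ => ∫ x in {x : ℝ | ε < |t - x|}, deriv w x / ((t - x : ℝ) : ℂ))
      (𝓝[>] (0 : ℝ)) (𝓝 (∫ x, deriv w x / ((t - x : ℝ) : ℂ))) := by
    -- The truncated integrals do not depend on small `ε`, as `∂w` vanishes near `t`.
    refine tendsto_const_nhds.congr' ?_
    filter_upwards [Ioo_mem_nhdsGT hδ] with ε hε
    refine (setIntegral_eq_integral_of_forall_compl_eq_zero fun x hx => ?_).symm
    have hx1 : |t - x| ≤ ε := not_lt.mp hx
    have : deriv w x = 0 := hb (by rw [Real.dist_eq, abs_sub_comm]; exact hx1.trans_lt hε.2)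
    rw [this, zero_div]
  rw [hypersingular, hlim.limUnder_eq, image_eq_zero_of_notMem_tsupport ht, neg_zero, zero_add,
    singleLayer_deriv (contDiff_deriv hw) hc.deriv ht']

/-- On `(0, ∞)` the Mellin convolution is `2 ∂ V J`, with the reflection `J v = v(-·)`. -/
theorem mellinOp_eq {v : ℝ → ℂ} (hv : IsTestFunctionOn (Ioi 0) v) {t : ℝ} (ht : 0 < t) :
    mellinOp v t = 2 * singleLayer (deriv fun x => v (-x)) t := by
  have h1 : t ∉ tsupport fun x => v (-x) := fun h => by
    have h2 : -t ∈ tsupport v := tsupport_comp_subset_preimage v continuous_neg h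
    have h3 : 0 < -t := hv.supp h2
    linarith
  have h2 : ContDiff ℝ ∞ fun x => v (-x) := hv.smooth.comp contDiff_neg
  rw [singleLayer_deriv h2 (hv.compact.comp_homeomorph (Homeomorph.neg ℝ)) h1,
    mellinOp, setIntegral_eq_integral_of_forall_compl_eq_zero fun x hx => ?_,
    ← integral_neg_eq_self]
  · simp only [sub_eq_add_neg]
    ring
  · rw [image_eq_zero_of_notMem_tsupport fun h => hx (hv.supp h), zero_div]

/-! ### Distributions given by functions -/

theorem _root_.AgreesOn.mono {U V : Set ℝ} {f : 𝓢'(ℝ, ℂ)} {F : ℝ → ℂ} (h : AgreesOn V f F)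
    (hUV : U ⊆ V) : AgreesOn U f F := fun θ h1 h2 => h θ h1 (h2.trans hUV)

theorem _root_.AgreesOn.congr {U : Set ℝ} {f : 𝓢'(ℝ, ℂ)} {F G : ℝ → ℂ} (h : AgreesOn U f F)
    (hFG : ∀ x ∈ U, F x = G x) : AgreesOn U f G := fun θ h1 h2 => by
  rw [h θ h1 h2]
  refine integral_congr_ae (Eventually.of_forall fun x => ?_)
  by_cases hx : x ∈ tsupport θ
  · simp only [hFG x (h2 hx)]
  · simp only [image_eq_zero_of_notMem_tsupport hx, zero_mul]

theorem integrable_schwartz_mul {θ : 𝓢(ℝ, ℂ)} (hθ : HasCompactSupport θ) {F : ℝ → ℂ}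
    (hF : Continuous F) : Integrable fun x => θ x * F x :=
  (θ.continuous.mul hF).integrable_of_hasCompactSupport hθ.mul_right

theorem _root_.AgreesOn.add {U : Set ℝ} {f g : 𝓢'(ℝ, ℂ)} {F G : ℝ → ℂ} (hf : AgreesOn U f F)
    (hg : AgreesOn U g G) (hF : Continuous F) (hG : Continuous G) :
    AgreesOn U (f + g) fun x => F x + G x := fun θ h1 h2 => by
  change f θ + g θ = _
  rw [hf θ h1 h2, hg θ h1 h2, ← integral_add (integrable_schwartz_mul h1 hF)
    (integrable_schwartz_mul h1 hG)]
  simp only [mul_add]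

theorem _root_.AgreesOn.const_smul {U : Set ℝ} {f : 𝓢'(ℝ, ℂ)} {F : ℝ → ℂ} (hf : AgreesOn U f F)
    (c : ℂ) : AgreesOn U (c • f) fun x => c * F x := fun θ h1 h2 => by
  change c • f θ = _
  rw [hf θ h1 h2, smul_eq_mul, ← integral_const_mul]
  refine integral_congr_ae (Eventually.of_forall fun x => ?_)
  simp only
  ring

theorem _root_.AgreesOn.smulD {U : Set ℝ} {f : 𝓢'(ℝ, ℂ)} {F : ℝ → ℂ} (hf : AgreesOn U f F)
    {g : ℝ → ℂ} (hg : g.HasTemperateGrowth) : AgreesOn U (smulD g f) fun x => g x * F x :=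
  fun θ h1 h2 => by
  have e : (SchwartzMap.smulLeftCLM ℂ g θ : ℝ → ℂ) = fun x => g x * θ x := by
    funext x
    rw [SchwartzMap.smulLeftCLM_apply_apply hg, smul_eq_mul]
  have h3 : tsupport (SchwartzMap.smulLeftCLM ℂ g θ) ⊆ tsupport θ := by
    rw [e]; exact closure_mono fun x hx => right_ne_zero_of_mul hx
  rw [TemperedDistribution.smulLeftCLM_apply_apply, hf _ ?_ (h3.trans h2), e]
  · refine integral_congr_ae (Eventually.of_forall fun x => ?_)
    simp only
    ring
  · rw [e]; exact h1.mul_left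

/-- The distribution `f` is the test function `w`. -/
structure IsTest (f : 𝓢'(ℝ, ℂ)) (w : ℝ → ℂ) : Prop where
  smooth : ContDiff ℝ ∞ w
  compact : HasCompactSupport w
  agrees : AgreesOn univ f w

theorem eq_of_agreesOn {f g : 𝓢'(ℝ, ℂ)} {F : ℝ → ℂ} (hf : AgreesOn univ f F)
    (hg : AgreesOn univ g F) : f = g := by
  have h : Distribution.IsVanishingOn (f - g) univ := isVanishingOn_of_compactSupport
    fun θ h1 h2 => by
      change f θ - g θ = 0
      rw [hf θ h1 h2, hg θ h1 h2, sub_self]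
  ext θ
  exact sub_eq_zero.mp (h θ (subset_univ _))

theorem agreesOn_schwartz (W : 𝓢(ℝ, ℂ)) :
    AgreesOn univ (SchwartzMap.toTemperedDistributionCLM ℝ ℂ volume W) W := fun θ _ _ => by
  exact SchwartzMap.coe_apply W θ

theorem IsTest.exists_schwartz {f : 𝓢'(ℝ, ℂ)} {w : ℝ → ℂ} (h : IsTest f w) :
    ∃ W : 𝓢(ℝ, ℂ), (∀ x, W x = w x) ∧ f = SchwartzMap.toTemperedDistributionCLM ℝ ℂ volume W :=
  ⟨h.compact.toSchwartzMap h.smooth, fun _ => rfl,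
    eq_of_agreesOn h.agrees (agreesOn_schwartz (h.compact.toSchwartzMap h.smooth))⟩

theorem IsTest.deriv {f : 𝓢'(ℝ, ℂ)} {w : ℝ → ℂ} (h : IsTest f w) : IsTest (D f) (deriv w) := by
  refine ⟨contDiff_deriv h.smooth, h.compact.deriv, ?_⟩
  obtain ⟨W, hW, rfl⟩ := h.exists_schwartz
  have e : (SchwartzMap.derivCLM ℂ ℂ W : ℝ → ℂ) = _root_.deriv w := by
    funext x
    rw [SchwartzMap.derivCLM_apply, funext hW]
  rw [D, TemperedDistribution.derivCLM_toTemperedDistributionCLM_eq (𝕜 := ℂ), ← e]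
  exact agreesOn_schwartz _

theorem IsTest.smulD {f : 𝓢'(ℝ, ℂ)} {w : ℝ → ℂ} (h : IsTest f w) (g : 𝓢(ℝ, ℂ)) :
    IsTest (smulD g f) fun x => g x * w x :=
  ⟨g.smooth'.mul h.smooth, h.compact.mul_left, h.agrees.smulD g.hasTemperateGrowth⟩

theorem IsTest.refl {f : 𝓢'(ℝ, ℂ)} {w : ℝ → ℂ} (h : IsTest f w) :
    IsTest (refl f) fun x => w (-x) := by
  refine ⟨h.smooth.comp contDiff_neg, h.compact.comp_homeomorph (Homeomorph.neg ℝ),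
    fun θ hθ _ => ?_⟩
  rw [refl_apply, h.agrees (reflS θ) (hθ.comp_homeomorph (Homeomorph.neg ℝ)) (subset_univ _),
    ← integral_neg_eq_self]
  refine integral_congr_ae (Eventually.of_forall fun x => ?_)
  simp [reflS_apply]

/-- Convolution with the truncated logarithmic kernel. -/
def logPot (χ : 𝓢(ℝ, ℂ)) : 𝓢'(ℝ, ℂ) →L[ℂ] 𝓢'(ℝ, ℂ) := mult (𝓕 (logKernel χ))

theorem IsTest.logPot {χ : 𝓢(ℝ, ℂ)} (hχ : HasCompactSupport χ) {f : 𝓢'(ℝ, ℂ)} {w : ℝ → ℂ}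
    (h : IsTest f w) :
    AgreesOn univ (logPot χ f) (fun t => ∫ x, w x * logKernel χ (t - x)) ∧
      Continuous fun t => ∫ x, w x * logKernel χ (t - x) := by
  obtain ⟨W, hW, rfl⟩ := h.exists_schwartz
  have hk := isMomentKernel_logKernel hχ
  have hae : ∀ t, ∫ x, (W.toLp 1 volume : LpC 1) x * logKernel χ (t - x) =
      ∫ x, w x * logKernel χ (t - x) := fun t => by
    refine integral_congr_ae ?_
    filter_upwards [W.coeFn_toLp 1 volume] with x hx
    rw [hx, hW]
  refine ⟨?_, ?_⟩
  · have := agreesOn_mult hk (W.toLp 1 volume : LpC 1) (L1.integrable_coeFn _)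
    rw [toDist_toLp] at this
    exact this.congr fun t _ => hae t
  · exact h.compact.continuous_convolution_left (ContinuousLinearMap.mul ℝ ℂ)
      h.smooth.continuous hk.integrable.locallyIntegrable

/-- On bounded sets the truncation of the logarithm is not felt. -/
theorem potential_eq_singleLayer {χ : 𝓢(ℝ, ℂ)} {R : ℝ} (hχ : ∀ x, |x| ≤ 2 * R → χ x = 1) {w : ℝ → ℂ}
    (hw : ∀ x, w x ≠ 0 → |x| ≤ R) {t : ℝ} (ht : |t| ≤ R) :
    ∫ x, w x * logKernel χ (t - x) = singleLayer w t := by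
  refine integral_congr_ae (Eventually.of_forall fun x => ?_)
  simp only
  by_cases h0 : w x = 0
  · rw [h0, zero_mul, mul_zero]
  · have h1 : |t - x| ≤ 2 * R := (abs_sub _ _).trans (by linarith [hw x h0])
    rw [logKernel, hχ _ h1, one_mul, laplaceKernel_zero, mul_comm]


/-! ### Compact operators and transfer of one-sided inverses -/

section Transfer

variable {W X X' Y Y' Z : Type*}
  [SeminormedAddCommGroup W] [NormedSpace ℂ W] [SeminormedAddCommGroup X] [NormedSpace ℂ X]
  [SeminormedAddCommGroup X'] [NormedSpace ℂ X'] [SeminormedAddCommGroup Y] [NormedSpace ℂ Y]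
  [SeminormedAddCommGroup Y'] [NormedSpace ℂ Y'] [SeminormedAddCommGroup Z] [NormedSpace ℂ Z]

theorem isCompactOperator_comp {A : X →L[ℂ] Y} (hA : IsCompactOperator A) (B : Y →L[ℂ] Z)
    (C : W →L[ℂ] X) : IsCompactOperator (B ∘L A ∘L C) :=
  (hA.comp_clm C).clm_comp B

theorem isCompactOperator_comp_left {A : X →L[ℂ] Y} (hA : IsCompactOperator A) (B : Y →L[ℂ] Z) :
    IsCompactOperator (B ∘L A) :=
  hA.clm_comp B

theorem isCompactOperator_comp_right {A : X →L[ℂ] Y} (hA : IsCompactOperator A) (C : W →L[ℂ] X) :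
    IsCompactOperator (A ∘L C) :=
  hA.comp_clm C

theorem isCompactOperator_add {A B : X →L[ℂ] Y} (hA : IsCompactOperator A)
    (hB : IsCompactOperator B) : IsCompactOperator (A + B) :=
  IsCompactOperator.add hA hB

theorem isCompactOperator_sub {A B : X →L[ℂ] Y} (hA : IsCompactOperator A)
    (hB : IsCompactOperator B) : IsCompactOperator (A - B) :=
  IsCompactOperator.sub hA hB

/-- Operators that are intertwined, modulo compact operators, by isomorphisms: `P`, `Q` transform
`T`, `M`, `N` into multiples of `T'`, `M'`, `N'`. -/
structure Intertwined (P : X ≃L[ℂ] X') (Q : Y ≃L[ℂ] Y') (c : ℂ) (T : X →L[ℂ] Y) (T' : X' →L[ℂ] Y')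
    (M : X →L[ℂ] X) (M' : X' →L[ℂ] X') (N : Y →L[ℂ] Y) (N' : Y' →L[ℂ] Y') : Prop where
  ne_zero : c ≠ 0
  op : IsCompactOperator ((Q : Y →L[ℂ] Y') ∘L T - c • (T' ∘L (P : X →L[ℂ] X')))
  left : IsCompactOperator ((P : X →L[ℂ] X') ∘L M - M' ∘L (P : X →L[ℂ] X'))
  right : IsCompactOperator ((Q : Y →L[ℂ] Y') ∘L N - N' ∘L (Q : Y →L[ℂ] Y'))

namespace Intertwined

variable {P : X ≃L[ℂ] X'} {Q : Y ≃L[ℂ] Y'} {c : ℂ} {T : X →L[ℂ] Y} {T' : X' →L[ℂ] Y'}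
  {M : X →L[ℂ] X} {M' : X' →L[ℂ] X'} {N : Y →L[ℂ] Y} {N' : Y' →L[ℂ] Y'}

theorem symm (h : Intertwined P Q c T T' M M' N N') :
    Intertwined P.symm Q.symm c⁻¹ T' T M' M N' N where
  ne_zero := inv_ne_zero h.ne_zero
  op := by
    have e : (Q.symm : Y' →L[ℂ] Y) ∘L T' - c⁻¹ • (T ∘L (P.symm : X' →L[ℂ] X)) =
        (-c⁻¹ • (Q.symm : Y' →L[ℂ] Y)) ∘L ((Q : Y →L[ℂ] Y') ∘L T - c • (T' ∘L (P : X →L[ℂ] X'))) ∘L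
          (P.symm : X' →L[ℂ] X) := by
      ext x
      simp [smul_smul, h.ne_zero]
      abel
    rw [e]
    exact isCompactOperator_comp h.op _ _
  left := by
    have e : (P.symm : X' →L[ℂ] X) ∘L M' - M ∘L (P.symm : X' →L[ℂ] X) =
        (-(P.symm : X' →L[ℂ] X)) ∘L ((P : X →L[ℂ] X') ∘L M - M' ∘L (P : X →L[ℂ] X')) ∘L
          (P.symm : X' →L[ℂ] X) := by
      ext x
      simp
      abel
    rw [e]
    exact isCompactOperator_comp h.left _ _
  right := by
    have e : (Q.symm : Y' →L[ℂ] Y) ∘L N' - N ∘L (Q.symm : Y' →L[ℂ] Y) =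
        (-(Q.symm : Y' →L[ℂ] Y)) ∘L ((Q : Y →L[ℂ] Y') ∘L N - N' ∘L (Q : Y →L[ℂ] Y')) ∘L
          (Q.symm : Y' →L[ℂ] Y) := by
      ext x
      simp
      abel
    rw [e]
    exact isCompactOperator_comp h.right _ _

theorem exists_left (h : Intertwined P Q c T T' M M' N N') {L : Y →L[ℂ] X}
    (hL : IsCompactOperator (L ∘L T - M)) :
    ∃ L' : Y' →L[ℂ] X', IsCompactOperator (L' ∘L T' - M') := by
  -- `L₁ = c P L Q⁻¹`.
  refine ⟨c • ((P : X →L[ℂ] X') ∘L L ∘L (Q.symm : Y' →L[ℂ] Y)), ?_⟩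
  have e : (c • ((P : X →L[ℂ] X') ∘L L ∘L (Q.symm : Y' →L[ℂ] Y))) ∘L T' - M' =
      (P : X →L[ℂ] X') ∘L (L ∘L T - M) ∘L (P.symm : X' →L[ℂ] X) +
      ((P : X →L[ℂ] X') ∘L M - M' ∘L (P : X →L[ℂ] X')) ∘L (P.symm : X' →L[ℂ] X) -
      ((P : X →L[ℂ] X') ∘L L ∘L (Q.symm : Y' →L[ℂ] Y)) ∘L
        ((Q : Y →L[ℂ] Y') ∘L T - c • (T' ∘L (P : X →L[ℂ] X'))) ∘L (P.symm : X' →L[ℂ] X) := by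
    ext x
    simp
  rw [e]
  exact isCompactOperator_sub (isCompactOperator_add (isCompactOperator_comp hL _ _)
    (isCompactOperator_comp_right h.left _)) (isCompactOperator_comp h.op _ _)

theorem exists_right (h : Intertwined P Q c T T' M M' N N') {R : Y →L[ℂ] X}
    (hR : IsCompactOperator (T ∘L R - N)) :
    ∃ R' : Y' →L[ℂ] X', IsCompactOperator (T' ∘L R' - N') := by
  -- `R₁ = c P R Q⁻¹`.
  refine ⟨c • ((P : X →L[ℂ] X') ∘L R ∘L (Q.symm : Y' →L[ℂ] Y)), ?_⟩
  have e : T' ∘L (c • ((P : X →L[ℂ] X') ∘L R ∘L (Q.symm : Y' →L[ℂ] Y))) - N' =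
      (Q : Y →L[ℂ] Y') ∘L (T ∘L R - N) ∘L (Q.symm : Y' →L[ℂ] Y) +
      ((Q : Y →L[ℂ] Y') ∘L N - N' ∘L (Q : Y →L[ℂ] Y')) ∘L (Q.symm : Y' →L[ℂ] Y) -
      ((Q : Y →L[ℂ] Y') ∘L T - c • (T' ∘L (P : X →L[ℂ] X'))) ∘L (R ∘L (Q.symm : Y' →L[ℂ] Y)) := by
    ext x
    simp
  rw [e]
  exact isCompactOperator_sub (isCompactOperator_add (isCompactOperator_comp hR _ _)
    (isCompactOperator_comp_right h.right _)) (isCompactOperator_comp_right h.op _)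

end Intertwined

end Transfer

/-! ### Operators on the spaces over half-lines -/

theorem isClosed_vanishingOn (hp : p ≠ ⊤) (σ : ℝ) (U : Set ℝ) :
    IsClosed (Besov.vanishingOn σ p U : Set (Besov σ p)) := by
  have e : (Besov.vanishingOn σ p U : Set (Besov σ p)) =
      ⋂ (θ : 𝓢(ℝ, ℂ)) (_ : tsupport θ ⊆ U), {f | Besov.dist f θ = 0} := by
    ext f
    simp only [mem_iInter]
    rfl
  rw [e]
  exact isClosed_iInter fun θ => isClosed_iInter fun _ =>
    isClosed_eq (continuous_dist_apply hp σ θ) continuous_const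

theorem t2Space_besovOn (hp : p ≠ ⊤) (σ : ℝ) (I : Set ℝ) : T2Space (BesovOn σ p I) := by
  have : IsClosed (Besov.vanishingOn σ p I : Set (Besov σ p)) := isClosed_vanishingOn hp σ I
  have : T3Space (BesovOn σ p I) := inferInstance
  infer_instance

/-- The inclusion of the supported elements. -/
def incl (σ : ℝ) (p : ℝ≥0∞) [Fact (1 ≤ p)] (I : Set ℝ) : BesovTilde σ p I →L[ℂ] Besov σ p :=
  (Besov.vanishingOn σ p (closure I)ᶜ).subtypeL

/-- The restriction as a continuous linear map. -/
def restr (σ : ℝ) (p : ℝ≥0∞) [Fact (1 ≤ p)] (I : Set ℝ) : Besov σ p →L[ℂ] BesovOn σ p I :=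
  (Besov.vanishingOn σ p I).mkQL

theorem restrict_surjective (I : Set ℝ) (y : BesovOn σ p I) : ∃ f : Besov σ p, f.restrict I = y :=
  Submodule.Quotient.mk_surjective _ y

theorem restrict_eq_iff {I : Set ℝ} {f g : Besov σ p} :
    f.restrict I = g.restrict I ↔ Distribution.IsVanishingOn (Besov.dist (f - g)) I :=
  Submodule.Quotient.eq _

theorem restrict_eq_of_agreesOn {I : Set ℝ} {f g : Besov σ p} {F : ℝ → ℂ}
    (hf : AgreesOn I (Besov.dist f) F) (hg : AgreesOn I (Besov.dist g) F) :
    f.restrict I = g.restrict I := by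
  rw [restrict_eq_iff]
  refine isVanishingOn_of_compactSupport fun θ h1 h2 => ?_
  rw [map_sub Besov.dist]
  change Besov.dist f θ - Besov.dist g θ = 0
  rw [hf θ h1 h2, hg θ h1 h2, sub_self]

/-- An operator that preserves supports, on the spaces of supported elements. -/
def tildeMap (T : Besov σ p →L[ℂ] Besov τ p) (I J : Set ℝ)
    (h : ∀ f, Distribution.IsVanishingOn (Besov.dist f) (closure I)ᶜ →
      Distribution.IsVanishingOn (Besov.dist (T f)) (closure J)ᶜ) :
    BesovTilde σ p I →L[ℂ] BesovTilde τ p J :=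
  (T ∘L incl σ p I).codRestrict _ fun f => h f f.2

theorem isCompactOperator_tildeMap (hp : p ≠ ⊤) {T : Besov σ p →L[ℂ] Besov τ p} {I J : Set ℝ} (h)
    (hT : IsCompactOperator T) : IsCompactOperator (tildeMap T I J h) :=
  (hT.comp_clm (incl σ p I)).codRestrict (fun f => h f f.2) (isClosed_vanishingOn hp τ _)

/-- A local operator, on the spaces of restrictions. -/
def onMap (T : Besov σ p →L[ℂ] Besov τ p) (I J : Set ℝ)
    (h : ∀ f, Distribution.IsVanishingOn (Besov.dist f) I →
      Distribution.IsVanishingOn (Besov.dist (T f)) J) : BesovOn σ p I →L[ℂ] BesovOn τ p J :=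
  (Besov.vanishingOn σ p I).liftQL (restr τ p J ∘L T) fun f hf =>
    (Submodule.Quotient.mk_eq_zero _).mpr (h f hf)

/-- Compactness passes to the quotients because the quotient map is open: it takes a neighbourhood
of zero with relatively compact image to a neighbourhood of zero. -/
theorem isCompactOperator_onMap {T : Besov σ p →L[ℂ] Besov τ p} {I J : Set ℝ} (h)
    (hT : IsCompactOperator T) : IsCompactOperator (onMap T I J h) := by
  obtain ⟨K, hK, h1⟩ := hT.clm_comp (restr τ p J)
  refine ⟨K, hK, ?_⟩
  have hopen := (Besov.vanishingOn σ p I).isOpenQuotientMap_mkQL.isOpenMap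
  have h2 := hopen.image_mem_nhds h1
  rw [map_zero] at h2
  refine mem_of_superset h2 ?_
  rintro _ ⟨f, hf, rfl⟩
  exact hf


/-! ### Cut-offs of half-line systems -/

/-- Multiplication by a Schwartz function on the Besov space. -/
def mulB (hp : p ≠ ⊤) (σ : ℝ) (g : 𝓢(ℝ, ℂ)) : Besov σ p →L[ℂ] Besov σ p :=
  (besovBound_smulD hp σ g).choose_spec.2.clm

@[simp]
theorem dist_mulB (hp : p ≠ ⊤) (g : 𝓢(ℝ, ℂ)) (f : Besov σ p) :
    Besov.dist (mulB hp σ g f) = smulD g (Besov.dist f) :=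
  (besovBound_smulD hp σ g).choose_spec.2.dist_clm f

theorem isVanishingOn_smulD (g : 𝓢(ℝ, ℂ)) {f : 𝓢'(ℝ, ℂ)} {U : Set ℝ}
    (hf : Distribution.IsVanishingOn f U) : Distribution.IsVanishingOn (smulD g f) U :=
  Distribution.TemperedDistribution.IsVanishingOn.smulLeftCLM hf g.hasTemperateGrowth

theorem smulD_smulD (g h : 𝓢(ℝ, ℂ)) (f : 𝓢'(ℝ, ℂ)) :
    smulD g (smulD h f) = smulD (fun x => g x * h x) f :=
  (TemperedDistribution.smulLeftCLM_smulLeftCLM_apply h.hasTemperateGrowth g.hasTemperateGrowth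
    f).trans (congrArg (fun a => smulD a f) (mul_comm (h : ℝ → ℂ) g))

theorem smulD_smulD_of_mul_eq {g h k : 𝓢(ℝ, ℂ)} (hg : ∀ x, g x * h x = k x) (f : 𝓢'(ℝ, ℂ)) :
    smulD g (smulD h f) = smulD k f := by
  rw [smulD_smulD, funext hg]

section System

variable (S : HalfLineSystem) (hp : p ≠ ⊤)

/-- Multiplication by a Schwartz function on the space of unknowns. -/
def cutU (g : 𝓢(ℝ, ℂ)) : S.Unknowns p →L[ℂ] S.Unknowns p :=
  (tildeMap (mulB hp S.σ₁ g) S.I₁ S.I₁ fun f hf => by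
    rw [dist_mulB]; exact isVanishingOn_smulD g hf).prodMap
  (tildeMap (mulB hp S.σ₂ g) S.I₂ S.I₂ fun f hf => by
    rw [dist_mulB]; exact isVanishingOn_smulD g hf)

/-- Multiplication by a Schwartz function on the space of right-hand sides. -/
def cutY (g : 𝓢(ℝ, ℂ)) : S.Data p →L[ℂ] S.Data p :=
  (onMap (mulB hp S.σ₁ g) S.I₁ S.I₁ fun f hf => by
    rw [dist_mulB]; exact isVanishingOn_smulD g hf).prodMap
  (onMap (mulB hp S.σ₂ g) S.I₂ S.I₂ fun f hf => by
    rw [dist_mulB]; exact isVanishingOn_smulD g hf)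

theorem cutU_fst (g : 𝓢(ℝ, ℂ)) (u : S.Unknowns p) :
    ((cutU S hp g u).1 : Besov S.σ₁ p) = mulB hp S.σ₁ g u.1 := rfl

theorem cutU_snd (g : 𝓢(ℝ, ℂ)) (u : S.Unknowns p) :
    ((cutU S hp g u).2 : Besov S.σ₂ p) = mulB hp S.σ₂ g u.2 := rfl

theorem cutY_restrict (g : 𝓢(ℝ, ℂ)) (f₁ : Besov S.σ₁ p) (f₂ : Besov S.σ₂ p) :
    cutY S hp g (f₁.restrict S.I₁, f₂.restrict S.I₂) =
      ((mulB hp S.σ₁ g f₁).restrict S.I₁, (mulB hp S.σ₂ g f₂).restrict S.I₂) := rfl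

theorem isMulUnknowns_cutU (g : 𝓢(ℝ, ℂ)) : S.IsMulUnknowns g (cutU S hp g) := fun u =>
  ⟨by rw [cutU_fst, dist_mulB], by rw [cutU_snd, dist_mulB]⟩

theorem isMulData_cutY (g : 𝓢(ℝ, ℂ)) : S.IsMulData g (cutY S hp g) := fun f₁ f₂ =>
  ⟨mulB hp S.σ₁ g f₁, mulB hp S.σ₂ g f₂, dist_mulB hp g f₁, dist_mulB hp g f₂,
    cutY_restrict S hp g f₁ f₂⟩

variable {S}

theorem unknowns_ext {u v : S.Unknowns p}
    (h1 : Besov.dist (u.1 : Besov S.σ₁ p) = Besov.dist (v.1 : Besov S.σ₁ p))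
    (h2 : Besov.dist (u.2 : Besov S.σ₂ p) = Besov.dist (v.2 : Besov S.σ₂ p)) : u = v :=
  Prod.ext (Subtype.ext (dist_injective h1)) (Subtype.ext (dist_injective h2))

theorem isMulUnknowns_eq {g : 𝓢(ℝ, ℂ)} {M : S.Unknowns p →L[ℂ] S.Unknowns p}
    (hM : S.IsMulUnknowns g M) : M = cutU S hp g :=
  ContinuousLinearMap.ext fun u => unknowns_ext
    ((hM u).1.trans (isMulUnknowns_cutU S hp g u).1.symm)
    ((hM u).2.trans (isMulUnknowns_cutU S hp g u).2.symm)

theorem data_cases (y : S.Data p) : ∃ (f₁ : Besov S.σ₁ p) (f₂ : Besov S.σ₂ p),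
    y = (f₁.restrict S.I₁, f₂.restrict S.I₂) := by
  obtain ⟨f₁, h1⟩ := restrict_surjective S.I₁ y.1
  obtain ⟨f₂, h2⟩ := restrict_surjective S.I₂ y.2
  exact ⟨f₁, f₂, Prod.ext h1.symm h2.symm⟩

theorem isMulData_eq {g : 𝓢(ℝ, ℂ)} {M : S.Data p →L[ℂ] S.Data p} (hM : S.IsMulData g M) :
    M = cutY S hp g := by
  refine ContinuousLinearMap.ext fun y => ?_
  obtain ⟨f₁, f₂, rfl⟩ := data_cases y
  obtain ⟨k₁, k₂, h1, h2, h3⟩ := hM f₁ f₂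
  have e1 : k₁ = mulB hp S.σ₁ g f₁ := dist_injective (by rw [h1, dist_mulB])
  have e2 : k₂ = mulB hp S.σ₂ g f₂ := dist_injective (by rw [h2, dist_mulB])
  rw [h3, e1, e2, cutY_restrict]

theorem cutU_comp {g h k : 𝓢(ℝ, ℂ)} (hg : ∀ x, g x * h x = k x) :
    cutU S hp g ∘L cutU S hp h = cutU S hp k :=
  ContinuousLinearMap.ext fun u => unknowns_ext
    (by rw [ContinuousLinearMap.comp_apply, cutU_fst, cutU_fst, cutU_fst, dist_mulB, dist_mulB,
      dist_mulB, smulD_smulD_of_mul_eq hg])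
    (by rw [ContinuousLinearMap.comp_apply, cutU_snd, cutU_snd, cutU_snd, dist_mulB, dist_mulB,
      dist_mulB, smulD_smulD_of_mul_eq hg])

theorem cutY_comp {g h k : 𝓢(ℝ, ℂ)} (hg : ∀ x, g x * h x = k x) :
    cutY S hp g ∘L cutY S hp h = cutY S hp k := by
  refine ContinuousLinearMap.ext fun y => ?_
  obtain ⟨f₁, f₂, rfl⟩ := data_cases y
  have e1 : mulB hp S.σ₁ g (mulB hp S.σ₁ h f₁) = mulB hp S.σ₁ k f₁ := dist_injective (by
    rw [dist_mulB, dist_mulB, dist_mulB, smulD_smulD_of_mul_eq hg])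
  have e2 : mulB hp S.σ₂ g (mulB hp S.σ₂ h f₂) = mulB hp S.σ₂ k f₂ := dist_injective (by
    rw [dist_mulB, dist_mulB, dist_mulB, smulD_smulD_of_mul_eq hg])
  rw [ContinuousLinearMap.comp_apply, cutY_restrict, cutY_restrict, cutY_restrict, e1, e2]

/-- `I` is one of the two open half-lines that end at the origin. -/
def IsHalfLine (I : Set ℝ) : Prop := I = Ioi 0 ∨ I = Iio 0

theorem compl_closure_Ioi : (closure (Ioi (0 : ℝ)))ᶜ = Iio 0 := by
  rw [closure_Ioi, compl_Ici]

theorem compl_closure_Iio : (closure (Iio (0 : ℝ)))ᶜ = Ioi 0 := by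
  rw [closure_Iio, compl_Iic]

theorem isVanishingOn_of_testSet {U : Set ℝ} {u : Besov σ p} (hu : u ∈ testSet σ p U) :
    Distribution.IsVanishingOn (Besov.dist u) (closure U)ᶜ := by
  obtain ⟨φ, hφ, h⟩ := hu
  refine isVanishingOn_of_compactSupport fun θ h1 h2 => ?_
  rw [h θ h1 (subset_univ _)]
  have e : ∀ t, θ t * φ t = 0 := fun t => by
    by_cases ht : t ∈ tsupport θ
    · rw [image_eq_zero_of_notMem_tsupport fun h3 => h2 ht (subset_closure (hφ.supp h3)), mul_zero]
    · rw [image_eq_zero_of_notMem_tsupport ht, zero_mul]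
  simp only [e, integral_zero]

theorem dense_testSet (hp : p ≠ ⊤) {I : Set ℝ} (hI : IsHalfLine I) (σ : ℝ) :
    Dense {u : BesovTilde σ p I | (u : Besov σ p) ∈ testSet σ p I} := by
  intro u
  rw [closure_subtype]
  have e : ((↑) : BesovTilde σ p I → Besov σ p) '' {u | (u : Besov σ p) ∈ testSet σ p I} =
      testSet σ p I := by
    ext f
    refine ⟨?_, fun hf => ⟨⟨f, isVanishingOn_of_testSet hf⟩, hf, rfl⟩⟩
    rintro ⟨v, hv, rfl⟩
    exact hv
  rw [e]
  have hu : Distribution.IsVanishingOn (Besov.dist (u : Besov σ p)) (closure I)ᶜ := u.2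
  rcases hI with rfl | rfl
  · exact mem_closure_testSet_Ioi hp _ (compl_closure_Ioi ▸ hu)
  · exact mem_closure_testSet_Iio hp _ (compl_closure_Iio ▸ hu)

/-- Operators into the space of right-hand sides are determined by their values on test
functions. -/
theorem clm_eq_of_testSet (hp : p ≠ ⊤) (h1 : IsHalfLine S.I₁) (h2 : IsHalfLine S.I₂)
    {T T' : S.Unknowns p →L[ℂ] S.Data p}
    (h : ∀ u : S.Unknowns p, (u.1 : Besov S.σ₁ p) ∈ testSet S.σ₁ p S.I₁ →
      (u.2 : Besov S.σ₂ p) ∈ testSet S.σ₂ p S.I₂ → T u = T' u) : T = T' := by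
  have := t2Space_besovOn hp S.σ₁ S.I₁
  have := t2Space_besovOn hp S.σ₂ S.I₂
  have hd := (dense_testSet hp h1 S.σ₁).prod (dense_testSet hp h2 S.σ₂)
  exact ContinuousLinearMap.ext fun u => congrFun
    (Continuous.ext_on hd T.continuous T'.continuous fun v hv => h v hv.1 hv.2) u

theorem IsTest.of_isTestFunctionOn {I : Set ℝ} {f : 𝓢'(ℝ, ℂ)} {φ : ℝ → ℂ}
    (h : IsTestFunctionOn I φ) (hf : AgreesOn univ f φ) : IsTest f φ := ⟨h.smooth, h.compact, hf⟩

theorem _root_.IsTestFunctionOn.mul {I : Set ℝ} {φ : ℝ → ℂ} (h : IsTestFunctionOn I φ)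
    (g : 𝓢(ℝ, ℂ)) : IsTestFunctionOn I fun x => g x * φ x :=
  ⟨g.smooth'.mul h.smooth, h.compact.mul_left,
    (closure_mono fun _ hx => right_ne_zero_of_mul hx).trans h.supp⟩

/-- Two localizations of the same system agree as far as their cut-offs allow: `(h A g) g₀` and
`h (h₀ A g₀)` coincide if `g = 1` on the support of `g₀` and `h₀ = 1` on the support of `h`. By
density it suffices to compare them on test functions. -/
theorem localization_comp (h1 : IsHalfLine S.I₁) (h2 : IsHalfLine S.I₂) {h g h₀ g₀ : 𝓢(ℝ, ℂ)}
    {T T₀ : S.Unknowns p →L[ℂ] S.Data p} (hT : S.IsLocalization h g T)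
    (hT₀ : S.IsLocalization h₀ g₀ T₀) (hg : ∀ x, g x * g₀ x = g₀ x) (hh : ∀ x, h₀ x * h x = h x) :
    T ∘L cutU S hp g₀ = cutY S hp h ∘L T₀ := by
  refine clm_eq_of_testSet hp h1 h2 fun u hu1 hu2 => ?_
  obtain ⟨φ, hφ, a1⟩ := hu1
  obtain ⟨ψ, hψ, a2⟩ := hu2
  obtain ⟨y₁, y₂, ey, b1, b2⟩ := hT _ _ (hφ.mul g₀) (hψ.mul g₀) (cutU S hp g₀ u)
    (by rw [cutU_fst, dist_mulB]; exact a1.smulD g₀.hasTemperateGrowth)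
    (by rw [cutU_snd, dist_mulB]; exact a2.smulD g₀.hasTemperateGrowth)
  obtain ⟨z₁, z₂, ez, c1, c2⟩ := hT₀ φ ψ hφ hψ u a1 a2
  rw [ContinuousLinearMap.comp_apply, ContinuousLinearMap.comp_apply, ey, ez, cutY_restrict]
  simp only [← mul_assoc, hg] at b1 b2
  refine Prod.ext (restrict_eq_of_agreesOn b1 ?_) (restrict_eq_of_agreesOn b2 ?_)
  · rw [dist_mulB]
    refine (c1.smulD h.hasTemperateGrowth).congr fun x _ => ?_
    rw [← mul_assoc, mul_comm (h x), hh]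
  · rw [dist_mulB]
    refine (c2.smulD h.hasTemperateGrowth).congr fun x _ => ?_
    rw [← mul_assoc, mul_comm (h x), hh]

/-- Even cut-offs at the origin, as Schwartz functions. -/
structure IsEvenCutoff (g : 𝓢(ℝ, ℂ)) : Prop where
  cutoff : IsCutoffAtZero g
  even : ∀ x, g (-x) = g x

theorem exists_evenCutoff_le {g : 𝓢(ℝ, ℂ)} (hg : IsCutoffAtZero g) :
    ∃ g₀ : 𝓢(ℝ, ℂ), IsEvenCutoff g₀ ∧ ∀ x, g x * g₀ x = g₀ x := by
  obtain ⟨δ, hδ, h⟩ := Metric.eventually_nhds_iff.mp hg.eq_one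
  obtain ⟨χ, h1, h2, h3, h4⟩ := exists_even_cutoff_within (half_pos hδ) (half_lt_self hδ)
  refine ⟨χ, ⟨⟨χ.smooth', h1, ?_⟩, h4⟩, fun x => ?_⟩
  · refine Metric.eventually_nhds_iff.mpr ⟨δ / 2, half_pos hδ, fun x hx => h2 x ?_⟩
    rw [Real.dist_0_eq_abs] at hx
    exact hx.le
  · by_cases hx : δ ≤ |x|
    · rw [h3 x hx, mul_zero]
    · rw [h (by rw [Real.dist_0_eq_abs]; exact not_le.mp hx), one_mul]

theorem exists_evenCutoff_ge {h : 𝓢(ℝ, ℂ)} (hh : IsCutoffAtZero h) :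
    ∃ h₀ : 𝓢(ℝ, ℂ), IsEvenCutoff h₀ ∧ ∀ x, h₀ x * h x = h x := by
  obtain ⟨χ, h1, h2, h3⟩ := exists_cutoff_on hh.compact.isCompact
  refine ⟨χ, ⟨⟨χ.smooth', h1, ?_⟩, h3⟩, fun x => ?_⟩
  · filter_upwards [hh.eq_one] with x hx
    exact h2 x (subset_tsupport _ (by rw [Function.mem_support, hx]; exact one_ne_zero))
  · by_cases hx : h x = 0
    · rw [hx, mul_zero]
    · rw [h2 x (subset_tsupport _ hx), one_mul]

theorem _root_.IsCutoffAtZero.exists_schwartz {g : ℝ → ℂ} (hg : IsCutoffAtZero g) :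
    ∃ G : 𝓢(ℝ, ℂ), (G : ℝ → ℂ) = g := ⟨hg.compact.toSchwartzMap hg.smooth, rfl⟩

/-- A left local inverse provides left local inverses for suitable even cut-offs. A smaller `g₀` and
a larger `h₀` are chosen so that `localization_comp` applies. -/
theorem exists_left_of_hasLeftLocalInverse (h1 : IsHalfLine S.I₁) (h2 : IsHalfLine S.I₂)
    (h : S.HasLeftLocalInverse p) : ∃ g₀ h₀ : 𝓢(ℝ, ℂ), IsEvenCutoff g₀ ∧ IsEvenCutoff h₀ ∧
      ∀ T₀ : S.Unknowns p →L[ℂ] S.Data p, S.IsLocalization h₀ g₀ T₀ →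
        ∃ L : S.Data p →L[ℂ] S.Unknowns p, IsCompactOperator (L ∘L T₀ - cutU S hp g₀) := by
  obtain ⟨g, k, hg, hk, T, hT, M, hM, L, hL⟩ := h
  obtain ⟨g, rfl⟩ := hg.exists_schwartz
  obtain ⟨k, rfl⟩ := hk.exists_schwartz
  obtain ⟨g₀, hg₀, e1⟩ := exists_evenCutoff_le hg
  obtain ⟨k₀, hk₀, e2⟩ := exists_evenCutoff_ge hk
  refine ⟨g₀, k₀, hg₀, hk₀, fun T₀ hT₀ => ⟨L ∘L cutY S hp k, ?_⟩⟩
  have e3 := localization_comp hp h1 h2 hT hT₀ e1 e2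
  have e4 : (L ∘L cutY S hp k) ∘L T₀ - cutU S hp g₀ = (L ∘L T - M) ∘L cutU S hp g₀ := by
    rw [isMulUnknowns_eq hp hM, ContinuousLinearMap.sub_comp, cutU_comp hp e1,
      ContinuousLinearMap.comp_assoc, ContinuousLinearMap.comp_assoc, e3]
  rw [e4]
  exact isCompactOperator_comp_right hL _

/-- A right local inverse provides right local inverses for suitable even cut-offs. -/
theorem exists_right_of_hasRightLocalInverse (h1 : IsHalfLine S.I₁) (h2 : IsHalfLine S.I₂)
    (h : S.HasRightLocalInverse p) : ∃ g₀ h₀ : 𝓢(ℝ, ℂ), IsEvenCutoff g₀ ∧ IsEvenCutoff h₀ ∧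
      ∀ T₀ : S.Unknowns p →L[ℂ] S.Data p, S.IsLocalization g₀ h₀ T₀ →
        ∃ R : S.Data p →L[ℂ] S.Unknowns p, IsCompactOperator (T₀ ∘L R - cutY S hp g₀) := by
  obtain ⟨g, k, hg, hk, T, hT, M, hM, R, hR⟩ := h
  obtain ⟨g, rfl⟩ := hg.exists_schwartz
  obtain ⟨k, rfl⟩ := hk.exists_schwartz
  obtain ⟨g₀, hg₀, e1⟩ := exists_evenCutoff_le hg
  obtain ⟨k₀, hk₀, e2⟩ := exists_evenCutoff_ge hk
  refine ⟨g₀, k₀, hg₀, hk₀, fun T₀ hT₀ => ⟨cutU S hp k ∘L R, ?_⟩⟩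
  have e3 := localization_comp hp h1 h2 hT₀ hT e2 e1
  have e5 : ∀ x, g₀ x * g x = g₀ x := fun x => by rw [mul_comm, e1]
  have e4 : T₀ ∘L (cutU S hp k ∘L R) - cutY S hp g₀ = cutY S hp g₀ ∘L (T ∘L R - M) := by
    rw [isMulData_eq hp hM, ContinuousLinearMap.comp_sub, cutY_comp hp e5,
      ← ContinuousLinearMap.comp_assoc, ← ContinuousLinearMap.comp_assoc, e3]
  rw [e4]
  exact isCompactOperator_comp_left hR _

end System


/-! ### The two systems as operators on distributions -/

theorem fourier_logKernel_neg {χ : 𝓢(ℝ, ℂ)} (hχ : ∀ x, χ (-x) = χ x) (ξ : ℝ) :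
    𝓕 (logKernel χ) (-ξ) = 𝓕 (logKernel χ) ξ := by
  rw [← Real.fourierInv_eq_fourier_neg, Real.fourierInv_eq_fourier_comp_neg,
    funext (logKernel_neg hχ)]

theorem refl_logPot {χ : 𝓢(ℝ, ℂ)} (hc : HasCompactSupport χ) (hχ : ∀ x, χ (-x) = χ x)
    (f : 𝓢'(ℝ, ℂ)) : refl (logPot χ f) = logPot χ (refl f) := by
  rw [logPot, refl_mult (isMomentKernel_logKernel hc).temperate, funext (fourier_logKernel_neg hχ)]

theorem D_logPot {χ : 𝓢(ℝ, ℂ)} (hc : HasCompactSupport χ) (f : 𝓢'(ℝ, ℂ)) :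
    D (logPot χ f) = logPot χ (D f) :=
  D_mult (isMomentKernel_logKernel hc).temperate f

theorem refl_smulD_of_even {g : 𝓢(ℝ, ℂ)} (hg : ∀ x, g (-x) = g x) (f : 𝓢'(ℝ, ℂ)) :
    refl (smulD g f) = smulD g (refl f) := by
  rw [smulD, refl_smulLeft g.hasTemperateGrowth, funext hg]

/-- The localized first equation of the mixed system, `h (½ g φ + V (g ψ))`. -/
def mixedRow₁ (χ h g : 𝓢(ℝ, ℂ)) (φ ψ : 𝓢'(ℝ, ℂ)) : 𝓢'(ℝ, ℂ) :=
  smulD h ((1 / 2 : ℂ) • smulD g φ + logPot χ (smulD g ψ))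

/-- The localized second equation of the mixed system, `h (½ g ψ - ∂∂V (g φ))`. -/
def mixedRow₂ (χ h g : 𝓢(ℝ, ℂ)) (φ ψ : 𝓢'(ℝ, ℂ)) : 𝓢'(ℝ, ℂ) :=
  smulD h ((1 / 2 : ℂ) • smulD g ψ + (-1 : ℂ) • D (D (logPot χ (smulD g φ))))

/-- A localized equation of the Mellin system, `h (g u + 2∂VJ (g v))`. -/
def mellinRow (χ h g : 𝓢(ℝ, ℂ)) (u v : 𝓢'(ℝ, ℂ)) : 𝓢'(ℝ, ℂ) :=
  smulD h (smulD g u + (2 : ℂ) • D (logPot χ (refl (smulD g v))))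

/-- The cut-off `χ` truncates the logarithm away from all differences of points in the supports of
`h` and `g`. -/
structure Truncates (χ h g : 𝓢(ℝ, ℂ)) (R : ℝ) : Prop where
  compact : HasCompactSupport χ
  even : ∀ x, χ (-x) = χ x
  eq_one : ∀ x, |x| ≤ 2 * R → χ x = 1
  outer : ∀ x, h x ≠ 0 → |x| ≤ R
  inner : ∀ x ∈ tsupport g, |x| ≤ R

theorem exists_truncates {h g : 𝓢(ℝ, ℂ)} (hh : HasCompactSupport h) (hg : HasCompactSupport g) :
    ∃ χ R, Truncates χ h g R := by
  obtain ⟨R₁, h1, h2⟩ := hh.isCompact.isBounded.exists_pos_norm_le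
  obtain ⟨R₂, h3, h4⟩ := hg.isCompact.isBounded.exists_pos_norm_le
  obtain ⟨χ, h5, h6, h7⟩ := exists_even_cutoff (R := 2 * max R₁ R₂)
    (mul_pos two_pos (lt_max_of_lt_left h1))
  exact ⟨χ, max R₁ R₂, h5, h7, h6,
    fun x hx => (h2 x (subset_tsupport _ hx)).trans (le_max_left _ _),
    fun x hx => (h4 x hx).trans (le_max_right _ _)⟩

section Agreement

variable {χ h g : 𝓢(ℝ, ℂ)} {R : ℝ} {f₁ f₂ : 𝓢'(ℝ, ℂ)} {φ ψ : ℝ → ℂ}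

theorem Truncates.inner_of_tsupport (hχ : Truncates χ h g R) {x : ℝ}
    (hx : x ∈ tsupport fun y => g y * φ y) : |x| ≤ R :=
  hχ.inner x (closure_mono (fun _ hy => left_ne_zero_of_mul hy) hx)

theorem agreesOn_mixedRow₁ (hχ : Truncates χ h g R) (hφ : IsTest f₁ φ) (hψ : IsTest f₂ ψ) :
    AgreesOn (Ioi 0) (mixedRow₁ χ h g f₁ f₂) fun t => h t *
      (1 / 2 * (g t * φ t) - doubleLayer (fun τ => g τ * φ τ) t +
        singleLayer (fun τ => g τ * ψ τ) t) := by
  obtain ⟨a1, a2⟩ := (hψ.smulD g).logPot hχ.compact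
  have b := (((hφ.smulD g).agrees.const_smul (1 / 2)).add a1
    (continuous_const.mul (hφ.smulD g).smooth.continuous) a2).smulD h.hasTemperateGrowth
  refine (b.congr fun t _ => ?_).mono (subset_univ _)
  by_cases ht : h t = 0
  · rw [ht, zero_mul, zero_mul]
  · rw [potential_eq_singleLayer hχ.eq_one (fun x hx => hχ.inner_of_tsupport (subset_tsupport _ hx))
      (hχ.outer t ht), doubleLayer_eq_zero, sub_zero]

theorem agreesOn_mixedRow₂ (hχ : Truncates χ h g R) (hφ : IsTest f₁ φ) (hψ : IsTest f₂ ψ)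
    (hφ0 : tsupport φ ⊆ Ioi 0) :
    AgreesOn (Iio 0) (mixedRow₂ χ h g f₁ f₂) fun t => h t *
      (1 / 2 * (g t * ψ t) + adjointDoubleLayer (fun τ => g τ * ψ τ) t -
        hypersingular (fun τ => g τ * φ τ) t) := by
  -- Convolution commutes with `∂`, and `∂∂(g φ)` is again a test function.
  have hw := hφ.smulD g
  obtain ⟨a1, a2⟩ := hw.deriv.deriv.logPot hχ.compact
  rw [← D_logPot hχ.compact, ← D_logPot hχ.compact] at a1
  have b := (((hψ.smulD g).agrees.const_smul (1 / 2)).add (a1.const_smul (-1))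
    (continuous_const.mul (hψ.smulD g).smooth.continuous)
    (continuous_const.mul a2)).smulD h.hasTemperateGrowth
  refine (b.mono (subset_univ _)).congr fun t ht0 => ?_
  by_cases ht : h t = 0
  · rw [ht, zero_mul, zero_mul]
  · have h1 : t ∉ tsupport fun y => g y * φ y := fun h2 =>
      lt_asymm (show t < 0 from ht0)
        (show 0 < t from hφ0 (closure_mono (fun _ hy => right_ne_zero_of_mul hy) h2))
    rw [potential_eq_singleLayer hχ.eq_one (fun x hx => hχ.inner_of_tsupport
      (tsupport_deriv_subset (tsupport_deriv_subset (subset_tsupport _ hx)))) (hχ.outer t ht),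
      adjointDoubleLayer_eq_zero, hypersingular_eq hw.smooth hw.compact h1, add_zero]
    ring

theorem agreesOn_mellinRow (hχ : Truncates χ h g R) (hφ : IsTest f₁ φ) (hψ : IsTest f₂ ψ)
    (hψ0 : IsTestFunctionOn (Ioi 0) ψ) :
    AgreesOn (Ioi 0) (mellinRow χ h g f₁ f₂) fun t => h t *
      (g t * φ t + mellinOp (fun τ => g τ * ψ τ) t) := by
  have hw := hψ.smulD g
  obtain ⟨a1, a2⟩ := hw.refl.deriv.logPot hχ.compact
  rw [← D_logPot hχ.compact] at a1
  have b := ((hφ.smulD g).agrees.add (a1.const_smul 2)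
    (hφ.smulD g).smooth.continuous
    (continuous_const.mul a2)).smulD h.hasTemperateGrowth
  refine (b.mono (subset_univ _)).congr fun t ht0 => ?_
  by_cases ht : h t = 0
  · rw [ht, zero_mul, zero_mul]
  · rw [potential_eq_singleLayer hχ.eq_one (fun x hx => ?_) (hχ.outer t ht),
      mellinOp_eq (hψ0.mul g) ht0]
    have h1 : -x ∈ tsupport fun y => g y * ψ y :=
      tsupport_comp_subset_preimage (fun y => g y * ψ y) continuous_neg
        (tsupport_deriv_subset (subset_tsupport _ hx))
    rw [← abs_neg]
    exact hχ.inner_of_tsupport h1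

end Agreement

/-- The operator `∂ - 1` takes the first mixed equation to half of the first Mellin equation, up to
terms in which derivatives fall on the cut-offs or are missing. -/
theorem mixedRow₁_sub_mellinRow {χ h g : 𝓢(ℝ, ℂ)} (hg : ∀ x, g (-x) = g x) (φ ψ : 𝓢'(ℝ, ℂ)) :
    D (mixedRow₁ χ h g φ ψ) - mixedRow₁ χ h g φ ψ -
        (1 / 2 : ℂ) • mellinRow χ h g (D φ + φ) (refl ψ) =
      smulD (SchwartzMap.derivCLM ℂ ℂ h) ((1 / 2 : ℂ) • smulD g φ + logPot χ (smulD g ψ)) +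
      smulD h ((1 / 2 : ℂ) • smulD (SchwartzMap.derivCLM ℂ ℂ g) φ - smulD g φ -
        logPot χ (smulD g ψ)) := by
  rw [mellinRow, ← refl_smulD_of_even hg, refl_refl, mixedRow₁, D_smulD]
  rw [map_add D, map_smul D, D_smulD]
  simp only [map_add, map_sub, map_smul]
  module

/-- Reflection takes the second mixed equation to half of the second Mellin equation, up to terms
of lower order. -/
theorem mixedRow₂_sub_mellinRow {χ h g : 𝓢(ℝ, ℂ)} (hc : HasCompactSupport χ)
    (hχ : ∀ x, χ (-x) = χ x) (hh : ∀ x, h (-x) = h x) (hg : ∀ x, g (-x) = g x) (φ ψ : 𝓢'(ℝ, ℂ)) :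
    refl (mixedRow₂ χ h g φ ψ) - (1 / 2 : ℂ) • mellinRow χ h g (refl ψ) (D φ + φ) =
      smulD h (D (logPot χ (refl (smulD (SchwartzMap.derivCLM ℂ ℂ g) φ - smulD g φ)))) := by
  have e : smulD g (D φ + φ) =
      D (smulD g φ) - (smulD (SchwartzMap.derivCLM ℂ ℂ g) φ - smulD g φ) := by
    rw [D_smulD, map_add]
    abel
  rw [mellinRow, e, mixedRow₂, refl_smulD_of_even hh, map_add refl, map_smul refl, map_smul refl,
    refl_smulD_of_even hg, refl_D, refl_D, map_neg D, neg_neg, refl_logPot hc hχ,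
    map_sub refl (D _), refl_D, map_sub (logPot χ),
    map_neg (logPot χ), ← D_logPot hc, map_sub D, map_neg D]
  simp only [map_add, map_sub, map_smul, map_neg]
  module


/-! ### The intertwining isomorphisms -/

theorem exists_derivEquiv (hp : p ≠ ⊤) (h : ρ = τ + 1) : ∃ E : Besov ρ p ≃L[ℂ] Besov τ p,
    (∀ f, Besov.dist (E f) = D (Besov.dist f) + Besov.dist f) ∧
      ∀ f, Besov.dist (E.symm f) = resolvent (Besov.dist f) := by
  subst h
  exact ⟨derivEquiv hp τ, dist_derivEquiv hp, dist_derivEquiv_symm hp⟩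

/-- Reflection as an isomorphism. -/
def reflEquiv (σ : ℝ) : Besov σ p ≃L[ℂ] Besov σ p :=
  ContinuousLinearEquiv.equivOfInverse (reflB σ) (reflB σ) reflB_reflB reflB_reflB

theorem dist_reflEquiv (f : Besov σ p) : Besov.dist (reflEquiv σ f) = refl (Besov.dist f) :=
  dist_reflB f

theorem reflEquiv_symm : (reflEquiv σ : Besov σ p ≃L[ℂ] Besov σ p).symm = reflEquiv σ := rfl

/-- The operator `∂ - 1` is an isomorphism; its inverse is obtained from the causal resolvent by
reflection. -/
theorem exists_derivSubEquiv (hp : p ≠ ⊤) (h : ρ = τ + 1) : ∃ F : Besov ρ p ≃L[ℂ] Besov τ p,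
    (∀ f, Besov.dist (F f) = D (Besov.dist f) - Besov.dist f) ∧
      ∀ f, Besov.dist (F.symm f) = -refl (resolvent (refl (Besov.dist f))) := by
  obtain ⟨E, h1, h2⟩ := exists_derivEquiv hp h
  refine ⟨((reflEquiv ρ).trans (E.trans (reflEquiv τ))).trans (ContinuousLinearEquiv.neg ℂ),
    fun f => ?_, fun f => ?_⟩
  · change Besov.dist (-(reflEquiv τ (E (reflEquiv ρ f)))) = _
    rw [map_neg Besov.dist, dist_reflEquiv, h1, dist_reflEquiv, map_add refl, refl_D, refl_refl]
    abel
  · change Besov.dist (reflEquiv ρ (E.symm (reflEquiv τ (-f)))) = _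
    rw [dist_reflEquiv, h2, dist_reflEquiv, map_neg Besov.dist, map_neg refl, map_neg resolvent,
      map_neg refl]

/-- Isomorphisms that preserve supports in both directions, on spaces of supported elements. -/
def tildeEquiv (E : Besov σ p ≃L[ℂ] Besov τ p) (I J : Set ℝ)
    (h : ∀ f, Distribution.IsVanishingOn (Besov.dist f) (closure I)ᶜ →
      Distribution.IsVanishingOn (Besov.dist (E f)) (closure J)ᶜ)
    (h' : ∀ f, Distribution.IsVanishingOn (Besov.dist f) (closure J)ᶜ →
      Distribution.IsVanishingOn (Besov.dist (E.symm f)) (closure I)ᶜ) :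
    BesovTilde σ p I ≃L[ℂ] BesovTilde τ p J :=
  ContinuousLinearEquiv.equivOfInverse (tildeMap (E : Besov σ p →L[ℂ] Besov τ p) I J h)
    (tildeMap (E.symm : Besov τ p →L[ℂ] Besov σ p) J I h')
    (fun f => Subtype.ext (E.symm_apply_apply f)) (fun f => Subtype.ext (E.apply_symm_apply f))

/-- Isomorphisms that are local in both directions, on spaces of restrictions. -/
def onEquiv (E : Besov σ p ≃L[ℂ] Besov τ p) (I J : Set ℝ)
    (h : ∀ f, Distribution.IsVanishingOn (Besov.dist f) I →
      Distribution.IsVanishingOn (Besov.dist (E f)) J)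
    (h' : ∀ f, Distribution.IsVanishingOn (Besov.dist f) J →
      Distribution.IsVanishingOn (Besov.dist (E.symm f)) I) :
    BesovOn σ p I ≃L[ℂ] BesovOn τ p J :=
  ContinuousLinearEquiv.equivOfInverse (onMap (E : Besov σ p →L[ℂ] Besov τ p) I J h)
    (onMap (E.symm : Besov τ p →L[ℂ] Besov σ p) J I h')
    (fun y => by
      obtain ⟨f, rfl⟩ := restrict_surjective I y
      exact congrArg (Besov.restrict I) (E.symm_apply_apply f))
    (fun y => by
      obtain ⟨f, rfl⟩ := restrict_surjective J y
      exact congrArg (Besov.restrict J) (E.apply_symm_apply f))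

theorem isVanishingOn_add {f g : 𝓢'(ℝ, ℂ)} {U : Set ℝ} (hf : Distribution.IsVanishingOn f U)
    (hg : Distribution.IsVanishingOn g U) : Distribution.IsVanishingOn (f + g) U := fun θ hθ => by
  change f θ + g θ = 0
  rw [hf θ hθ, hg θ hθ, add_zero]

theorem isVanishingOn_neg {f : 𝓢'(ℝ, ℂ)} {U : Set ℝ} (hf : Distribution.IsVanishingOn f U) :
    Distribution.IsVanishingOn (-f) U := fun θ hθ => by
  change -f θ = 0
  rw [hf θ hθ, neg_zero]

theorem isVanishingOn_refl_Iio {f : 𝓢'(ℝ, ℂ)} (hf : Distribution.IsVanishingOn f (Iio 0)) :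
    Distribution.IsVanishingOn (refl f) (Ioi 0) :=
  isVanishingOn_refl hf fun x hx => by simpa using hx

theorem isVanishingOn_refl_Ioi {f : 𝓢'(ℝ, ℂ)} (hf : Distribution.IsVanishingOn f (Ioi 0)) :
    Distribution.IsVanishingOn (refl f) (Iio 0) :=
  isVanishingOn_refl hf fun x hx => by simpa using hx

/-- The isomorphism `(φ, ψ) ↦ (∂φ + φ, Jψ)` between the spaces of unknowns. -/
theorem exists_unknownsEquiv (hp : p ≠ ⊤) (ρ : ℝ) :
    ∃ P : (mixedSystem ρ).Unknowns p ≃L[ℂ] (mellinSystem ρ).Unknowns p, ∀ u,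
      Besov.dist ((P u).1 : Besov (mellinSystem ρ).σ₁ p) =
        D (Besov.dist (u.1 : Besov (mixedSystem ρ).σ₁ p)) +
          Besov.dist (u.1 : Besov (mixedSystem ρ).σ₁ p) ∧
      Besov.dist ((P u).2 : Besov (mellinSystem ρ).σ₂ p) =
        refl (Besov.dist (u.2 : Besov (mixedSystem ρ).σ₂ p)) := by
  obtain ⟨E, h1, h2⟩ := exists_derivEquiv (p := p) hp (show ρ = ρ - 1 + 1 by ring)
  let P₁ : BesovTilde ρ p (Ioi 0) ≃L[ℂ] BesovTilde (ρ - 1) p (Ioi 0) :=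
    tildeEquiv E (Ioi 0) (Ioi 0) (fun f hf => by
      rw [h1]; exact isVanishingOn_add (isVanishingOn_D hf) hf) (fun f hf => by
      rw [compl_closure_Ioi] at hf ⊢
      rw [h2]; exact isVanishingOn_resolvent hf)
  let P₂ : BesovTilde (ρ - 1) p (Iio 0) ≃L[ℂ] BesovTilde (ρ - 1) p (Ioi 0) :=
    tildeEquiv (reflEquiv (ρ - 1)) (Iio 0) (Ioi 0) (fun f hf => by
      rw [compl_closure_Iio] at hf
      rw [compl_closure_Ioi, dist_reflEquiv]; exact isVanishingOn_refl_Ioi hf) (fun f hf => by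
      rw [compl_closure_Ioi] at hf
      rw [compl_closure_Iio, reflEquiv_symm, dist_reflEquiv]; exact isVanishingOn_refl_Iio hf)
  exact ⟨P₁.prodCongr P₂, fun u => ⟨h1 _, dist_reflEquiv _⟩⟩

/-- The isomorphism `(G, H) ↦ (∂G - G, JH)` between the spaces of right-hand sides. -/
theorem exists_dataEquiv (hp : p ≠ ⊤) (ρ : ℝ) :
    ∃ (F : Besov ρ p ≃L[ℂ] Besov (ρ - 1) p)
      (Q : (mixedSystem ρ).Data p ≃L[ℂ] (mellinSystem ρ).Data p),
      (∀ f, Besov.dist (F f) = D (Besov.dist f) - Besov.dist f) ∧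
      ∀ (f₁ : Besov ρ p) (f₂ : Besov (ρ - 1) p), Q (f₁.restrict (Ioi 0), f₂.restrict (Iio 0)) =
        ((F f₁).restrict (Ioi 0), (reflB (ρ - 1) f₂).restrict (Ioi 0)) := by
  obtain ⟨F, h1, h2⟩ := exists_derivSubEquiv (p := p) hp (show ρ = ρ - 1 + 1 by ring)
  let Q₁ : BesovOn ρ p (Ioi 0) ≃L[ℂ] BesovOn (ρ - 1) p (Ioi 0) :=
    onEquiv F (Ioi 0) (Ioi 0) (fun f hf => by
      rw [h1, sub_eq_add_neg]
      exact isVanishingOn_add (isVanishingOn_D hf) (isVanishingOn_neg hf)) (fun f hf => by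
      rw [h2]
      exact isVanishingOn_neg (isVanishingOn_refl_Iio (isVanishingOn_resolvent
        (isVanishingOn_refl_Ioi hf))))
  let Q₂ : BesovOn (ρ - 1) p (Iio 0) ≃L[ℂ] BesovOn (ρ - 1) p (Ioi 0) :=
    onEquiv (reflEquiv (ρ - 1)) (Iio 0) (Ioi 0) (fun f hf => by
      rw [dist_reflEquiv]; exact isVanishingOn_refl_Iio hf) (fun f hf => by
      rw [reflEquiv_symm, dist_reflEquiv]; exact isVanishingOn_refl_Ioi hf)
  exact ⟨F, Q₁.prodCongr Q₂, h1, fun f₁ f₂ => rfl⟩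

/-! ### Building blocks of the localized operators -/

theorem exists_logPotB (hp : p ≠ ⊤) {χ : 𝓢(ℝ, ℂ)} (hχ : HasCompactSupport χ) (h : ρ = τ + 1) :
    ∃ V : Besov τ p →L[ℂ] Besov ρ p, ∀ f, Besov.dist (V f) = logPot χ (Besov.dist f) := by
  subst h
  obtain ⟨C, -, hC⟩ := besovBound_zygmund (p := p) hp (isMomentKernel_logKernel hχ)
    (isZygmundKernel_logKernel hχ)
  exact ⟨(hC τ).clm, (hC τ).dist_clm⟩

theorem exists_derivB (hp : p ≠ ⊤) (h : ρ = τ + 1) :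
    ∃ A : Besov ρ p →L[ℂ] Besov τ p, ∀ f, Besov.dist (A f) = D (Besov.dist f) := by
  subst h
  obtain ⟨C, -, hC⟩ := besovBound_D (p := p) hp
  exact ⟨(hC τ).clm, (hC τ).dist_clm⟩

theorem exists_compact_mul (hp : p ≠ ⊤) {c : 𝓢(ℝ, ℂ)} (hc : HasCompactSupport c) (h : ρ = τ + 1) :
    ∃ K : Besov ρ p →L[ℂ] Besov τ p, (∀ f, Besov.dist (K f) = smulD c (Besov.dist f)) ∧
      IsCompactOperator K := by
  subst h
  obtain ⟨C, -, hC⟩ := besovBound_smulD hp (τ + 1) c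
  have hB := (besovBound_embedding (p := p) (show τ ≤ τ + 1 by linarith)).comp hC zero_le_one
  have hK : ∀ f : Besov (τ + 1) p, Besov.dist (hB.clm f) = smulD c (Besov.dist f) := fun f =>
    hB.dist_clm f
  exact ⟨hB.clm, hK, isCompactOperator_of_smulD hp hc _ hK⟩

/-- The operator of a system whose two rows are given on the whole line. -/
def pairOp (σ₁ σ₂ τ₁ τ₂ : ℝ) (p : ℝ≥0∞) [Fact (1 ≤ p)] (I₁ I₂ J₁ J₂ : Set ℝ)
    (A₁ : Besov σ₁ p × Besov σ₂ p →L[ℂ] Besov τ₁ p)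
    (A₂ : Besov σ₁ p × Besov σ₂ p →L[ℂ] Besov τ₂ p) :
    BesovTilde σ₁ p I₁ × BesovTilde σ₂ p I₂ →L[ℂ] BesovOn τ₁ p J₁ × BesovOn τ₂ p J₂ :=
  ((restr τ₁ p J₁ ∘L A₁).prod (restr τ₂ p J₂ ∘L A₂)) ∘L ((incl σ₁ p I₁).prodMap (incl σ₂ p I₂))

theorem isCompactOperator_prod {X Y Z : Type*} [SeminormedAddCommGroup X] [NormedSpace ℂ X]
    [SeminormedAddCommGroup Y] [NormedSpace ℂ Y] [SeminormedAddCommGroup Z] [NormedSpace ℂ Z]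
    {A : X →L[ℂ] Y} {B : X →L[ℂ] Z} (hA : IsCompactOperator A) (hB : IsCompactOperator B) :
    IsCompactOperator (A.prod B) := by
  have e : A.prod B = ContinuousLinearMap.inl ℂ Y Z ∘L A + ContinuousLinearMap.inr ℂ Y Z ∘L B := by
    ext x <;> simp
  rw [e]
  exact isCompactOperator_add (isCompactOperator_comp_left hA _) (isCompactOperator_comp_left hB _)

theorem isCompactOperator_pairOp {σ₁ σ₂ τ₁ τ₂ : ℝ} {I₁ I₂ J₁ J₂ : Set ℝ}
    {A₁ : Besov σ₁ p × Besov σ₂ p →L[ℂ] Besov τ₁ p} {A₂ : Besov σ₁ p × Besov σ₂ p →L[ℂ] Besov τ₂ p}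
    (h1 : IsCompactOperator A₁) (h2 : IsCompactOperator A₂) :
    IsCompactOperator (pairOp σ₁ σ₂ τ₁ τ₂ p I₁ I₂ J₁ J₂ A₁ A₂) :=
  isCompactOperator_comp_right (isCompactOperator_prod (isCompactOperator_comp_left h1 _)
    (isCompactOperator_comp_left h2 _)) _


theorem exists_mixedRow₁ (hp : p ≠ ⊤) {χ : 𝓢(ℝ, ℂ)} (hχ : HasCompactSupport χ) (h g : 𝓢(ℝ, ℂ))
    (e : ρ = τ + 1) : ∃ A : Besov ρ p × Besov τ p →L[ℂ] Besov ρ p, ∀ u,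
      Besov.dist (A u) = mixedRow₁ χ h g (Besov.dist u.1) (Besov.dist u.2) := by
  obtain ⟨V, hV⟩ := exists_logPotB (p := p) hp hχ e
  refine ⟨mulB hp ρ h ∘L (((1 / 2 : ℂ) • mulB hp ρ g).coprod (V ∘L mulB hp τ g)), fun u => ?_⟩
  change Besov.dist (mulB hp ρ h ((1 / 2 : ℂ) • mulB hp ρ g u.1 + V (mulB hp τ g u.2))) = _
  rw [dist_mulB, map_add Besov.dist, map_smul Besov.dist, hV, dist_mulB, dist_mulB, mixedRow₁]

/-- The row `mixedRow₂` as an operator `B^ρ × B^{ρ-1} → B^{ρ-1}`: the logarithmic potential gains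
one derivative, two derivatives are lost. -/
theorem exists_mixedRow₂ (hp : p ≠ ⊤) {χ : 𝓢(ℝ, ℂ)} (hχ : HasCompactSupport χ) (h g : 𝓢(ℝ, ℂ))
    (e : ρ = τ + 1) : ∃ A : Besov ρ p × Besov τ p →L[ℂ] Besov τ p, ∀ u,
      Besov.dist (A u) = mixedRow₂ χ h g (Besov.dist u.1) (Besov.dist u.2) := by
  obtain ⟨V, hV⟩ := exists_logPotB (p := p) hp hχ (rfl : ρ + 1 = ρ + 1)
  obtain ⟨D₁, h1⟩ := exists_derivB (p := p) hp (rfl : ρ + 1 = ρ + 1)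
  obtain ⟨D₂, h2⟩ := exists_derivB (p := p) hp e
  refine ⟨mulB hp τ h ∘L (((-1 : ℂ) • (D₂ ∘L D₁ ∘L V ∘L mulB hp ρ g)).coprod
    ((1 / 2 : ℂ) • mulB hp τ g)), fun u => ?_⟩
  change Besov.dist (mulB hp τ h ((-1 : ℂ) • D₂ (D₁ (V (mulB hp ρ g u.1))) +
    (1 / 2 : ℂ) • mulB hp τ g u.2)) = _
  rw [dist_mulB, map_add Besov.dist, map_smul Besov.dist, map_smul Besov.dist, h2, h1, hV,
    dist_mulB, dist_mulB, mixedRow₂, add_comm]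

theorem exists_mellinRow (hp : p ≠ ⊤) {χ : 𝓢(ℝ, ℂ)} (hχ : HasCompactSupport χ) (h g : 𝓢(ℝ, ℂ))
    (τ : ℝ) : ∃ A : Besov τ p × Besov τ p →L[ℂ] Besov τ p, ∀ u,
      Besov.dist (A u) = mellinRow χ h g (Besov.dist u.1) (Besov.dist u.2) := by
  obtain ⟨V, hV⟩ := exists_logPotB (p := p) hp hχ (rfl : τ + 1 = τ + 1)
  obtain ⟨D₁, h1⟩ := exists_derivB (p := p) hp (rfl : τ + 1 = τ + 1)
  refine ⟨mulB hp τ h ∘L ((mulB hp τ g).coprod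
    ((2 : ℂ) • (D₁ ∘L V ∘L reflB τ ∘L mulB hp τ g))), fun u => ?_⟩
  change Besov.dist (mulB hp τ h (mulB hp τ g u.1 +
    (2 : ℂ) • D₁ (V (reflB τ (mulB hp τ g u.2))))) = _
  rw [dist_mulB, map_add Besov.dist, map_smul Besov.dist, h1, hV, dist_reflB,
    dist_mulB, dist_mulB, mellinRow]

theorem hasCompactSupport_derivCLM {g : 𝓢(ℝ, ℂ)} (hg : HasCompactSupport g) :
    HasCompactSupport (SchwartzMap.derivCLM ℂ ℂ g) := by
  have e : (SchwartzMap.derivCLM ℂ ℂ g : ℝ → ℂ) = deriv g :=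
    funext fun x => SchwartzMap.derivCLM_apply ℂ g x
  rw [e]
  exact hg.deriv

/-- The error terms of `mixedRow₁_sub_mellinRow` form a compact operator. -/
theorem exists_compact_remainder₁ (hp : p ≠ ⊤) {χ h g : 𝓢(ℝ, ℂ)} (hχ : HasCompactSupport χ)
    (hh : HasCompactSupport h) (e : ρ = τ + 1) :
    ∃ K : Besov ρ p × Besov τ p →L[ℂ] Besov τ p, IsCompactOperator K ∧ ∀ u, Besov.dist (K u) =
      smulD (SchwartzMap.derivCLM ℂ ℂ h) ((1 / 2 : ℂ) • smulD g (Besov.dist u.1) +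
        logPot χ (smulD g (Besov.dist u.2))) +
      smulD h ((1 / 2 : ℂ) • smulD (SchwartzMap.derivCLM ℂ ℂ g) (Besov.dist u.1) -
        smulD g (Besov.dist u.1) - logPot χ (smulD g (Besov.dist u.2))) := by
  obtain ⟨V, hV⟩ := exists_logPotB (p := p) hp hχ e
  obtain ⟨K₁, h1, c1⟩ := exists_compact_mul (p := p) hp (hasCompactSupport_derivCLM hh) e
  obtain ⟨K₂, h2, c2⟩ := exists_compact_mul (p := p) hp hh e
  let A₁ : Besov ρ p × Besov τ p →L[ℂ] Besov ρ p :=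
    ((1 / 2 : ℂ) • mulB hp ρ g).coprod (V ∘L mulB hp τ g)
  let A₂ : Besov ρ p × Besov τ p →L[ℂ] Besov ρ p :=
    ((1 / 2 : ℂ) • mulB hp ρ (SchwartzMap.derivCLM ℂ ℂ g) - mulB hp ρ g).coprod
      (-(V ∘L mulB hp τ g))
  refine ⟨K₁ ∘L A₁ + K₂ ∘L A₂, isCompactOperator_add (isCompactOperator_comp_right c1 _)
    (isCompactOperator_comp_right c2 _), fun u => ?_⟩
  change Besov.dist (K₁ ((1 / 2 : ℂ) • mulB hp ρ g u.1 + V (mulB hp τ g u.2)) +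
    K₂ ((1 / 2 : ℂ) • mulB hp ρ (SchwartzMap.derivCLM ℂ ℂ g) u.1 - mulB hp ρ g u.1 +
      -V (mulB hp τ g u.2))) = _
  rw [map_add Besov.dist, h1, h2, map_add Besov.dist, map_add Besov.dist, map_sub Besov.dist,
    map_neg Besov.dist, map_smul Besov.dist, map_smul Besov.dist, hV, dist_mulB, dist_mulB,
    dist_mulB, ← sub_eq_add_neg]

/-- The error terms of `mixedRow₂_sub_mellinRow` form a compact operator. -/
theorem exists_compact_remainder₂ (hp : p ≠ ⊤) {χ h g : 𝓢(ℝ, ℂ)} (hχ : HasCompactSupport χ)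
    (hg : HasCompactSupport g) (e : ρ = τ + 1) :
    ∃ K : Besov ρ p × Besov τ p →L[ℂ] Besov τ p, IsCompactOperator K ∧ ∀ u, Besov.dist (K u) =
      smulD h (D (logPot χ (refl (smulD (SchwartzMap.derivCLM ℂ ℂ g) (Besov.dist u.1) -
        smulD g (Besov.dist u.1))))) := by
  obtain ⟨V, hV⟩ := exists_logPotB (p := p) hp hχ e
  obtain ⟨D₁, hD⟩ := exists_derivB (p := p) hp e
  obtain ⟨K₁, h1, c1⟩ := exists_compact_mul (p := p) hp (hasCompactSupport_derivCLM hg) e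
  obtain ⟨K₂, h2, c2⟩ := exists_compact_mul (p := p) hp hg e
  refine ⟨(mulB hp τ h ∘L D₁ ∘L V ∘L reflB τ) ∘L (K₁ - K₂) ∘L ContinuousLinearMap.fst ℂ _ _,
    isCompactOperator_comp (isCompactOperator_sub c1 c2) _ _, fun u => ?_⟩
  change Besov.dist (mulB hp τ h (D₁ (V (reflB τ (K₁ u.1 - K₂ u.1))))) = _
  rw [dist_mulB, hD, hV, dist_reflB, map_sub Besov.dist, h1, h2]

/-! ### Equivalence of the two systems -/

theorem isHalfLine_Ioi : IsHalfLine (Ioi 0) := Or.inl rfl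

theorem isHalfLine_Iio : IsHalfLine (Iio 0) := Or.inr rfl

theorem isLocalization_mixed {χ h g : 𝓢(ℝ, ℂ)} {R : ℝ} (hχ : Truncates χ h g R)
    {A₁ : Besov ρ p × Besov (ρ - 1) p →L[ℂ] Besov ρ p}
    {A₂ : Besov ρ p × Besov (ρ - 1) p →L[ℂ] Besov (ρ - 1) p}
    (h1 : ∀ u, Besov.dist (A₁ u) = mixedRow₁ χ h g (Besov.dist u.1) (Besov.dist u.2))
    (h2 : ∀ u, Besov.dist (A₂ u) = mixedRow₂ χ h g (Besov.dist u.1) (Besov.dist u.2)) :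
    (mixedSystem ρ).IsLocalization h g
      (pairOp ρ (ρ - 1) ρ (ρ - 1) p (Ioi 0) (Iio 0) (Ioi 0) (Iio 0) A₁ A₂) := by
  intro φ ψ hφ hψ u a1 a2
  have t1 := IsTest.of_isTestFunctionOn hφ a1
  have t2 := IsTest.of_isTestFunctionOn hψ a2
  refine ⟨A₁ (u.1.1, u.2.1), A₂ (u.1.1, u.2.1), rfl, ?_, ?_⟩
  · exact (congrArg (fun f => AgreesOn (Ioi 0) f _) (h1 (u.1.1, u.2.1))).mpr
      (agreesOn_mixedRow₁ hχ t1 t2)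
  · exact (congrArg (fun f => AgreesOn (Iio 0) f _) (h2 (u.1.1, u.2.1))).mpr
      (agreesOn_mixedRow₂ hχ t1 t2 hφ.supp)

/-- The two equations of the Mellin system arise from each other by exchanging the unknowns. -/
theorem isLocalization_mellin {χ h g : 𝓢(ℝ, ℂ)} {R : ℝ} (hχ : Truncates χ h g R)
    {B : Besov (ρ - 1) p × Besov (ρ - 1) p →L[ℂ] Besov (ρ - 1) p}
    (h1 : ∀ u, Besov.dist (B u) = mellinRow χ h g (Besov.dist u.1) (Besov.dist u.2)) :
    (mellinSystem ρ).IsLocalization h g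
      (pairOp (ρ - 1) (ρ - 1) (ρ - 1) (ρ - 1) p (Ioi 0) (Ioi 0) (Ioi 0) (Ioi 0) B
        (B ∘L (ContinuousLinearMap.snd ℂ _ _).prod (ContinuousLinearMap.fst ℂ _ _))) := by
  intro φ ψ hφ hψ u a1 a2
  have t1 := IsTest.of_isTestFunctionOn hφ a1
  have t2 := IsTest.of_isTestFunctionOn hψ a2
  refine ⟨B (u.1.1, u.2.1), B (u.2.1, u.1.1), rfl, ?_, ?_⟩
  · exact (congrArg (fun f => AgreesOn (Ioi 0) f _) (h1 (u.1.1, u.2.1))).mpr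
      (agreesOn_mellinRow hχ t1 t2 hψ)
  · exact (congrArg (fun f => AgreesOn (Ioi 0) f _) (h1 (u.2.1, u.1.1))).mpr
      (agreesOn_mellinRow hχ t2 t1 hφ)

/-- The isomorphism of the unknowns commutes with an even cut-off `g` up to the multiplication by
`∂g` in the first component, which is compact. -/
theorem isCompactOperator_unknowns_commutator (hp : p ≠ ⊤) {g : 𝓢(ℝ, ℂ)} (hg : HasCompactSupport g)
    (hge : ∀ x, g (-x) = g x)
    {P : (mixedSystem ρ).Unknowns p ≃L[ℂ] (mellinSystem ρ).Unknowns p}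
    (hP : ∀ u, Besov.dist ((P u).1 : Besov (mellinSystem ρ).σ₁ p) =
        D (Besov.dist (u.1 : Besov (mixedSystem ρ).σ₁ p)) +
          Besov.dist (u.1 : Besov (mixedSystem ρ).σ₁ p) ∧
      Besov.dist ((P u).2 : Besov (mellinSystem ρ).σ₂ p) =
        refl (Besov.dist (u.2 : Besov (mixedSystem ρ).σ₂ p))) :
    IsCompactOperator ((P : _ →L[ℂ] (mellinSystem ρ).Unknowns p) ∘L cutU (mixedSystem ρ) hp g -
      cutU (mellinSystem ρ) hp g ∘L (P : (mixedSystem ρ).Unknowns p →L[ℂ] _)) := by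
  obtain ⟨K, h1, c1⟩ := exists_compact_mul (p := p) hp (hasCompactSupport_derivCLM hg)
    (show ρ = ρ - 1 + 1 by ring)
  have hK : ∀ f : Besov ρ p, Distribution.IsVanishingOn (Besov.dist f) (closure (Ioi 0))ᶜ →
      Distribution.IsVanishingOn (Besov.dist (K f)) (closure (Ioi 0))ᶜ := fun f hf => by
    rw [h1]; exact isVanishingOn_smulD _ hf
  have c2 := isCompactOperator_tildeMap hp hK c1
  have e : ((P : _ →L[ℂ] (mellinSystem ρ).Unknowns p) ∘L cutU (mixedSystem ρ) hp g -
      cutU (mellinSystem ρ) hp g ∘L (P : (mixedSystem ρ).Unknowns p →L[ℂ] _)) =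
      (ContinuousLinearMap.inl ℂ _ (BesovTilde (ρ - 1) p (Ioi 0))) ∘L
        tildeMap K (Ioi 0) (Ioi 0) hK ∘L ContinuousLinearMap.fst ℂ _ _ := by
    refine ContinuousLinearMap.ext fun u => unknowns_ext ?_ ?_
    · change Besov.dist (((P (cutU (mixedSystem ρ) hp g u)).1 : Besov (mellinSystem ρ).σ₁ p) -
        ((cutU (mellinSystem ρ) hp g (P u)).1 : Besov (mellinSystem ρ).σ₁ p)) =
        Besov.dist (K u.1.1)
      refine Eq.trans ?_ (h1 u.1.1).symm
      rw [map_sub Besov.dist, (hP _).1, cutU_fst, cutU_fst, dist_mulB, dist_mulB, (hP _).1,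
        D_smulD, map_add (smulD g)]
      abel
    · change Besov.dist (((P (cutU (mixedSystem ρ) hp g u)).2 : Besov (mellinSystem ρ).σ₂ p) -
        ((cutU (mellinSystem ρ) hp g (P u)).2 : Besov (mellinSystem ρ).σ₂ p)) =
        Besov.dist (0 : Besov (mellinSystem ρ).σ₂ p)
      rw [map_sub Besov.dist, (hP _).2, cutU_snd, cutU_snd, dist_mulB, dist_mulB, (hP _).2,
        refl_smulD_of_even hge, sub_self, map_zero]
  rw [e]
  exact isCompactOperator_comp c2 _ _

/-- The isomorphism of the right-hand sides commutes with an even cut-off `h` up to the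
multiplication by `∂h` in the first component, which is compact. -/
theorem isCompactOperator_data_commutator (hp : p ≠ ⊤) {h : 𝓢(ℝ, ℂ)} (hh : HasCompactSupport h)
    (hhe : ∀ x, h (-x) = h x) {F : Besov ρ p ≃L[ℂ] Besov (ρ - 1) p}
    (hF : ∀ f, Besov.dist (F f) = D (Besov.dist f) - Besov.dist f)
    {Q : (mixedSystem ρ).Data p ≃L[ℂ] (mellinSystem ρ).Data p}
    (hQ : ∀ (f₁ : Besov ρ p) (f₂ : Besov (ρ - 1) p), Q (f₁.restrict (Ioi 0), f₂.restrict (Iio 0)) =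
        ((F f₁).restrict (Ioi 0), (reflB (ρ - 1) f₂).restrict (Ioi 0))) :
    IsCompactOperator ((Q : _ →L[ℂ] (mellinSystem ρ).Data p) ∘L cutY (mixedSystem ρ) hp h -
      cutY (mellinSystem ρ) hp h ∘L (Q : (mixedSystem ρ).Data p →L[ℂ] _)) := by
  obtain ⟨K, h1, c1⟩ := exists_compact_mul (p := p) hp (hasCompactSupport_derivCLM hh)
    (show ρ = ρ - 1 + 1 by ring)
  have hK : ∀ f : Besov ρ p, Distribution.IsVanishingOn (Besov.dist f) (Ioi 0) →
      Distribution.IsVanishingOn (Besov.dist (K f)) (Ioi 0) := fun f hf => by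
    rw [h1]; exact isVanishingOn_smulD _ hf
  have c2 := isCompactOperator_onMap hK c1
  have e : ((Q : _ →L[ℂ] (mellinSystem ρ).Data p) ∘L cutY (mixedSystem ρ) hp h -
      cutY (mellinSystem ρ) hp h ∘L (Q : (mixedSystem ρ).Data p →L[ℂ] _)) =
      (ContinuousLinearMap.inl ℂ _ (BesovOn (ρ - 1) p (Ioi 0))) ∘L
        onMap K (Ioi 0) (Ioi 0) hK ∘L ContinuousLinearMap.fst ℂ _ _ := by
    have e1 : ∀ f : Besov ρ p, F (mulB hp ρ h f) - mulB hp (ρ - 1) h (F f) = K f := fun f =>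
      dist_injective (by
        rw [map_sub Besov.dist, hF, dist_mulB, dist_mulB, hF, h1, D_smulD, map_sub (smulD h)]
        abel)
    have e2 : ∀ f : Besov (ρ - 1) p,
        reflB (ρ - 1) (mulB hp (ρ - 1) h f) - mulB hp (ρ - 1) h (reflB (ρ - 1) f) = 0 := fun f =>
      dist_injective (by
        rw [map_sub Besov.dist, dist_reflB, dist_mulB, dist_mulB, dist_reflB,
          refl_smulD_of_even hhe, sub_self, map_zero])
    refine ContinuousLinearMap.ext fun y => ?_
    obtain ⟨f₁, f₂, rfl⟩ := data_cases y
    have e3 := congrArg₂ (fun a b => a - cutY (mellinSystem ρ) hp h b)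
      (hQ (mulB hp ρ h f₁) (mulB hp (ρ - 1) h f₂)) (hQ f₁ f₂)
    exact e3.trans (congrArg₂ (fun (a b : Besov (ρ - 1) p) =>
      (a.restrict (Ioi 0), b.restrict (Ioi 0))) (e1 f₁) (e2 f₂))
  rw [e]
  exact isCompactOperator_comp c2 _ _

/-- The localized systems are intertwined modulo compact operators by `(φ, ψ) ↦ (∂φ + φ, Jψ)` on the
unknowns and `(G, H) ↦ (∂G - G, JH)` on the right-hand sides. -/
theorem exists_intertwined (hp : p ≠ ⊤) (ρ : ℝ) {h g : 𝓢(ℝ, ℂ)} (hh : IsEvenCutoff h)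
    (hg : IsEvenCutoff g) :
    ∃ (P : (mixedSystem ρ).Unknowns p ≃L[ℂ] (mellinSystem ρ).Unknowns p)
      (Q : (mixedSystem ρ).Data p ≃L[ℂ] (mellinSystem ρ).Data p)
      (T : (mixedSystem ρ).Unknowns p →L[ℂ] (mixedSystem ρ).Data p)
      (T' : (mellinSystem ρ).Unknowns p →L[ℂ] (mellinSystem ρ).Data p),
      (mixedSystem ρ).IsLocalization h g T ∧ (mellinSystem ρ).IsLocalization h g T' ∧
      Intertwined P Q (1 / 2) T T' (cutU (mixedSystem ρ) hp g) (cutU (mellinSystem ρ) hp g)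
        (cutY (mixedSystem ρ) hp h) (cutY (mellinSystem ρ) hp h) := by
  obtain ⟨P, hP⟩ := exists_unknownsEquiv hp ρ
  obtain ⟨F, Q, hF, hQ⟩ := exists_dataEquiv hp ρ
  obtain ⟨χ, R, hχ⟩ := exists_truncates hh.cutoff.compact hg.cutoff.compact
  have e : ρ = ρ - 1 + 1 := by ring
  obtain ⟨A₁, h1⟩ := exists_mixedRow₁ (p := p) hp hχ.compact h g e
  obtain ⟨A₂, h2⟩ := exists_mixedRow₂ (p := p) hp hχ.compact h g e
  obtain ⟨B, h3⟩ := exists_mellinRow (p := p) hp hχ.compact h g (ρ - 1)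
  obtain ⟨K₁, c1, k1⟩ := exists_compact_remainder₁ (p := p) (g := g) hp hχ.compact
    hh.cutoff.compact e
  obtain ⟨K₂, c2, k2⟩ := exists_compact_remainder₂ (p := p) (h := h) hp hχ.compact
    hg.cutoff.compact e
  refine ⟨P, Q, _, _, isLocalization_mixed hχ h1 h2, isLocalization_mellin hχ h3, by norm_num, ?_,
    isCompactOperator_unknowns_commutator hp hg.cutoff.compact hg.even hP,
    isCompactOperator_data_commutator hp hh.cutoff.compact hh.even hF hQ⟩
  have c3 := isCompactOperator_pairOp (I₁ := Ioi 0) (I₂ := Iio 0) (J₁ := Ioi 0) (J₂ := Ioi 0) c1 c2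
  refine (congrArg (fun A : (mixedSystem ρ).Unknowns p →L[ℂ] (mellinSystem ρ).Data p =>
    IsCompactOperator A) (ContinuousLinearMap.ext fun u => ?_)).mpr c3
  have d1 : ∀ (φ ψ : Besov (ρ - 1) p) (v : Besov ρ p × Besov (ρ - 1) p),
      Besov.dist φ = D (Besov.dist v.1) + Besov.dist v.1 → Besov.dist ψ = refl (Besov.dist v.2) →
      F (A₁ v) - (1 / 2 : ℂ) • B (φ, ψ) = K₁ v := fun φ ψ v hφ hψ => dist_injective (by
    rw [map_sub Besov.dist, map_smul Besov.dist, hF, h1, h3, k1, hφ, hψ]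
    exact mixedRow₁_sub_mellinRow hg.even _ _)
  have d2 : ∀ (φ ψ : Besov (ρ - 1) p) (v : Besov ρ p × Besov (ρ - 1) p),
      Besov.dist φ = D (Besov.dist v.1) + Besov.dist v.1 → Besov.dist ψ = refl (Besov.dist v.2) →
      reflB (ρ - 1) (A₂ v) - (1 / 2 : ℂ) • B (ψ, φ) = K₂ v := fun φ ψ v hφ hψ => dist_injective (by
    rw [map_sub Besov.dist, map_smul Besov.dist, dist_reflB, h2, h3, k2, hφ, hψ]
    exact mixedRow₂_sub_mellinRow hχ.compact hχ.even hh.even hg.even _ _)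
  have e1 := d1 (P u).1.1 (P u).2.1 (u.1.1, u.2.1) (hP u).1 (hP u).2
  have e2 := d2 (P u).1.1 (P u).2.1 (u.1.1, u.2.1) (hP u).1 (hP u).2
  have e3 := congrArg (fun y => y - (1 / 2 : ℂ) • pairOp (ρ - 1) (ρ - 1) (ρ - 1) (ρ - 1) p (Ioi 0)
    (Ioi 0) (Ioi 0) (Ioi 0) B (B ∘L (ContinuousLinearMap.snd ℂ _ _).prod
      (ContinuousLinearMap.fst ℂ _ _)) (P u)) (hQ (A₁ (u.1.1, u.2.1)) (A₂ (u.1.1, u.2.1)))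
  exact e3.trans (congrArg₂ (fun (a b : Besov (ρ - 1) p) =>
      (a.restrict (Ioi 0), b.restrict (Ioi 0))) e1 e2)

theorem hasLeftLocalInverse_iff (hp : p ≠ ⊤) (ρ : ℝ) :
    (mixedSystem ρ).HasLeftLocalInverse p ↔ (mellinSystem ρ).HasLeftLocalInverse p := by
  constructor
  · intro h
    obtain ⟨g, k, hg, hk, hL⟩ :=
      exists_left_of_hasLeftLocalInverse hp isHalfLine_Ioi isHalfLine_Iio h
    obtain ⟨P, Q, T, T', hT, hT', hI⟩ := exists_intertwined hp ρ hk hg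
    obtain ⟨L, hL⟩ := hL T hT
    obtain ⟨L', hL'⟩ := hI.exists_left hL
    exact ⟨g, k, hg.cutoff, hk.cutoff, T', hT', _, isMulUnknowns_cutU _ hp g, L', hL'⟩
  · intro h
    obtain ⟨g, k, hg, hk, hL⟩ :=
      exists_left_of_hasLeftLocalInverse hp isHalfLine_Ioi isHalfLine_Ioi h
    obtain ⟨P, Q, T, T', hT, hT', hI⟩ := exists_intertwined hp ρ hk hg
    obtain ⟨L, hL⟩ := hL T' hT'
    obtain ⟨L', hL'⟩ := hI.symm.exists_left hL
    exact ⟨g, k, hg.cutoff, hk.cutoff, T, hT, _, isMulUnknowns_cutU _ hp g, L', hL'⟩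

theorem hasRightLocalInverse_iff (hp : p ≠ ⊤) (ρ : ℝ) :
    (mixedSystem ρ).HasRightLocalInverse p ↔ (mellinSystem ρ).HasRightLocalInverse p := by
  constructor
  · intro h
    obtain ⟨g, k, hg, hk, hR⟩ :=
      exists_right_of_hasRightLocalInverse hp isHalfLine_Ioi isHalfLine_Iio h
    obtain ⟨P, Q, T, T', hT, hT', hI⟩ := exists_intertwined hp ρ hg hk
    obtain ⟨R, hR⟩ := hR T hT
    obtain ⟨R', hR'⟩ := hI.exists_right hR
    exact ⟨g, k, hg.cutoff, hk.cutoff, T', hT', _, isMulData_cutY _ hp g, R', hR'⟩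
  · intro h
    obtain ⟨g, k, hg, hk, hR⟩ :=
      exists_right_of_hasRightLocalInverse hp isHalfLine_Ioi isHalfLine_Ioi h
    obtain ⟨P, Q, T, T', hT, hT', hI⟩ := exists_intertwined hp ρ hg hk
    obtain ⟨R, hR⟩ := hR T' hT'
    obtain ⟨R', hR'⟩ := hI.symm.exists_right hR
    exact ⟨g, k, hg.cutoff, hk.cutoff, T, hT, _, isMulData_cutY _ hp g, R', hR'⟩

end BesovLine

end

theorem lemma1 (p : ℝ≥0∞) [Fact (1 ≤ p)] (hp : 1 < p) (hp' : p < ⊤)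
    (s r : ℝ) (hs : 1 / p.toReal < s) (hr : r = s - 1 / p.toReal) :
    (mixedSystem (s - 1 / p.toReal)).LocallyInvertibleAtZero p ↔
      (mellinSystem r).LocallyInvertibleAtZero p := by
  rw [hr]
  exact and_congr (BesovLine.hasLeftLocalInverse_iff hp'.ne _)
    (BesovLine.hasRightLocalInverse_iff hp'.ne _)
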